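/- **Setting.** Let $p\in\mathbb N\cup\{\infty\}$ and let $(\mathbf x,y)$ be a random pair, $\mathbf x$ with $p$ real coordinates and $y\in\mathbb R$. Let $\mathbf S$ be any fixed (deterministic) $M\times p$ real matrix, and let $\mathcal Q_d,\mathcal Q_s,\mathcal Q_f,\mathcal Q_l,\mathcal Q_p,\mathcal Q_a,\mathcal Q_o$ be randomized quantization operations (for data, sketch, features, labels, parameters, activations, output gradients) which are unbiased, $\mathbb E[\mathcal Q_i(\mathbf u)]=\mathbf u$ for every $\mathbf u$, and which use independent fresh randomness at each step. Write $\tilde{\mathbf x}=\mathcal Q_f(\mathcal Q_s(\mathbf S)\mathcal Q_d(\mathbf x))\in\mathbb R^M$ (the product being a convergent series a.s.), $\mathbf H=\mathbb E[\mathbf x\mathbf x^\top]$, $\mathbf H_f^{(q)}=\mathbb E[\tilde{\mathbf x}\tilde{\mathbf x}^\top]$, and let $\mathbf v^*$ be a minimizer of $\mathbf v\mapsto\frac12\mathbb E[(\langle\tilde{\mathbf x},\mathbf v\rangle-\mathcal Q_l(y))^2]$, where $\mathbb E[\mathcal Q_l(y)^2]<\infty$. Put $\xi=\mathcal Q_l(y)-\langle\mathbf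 v^*,\tilde{\mathbf x}\rangle$. Below, $\preceq$ is the Loewner order. Assume: * $\mathbf H$ and $\mathbf H_f^{(q)}$ have finite entries and finite trace, and $\mathbf H$ is strictly positive definite; * $\tilde{\mathbf x}$ has finite fourth moment and there are $\alpha,\beta>0$ such that for all positive semidefinite $\mathbf A$, $$\mathbf H_f^{(q)}\mathbf A\mathbf H_f^{(q)}+\beta\,\mathrm{tr}(\mathbf H_f^{(q)}\mathbf A)\mathbf H_f^{(q)}\preceq\mathbb E[\tilde{\mathbf x}\tilde{\mathbf x}^\top\mathbf A\tilde{\mathbf x}\tilde{\mathbf x}^\top]\preceq\alpha\,\mathrm{tr}(\mathbf H_f^{(q)}\mathbf A)\mathbf H_f^{(q)};$$ * there are $\underline\sigma,\overline\sigma>0$ with $\underline\sigma^2\mathbf H_f^{(q)}\preceq\mathbb E[\xi^2\tilde{\mathbf x}\tilde{\mathbf x}^\top]\preceq\overline\sigma^2\mathbf H_f^{(q)}$ (finite). Let $N\ge1$, $\gamma>0$. With i.i.d. samples $(\mathbf x_t,y_t)$ and features $\tilde{\mathbf x}_t=\mathcal Q_f(\mathcal Q_s(\mathbf S)\mathcal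 Q_d(\mathbf x_t))$, quantized SGD is $\mathbf v_0=0$ and, for $t\ge 1$, $$a_t=\tilde{\mathbf x}_t^\top\mathcal Q_p(\mathbf v_{t-1}),\quad o_t=\mathcal Q_l(y_t)-\mathcal Q_a(a_t),\quad \mathbf v_t=\mathbf v_{t-1}+\gamma\,\mathcal Q_o(o_t)\,\tilde{\mathbf x}_t,$$ with output $\overline{\mathbf v}_N=\frac1N\sum_{t=0}^{N-1}\mathbf v_t$ and $R_N^{(0)}=\frac12\big\langle\mathbf H_f^{(q)},\mathbb E[(\mathbf v^*-\overline{\mathbf v}_N)(\mathbf v^*-\overline{\mathbf v}_N)^\top]\big\rangle$, where $\langle\mathbf A,\mathbf B\rangle=\mathrm{tr}(\mathbf A^\top\mathbf B)$. Let $\mathbf H_f^{(q)}=\sum_{i=1}^M\tilde\lambda_i\mathbf u_i\mathbf u_i^\top$ be any eigendecomposition with $(\mathbf u_i)$ orthonormal and $\tilde\lambda_1\ge\dots\ge\tilde\lambda_M$; let $k^*=\max\{i:\tilde\lambda_i\ge 1/(\gamma N)\}$ ($k^*=0$ if there is none), and $$\mathrm{Var}=\frac{k^*}N+N\gamma^2\sum_{i>k^*}\tilde\lambda_i^2,\qquad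 \mathrm{Bias}=\frac1{\gamma^2N^2}\sum_{i\le k^*}\frac{\langle\mathbf u_i,\mathbf v^*\rangle^2}{\tilde\lambda_i}+\sum_{i>k^*}\tilde\lambda_i\langle\mathbf u_i,\mathbf v^*\rangle^2,$$ $$\sigma_{\rm bias}^2=\frac1{N\gamma}\sum_{i\le k^*}\langle\mathbf u_i,\mathbf v^*\rangle^2+\sum_{i>k^*}\tilde\lambda_i\langle\mathbf u_i,\mathbf v^*\rangle^2 .$$ **Theorem.** (1) *General quantization.* Let, with $t$ ranging over $1,\dots,N$ and the last supremum being also the essential supremum over the randomness, $$\sigma_G^2=\overline\sigma^2+\sup_t\alpha\,\mathrm{tr}\big(\mathbf H_f^{(q)}\mathbb E[\boldsymbol\epsilon_{t-1}\boldsymbol\epsilon_{t-1}^\top]\big)+\sup_t\big(\mathbb E[(\mathcal Q_a(a_t)-a_t)^2|a_t]+\mathbb E[(\mathcal Q_o(o_t)-o_t)^2|o_t]\big),\quad \boldsymbol\epsilon_{t-1}=\mathcal Q_p(\mathbf v_{t-1})-\mathbf v_{t-1}.$$ If $\gamma\alpha\,\mathrm{tr}(\mathbf H_f^{(q)})<1$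 and $\sigma_G^2<\infty$ (the bound is void otherwise), then $\overline{\mathbf v}_N$ is square integrable and $$R_N^{(0)}\le 2\,\mathrm{Bias}+2\,\frac{\sigma_G^2+2\alpha\sigma_{\rm bias}^2}{1-\gamma\alpha\,\mathrm{tr}(\mathbf H_f^{(q)})}\,\mathrm{Var}.$$ (2) *Multiplicative quantization.* Let $\overline\epsilon_p,\overline\epsilon_a,\overline\epsilon_o\ge0$ be such that $\mathcal Q_i$ is $\overline\epsilon_i$-multiplicative for $i\in\{p,a,o\}$, that is, $\mathbb E[(\mathcal Q_i(\mathbf u)-\mathbf u)(\mathcal Q_i(\mathbf u)-\mathbf u)^\top]\preceq\overline\epsilon_i\mathbf u\mathbf u^\top$ (finite) for all $\mathbf u$. Put $$\tilde\epsilon=4\overline\epsilon_o+2(2\overline\epsilon_o+1)[2(1+\overline\epsilon_p)\overline\epsilon_a+2\overline\epsilon_p],$$ $$\sigma_M^2=(2\overline\epsilon_o+1)\overline\sigma^2+(2\overline\epsilon_o+1)[2\overline\epsilon_p+2(1+\overline\epsilon_p)\overline\epsilon_a]\,\alpha\,\mathrm{tr}(\mathbf H_f^{(q)}\mathbf v^*{\mathbf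 v^*}^\top).$$ If $(1+\tilde\epsilon)\gamma\alpha\,\mathrm{tr}(\mathbf H_f^{(q)})<1$, then $\overline{\mathbf v}_N$ is square integrable and $$R_N^{(0)}\le 2\,\mathrm{Bias}+2\,\frac{\sigma_M^2+2(1+\tilde\epsilon)\alpha\sigma_{\rm bias}^2}{1-(1+\tilde\epsilon)\gamma\alpha\,\mathrm{tr}(\mathbf H_f^{(q)})}\,\mathrm{Var}.$$ -/

import Mathlib

open MeasureTheory ProbabilityTheory Filter Topology
open scoped ENNReal Matrix

noncomputable section

namespace QSGD

/-! ### Matrices -/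

/-- The Loewner order `A ⪯ B`. -/
def LoewnerLE {M : ℕ} (A B : Matrix (Fin M) (Fin M) ℝ) : Prop := (B - A).PosSemidef

/-- The outer product `v vᵀ`. -/
def outer {κ : Type*} (v : κ → ℝ) : Matrix κ κ ℝ := Matrix.vecMulVec v v

/-- `‖v‖²_A = vᵀ A v`. -/
def normSq {M : ℕ} (A : Matrix (Fin M) (Fin M) ℝ) (v : Fin M → ℝ) : ℝ := v ⬝ᵥ (A *ᵥ v)

/-- The entrywise expectation of a random matrix. -/
def matE {Ω κ : Type*} [MeasurableSpace Ω] (μ : Measure Ω) (F : Ω → Matrix κ κ ℝ) :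
    Matrix κ κ ℝ := Matrix.of fun i j => ∫ ω, F ω i j ∂μ

/-! ### Stochastic quantization -/

/-- A randomized quantization operation on `κ → ℝ`: a jointly measurable function of its input and
of a random seed. Each call of the operation draws a fresh seed from `law`. -/
structure Quantizer (κ : Type*) where
  Seed : Type
  [mSeed : MeasurableSpace Seed]
  law : Measure Seed
  [prob : IsProbabilityMeasure law]
  map : (κ → ℝ) → Seed → (κ → ℝ)
  measurable_map : Measurable fun z : (κ → ℝ) × Seed => map z.1 z.2

attribute [instance] Quantizer.mSeed Quantizer.prob

namespace Quantizer

/-- `E[Q(u) | u] = u` for every input `u`. -/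
def Unbiased {κ : Type*} (Q : Quantizer κ) : Prop :=
  ∀ (u : κ → ℝ) (k : κ), Integrable (fun s => Q.map u s k) Q.law ∧ ∫ s, Q.map u s k ∂Q.law = u k

/-- The second moment of the quantization error at `u`, `E[(Q(u) - u)(Q(u) - u)ᵀ | u]`. -/
def errCov {κ : Type*} (Q : Quantizer κ) (u : κ → ℝ) : Matrix κ κ ℝ :=
  matE Q.law fun s => outer (Q.map u s - u)

/-- `Q` is `ε`-multiplicative: `E[(Q(u) - u)(Q(u) - u)ᵀ | u] ⪯ ε u uᵀ`, the second moment
being finite. -/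
def Multiplicative {κ : Type*} (Q : Quantizer κ) (ε : ℝ) : Prop :=
  ∀ u : κ → ℝ, (∀ k, MemLp (fun s => Q.map u s k) 2 Q.law) ∧
    (ε • outer u - Q.errCov u).PosSemidef

/-- The action of a quantizer of scalars. -/
def scalar (Q : Quantizer Unit) (r : ℝ) (s : Q.Seed) : ℝ := Q.map (fun _ => r) s ()

/-- `E[(Q(r) - r)² | r]` for a quantizer of scalars, with values in `[0, ∞]`. -/
def scalarErr (Q : Quantizer Unit) (r : ℝ) : ℝ≥0∞ :=
  ∫⁻ s, ENNReal.ofReal ((Q.scalar r s - r) ^ 2) ∂Q.law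

end Quantizer

/-! ### Quantized sketched linear regression -/

/-- The coordinates of the data space, of finite or countably infinite dimension `p`. -/
abbrev Coord (p : ℕ∞) : Type := {j : ℕ // (j : ℕ∞) < p}

/-- The `n`-th partial sum of the `i`-th entry of the product `S x`. -/
def partialSketch {M : ℕ} {p : ℕ∞} (S : Fin M → Coord p → ℝ) (x : Coord p → ℝ) (i : Fin M)
    (n : ℕ) : ℝ :=
  ∑ j ∈ Finset.range n, if h : (j : ℕ∞) < p then S i ⟨j, h⟩ * x ⟨j, h⟩ else 0

/-- The matrix-vector product `S x` (a finite sum for finite `p`, a series for `p = ∞`). -/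
def sketch {M : ℕ} {p : ℕ∞} (S : Fin M → Coord p → ℝ) (x : Coord p → ℝ) : Fin M → ℝ :=
  fun i => limUnder atTop (partialSketch S x i)

/-- The data of the problem: the joint law of `(x, y)`, the (fixed) sketch matrix `S` and the
quantizers of data, sketch matrix, features, labels, parameters, activations and output
gradients. -/
structure Model (p : ℕ∞) (M : ℕ) where
  data : Measure ((Coord p → ℝ) × ℝ)
  [probData : IsProbabilityMeasure data]
  S : Fin M → Coord p → ℝ
  Qd : Quantizer (Coord p)
  Qs : Quantizer (Fin M × Coord p)
  Qf : Quantizer (Fin M)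
  Ql : Quantizer Unit
  Qp : Quantizer (Fin M)
  Qa : Quantizer Unit
  Qo : Quantizer Unit

attribute [instance] Model.probData

namespace Model

variable {p : ℕ∞} {M : ℕ} (m : Model p M)

/-- Everything that is drawn in one step: a data point `(x, y)`, the seeds of
`Q_d, Q_s, Q_f, Q_l`, and the seeds of `Q_p, Q_a, Q_o`. -/
abbrev Sample : Type :=
  ((Coord p → ℝ) × ℝ) × (m.Qd.Seed × m.Qs.Seed × m.Qf.Seed × m.Ql.Seed) ×
    (m.Qp.Seed × m.Qa.Seed × m.Qo.Seed)

/-- The law of one step: the data point and all the seeds are independent. -/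
def law : Measure m.Sample :=
  m.data.prod ((m.Qd.law.prod (m.Qs.law.prod (m.Qf.law.prod m.Ql.law))).prod
    (m.Qp.law.prod (m.Qa.law.prod m.Qo.law)))

/-- The quantized sketch matrix `Q_s(S)`. -/
def quantS (z : m.Sample) : Fin M → Coord p → ℝ :=
  fun i j => m.Qs.map (fun k => m.S k.1 k.2) z.2.1.2.1 (i, j)

/-- The quantized data vector `Q_d(x)`. -/
def quantX (z : m.Sample) : Coord p → ℝ := m.Qd.map z.1.1 z.2.1.1

/-- The quantized feature `Q_f(Q_s(S) Q_d(x))`. -/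
def feature (z : m.Sample) : Fin M → ℝ :=
  m.Qf.map (sketch (m.quantS z) (m.quantX z)) z.2.1.2.2.1

/-- The quantized label `Q_l(y)`. -/
def label (z : m.Sample) : ℝ := m.Ql.scalar z.1.2 z.2.1.2.2.2

/-- The product `Q_s(S) Q_d(x)` almost surely makes sense, and the quantized label is
square integrable, so that the quantized population risk is finite. -/
structure WellPosed : Prop where
  converges : ∀ᵐ z ∂m.law, ∀ i, ∃ l, Tendsto (partialSketch (m.quantS z) (m.quantX z) i) atTop (𝓝 l)
  label_sq : MemLp m.label 2 m.law

/-- The data covariance `H = E[x xᵀ]`. -/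
def covH : Matrix (Coord p) (Coord p) ℝ := matE m.data fun w => outer w.1

/-- The quantized feature covariance `H_f^{(q)}`. -/
def covHf : Matrix (Fin M) (Fin M) ℝ := matE m.law fun z => outer (m.feature z)

/-- The quantized population risk. -/
def riskq (v : Fin M → ℝ) : ℝ := (1 / 2) * ∫ z, (m.feature z ⬝ᵥ v - m.label z) ^ 2 ∂m.law

/-! ### Assumptions -/

/-- All quantizers are unbiased. -/
structure UnbiasedQuantization : Prop where
  d : m.Qd.Unbiased
  s : m.Qs.Unbiased
  f : m.Qf.Unbiased
  l : m.Ql.Unbiased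
  p : m.Qp.Unbiased
  a : m.Qa.Unbiased
  o : m.Qo.Unbiased

/-- `H` and `H_f^{(q)}` have finite entries and finite traces, and `H` is strictly positive
definite as an operator on the square summable sequences. -/
structure DataCovariance : Prop where
  sq_x : ∀ j, MemLp (fun w : (Coord p → ℝ) × ℝ => w.1 j) 2 m.data
  trace_H : Summable fun j => m.covH j j
  posDef_H : ∀ u : Coord p → ℝ, Summable (fun j => u j ^ 2) → u ≠ 0 →
    0 < ∑' j, ∑' k, u j * m.covH j k * u k
  sq_feature : ∀ i, MemLp (fun z => m.feature z i) 2 m.law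

/-- `E[x̃ x̃ᵀ A x̃ x̃ᵀ]` for the quantized feature `x̃`. -/
def fourthMoment (A : Matrix (Fin M) (Fin M) ℝ) : Matrix (Fin M) (Fin M) ℝ :=
  matE m.law fun z => outer (m.feature z) * A * outer (m.feature z)

/-- The fourth-moment condition with constants `α, β`. -/
structure FourthMomentCondition (α β : ℝ) : Prop where
  pos_α : 0 < α
  pos_β : 0 < β
  finite : ∀ i, MemLp (fun z => m.feature z i) 4 m.law
  lower : ∀ A : Matrix (Fin M) (Fin M) ℝ, A.PosSemidef →
    LoewnerLE (m.covHf * A * m.covHf + (β * (m.covHf * A).trace) • m.covHf) (m.fourthMoment A)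
  upper : ∀ A : Matrix (Fin M) (Fin M) ℝ, A.PosSemidef →
    LoewnerLE (m.fourthMoment A) ((α * (m.covHf * A).trace) • m.covHf)

/-- `ξ = Q_l(y) - ⟨v*, x̃⟩`. -/
def residual (vstar : Fin M → ℝ) (z : m.Sample) : ℝ := m.label z - vstar ⬝ᵥ m.feature z

/-- The noise condition with constants `σlo, σhi`, at the global optimum `vstar`. -/
structure NoiseCondition (vstar : Fin M → ℝ) (σlo σhi : ℝ) : Prop where
  pos_lo : 0 < σlo
  pos_hi : 0 < σhi
  finite : ∀ i j, Integrable
    (fun z => m.residual vstar z ^ 2 * (m.feature z i * m.feature z j)) m.law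
  lower : LoewnerLE (σlo ^ 2 • m.covHf)
    (matE m.law fun z => m.residual vstar z ^ 2 • outer (m.feature z))
  upper : LoewnerLE (matE m.law fun z => m.residual vstar z ^ 2 • outer (m.feature z))
    (σhi ^ 2 • m.covHf)

/-! ### Quantized SGD -/

/-- The quantized parameters `Q_p(v)`. -/
def quantV (z : m.Sample) (v : Fin M → ℝ) : Fin M → ℝ := m.Qp.map v z.2.2.1

/-- The activation `a = x̃ᵀ Q_p(v)`. -/
def act (z : m.Sample) (v : Fin M → ℝ) : ℝ := m.feature z ⬝ᵥ m.quantV z v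

/-- The output gradient `o = Q_l(y) - Q_a(a)`. -/
def outGrad (z : m.Sample) (v : Fin M → ℝ) : ℝ := m.label z - m.Qa.scalar (m.act z v) z.2.2.2.1

/-- The quantized output gradient `Q_o(o)`. -/
def quantOutGrad (z : m.Sample) (v : Fin M → ℝ) : ℝ := m.Qo.scalar (m.outGrad z v) z.2.2.2.2

/-- The iterates `v_0 = 0`, `v_{t+1} = v_t + γ Q_o(o) x̃`; step `t + 1` uses the sample `Z t`. -/
def iterate (γ : ℝ) (Z : ℕ → m.Sample) : ℕ → Fin M → ℝ
  | 0 => 0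
  | t + 1 => iterate γ Z t +
      (γ * m.quantOutGrad (Z t) (iterate γ Z t)) • m.feature (Z t)

/-- The averaged iterate `N⁻¹ ∑_{t < N} v_t`. -/
def average (γ : ℝ) (Z : ℕ → m.Sample) (N : ℕ) : Fin M → ℝ :=
  (N : ℝ)⁻¹ • ∑ t ∈ Finset.range N, m.iterate γ Z t

section Dynamics

variable {Ω : Type*} [MeasurableSpace Ω] (μ : Measure Ω) (Z : ℕ → Ω → m.Sample)

/-- `Z` is an i.i.d. sequence of draws of the randomness of one step. -/
structure IsSampling : Prop where
  measurable : ∀ t, Measurable (Z t)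
  law_eq : ∀ t, μ.map (Z t) = m.law
  indep : iIndepFun Z μ

/-- The iterate `v_t` as a random vector. -/
def randIterate (γ : ℝ) (t : ℕ) (ω : Ω) : Fin M → ℝ := m.iterate γ (fun s => Z s ω) t

/-- The random deviation `v* - v̄_N`. -/
def deviation (γ : ℝ) (N : ℕ) (vstar : Fin M → ℝ) (ω : Ω) : Fin M → ℝ :=
  vstar - m.average γ (fun s => Z s ω) N

/-- `R_N^{(0)} = ½ ⟨H_f^{(q)}, E[(v* - v̄_N)(v* - v̄_N)ᵀ]⟩` with `⟨A, B⟩ = tr(Aᵀ B)`. -/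
def excessRisk (γ : ℝ) (N : ℕ) (vstar : Fin M → ℝ) : ℝ :=
  (1 / 2) * (m.covHfᵀ * matE μ fun ω => outer (m.deviation Z γ N vstar ω)).trace

/-- `tr(H_f^{(q)} E[ε εᵀ])` for the parameter quantization error `ε = Q_p(v_t) - v_t`, with the
expectation taken in `[0, ∞]`. -/
def paramErr (γ : ℝ) (t : ℕ) : ℝ≥0∞ :=
  ∫⁻ ω, ENNReal.ofReal ((m.covHf *
    outer (m.quantV (Z t ω) (m.randIterate Z γ t ω) - m.randIterate Z γ t ω)).trace) ∂μ

/-- `E[(Q_a(a) - a)² | a] + E[(Q_o(o) - o)² | o]` in step `t + 1`. -/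
def actGradErr (γ : ℝ) (t : ℕ) (ω : Ω) : ℝ≥0∞ :=
  m.Qa.scalarErr (m.act (Z t ω) (m.randIterate Z γ t ω)) +
    m.Qo.scalarErr (m.outGrad (Z t ω) (m.randIterate Z γ t ω))

/-- `σ_G² = σhi² + sup_t α tr(H_f^{(q)} E[ε εᵀ]) + sup_t (E[(Q_a(a) - a)² | a] + E[(Q_o(o) - o)² | o])`,
over the steps `1, …, N`; the last supremum is also the essential one over the randomness. -/
def sigmaG2 (γ : ℝ) (N : ℕ) (α σhi : ℝ) : ℝ≥0∞ :=
  ENNReal.ofReal (σhi ^ 2) + (⨆ t : Fin N, ENNReal.ofReal α * m.paramErr μ Z γ t) +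
    ⨆ t : Fin N, essSup (m.actGradErr Z γ t) μ

end Dynamics

end Model

/-! ### Spectral quantities -/

/-- `H = ∑ i, lam i • u i (u i)ᵀ` with `u` orthonormal and `lam` non-increasing. -/
structure IsEigendecomposition {M : ℕ} (H : Matrix (Fin M) (Fin M) ℝ) (lam : Fin M → ℝ)
    (u : Fin M → Fin M → ℝ) : Prop where
  antitone : Antitone lam
  orthonormal : ∀ i j, u i ⬝ᵥ u j = if i = j then 1 else 0
  decomp : H = ∑ i, lam i • outer (u i)

/-- `k* = max {i ∈ {1, …, M} : λ_i ≥ 1 / (γ N)}`, and `0` if there is no such `i`; the eigenvalue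
`λ_i` is `lam (i - 1)`. -/
def kStar {M : ℕ} (lam : Fin M → ℝ) (γ : ℝ) (N : ℕ) : ℕ :=
  (Finset.univ.filter fun i : Fin M => 1 / (γ * N) ≤ lam i).sup fun i => (i : ℕ) + 1

/-- `I_{0:k}`. -/
def headProj {M : ℕ} (u : Fin M → Fin M → ℝ) (k : ℕ) : Matrix (Fin M) (Fin M) ℝ :=
  ∑ i : Fin M, if (i : ℕ) < k then outer (u i) else 0

/-- `(H_{0:k})⁻¹`, the inverse on the span of the first `k` eigenvectors. -/
def headInv {M : ℕ} (lam : Fin M → ℝ) (u : Fin M → Fin M → ℝ) (k : ℕ) :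
    Matrix (Fin M) (Fin M) ℝ :=
  ∑ i : Fin M, if (i : ℕ) < k then (lam i)⁻¹ • outer (u i) else 0

/-- `H_{k:∞}`. -/
def tailH {M : ℕ} (lam : Fin M → ℝ) (u : Fin M → Fin M → ℝ) (k : ℕ) :
    Matrix (Fin M) (Fin M) ℝ :=
  ∑ i : Fin M, if (i : ℕ) < k then 0 else lam i • outer (u i)

/-- `k* / N + N γ² ∑_{i > k*} λ_i²`. -/
def varFactor {M : ℕ} (lam : Fin M → ℝ) (γ : ℝ) (N : ℕ) : ℝ :=
  (kStar lam γ N : ℝ) / N +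
    N * γ ^ 2 * ∑ i : Fin M, if (i : ℕ) < kStar lam γ N then 0 else lam i ^ 2

/-- `(γ N)⁻² ‖v*‖²_{(H_{0:k*})⁻¹} + ‖v*‖²_{H_{k*:∞}}`. -/
def biasBound {M : ℕ} (lam : Fin M → ℝ) (u : Fin M → Fin M → ℝ) (γ : ℝ) (N : ℕ)
    (vstar : Fin M → ℝ) : ℝ :=
  1 / (γ ^ 2 * (N : ℝ) ^ 2) * normSq (headInv lam u (kStar lam γ N)) vstar +
    normSq (tailH lam u (kStar lam γ N)) vstar

/-- `‖v*‖²_{I_{0:k*}} / (N γ) + ‖v*‖²_{H_{k*:∞}}`. -/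
def sigmaBias2 {M : ℕ} (lam : Fin M → ℝ) (u : Fin M → Fin M → ℝ) (γ : ℝ) (N : ℕ)
    (vstar : Fin M → ℝ) : ℝ :=
  normSq (headProj u (kStar lam γ N)) vstar / (N * γ) +
    normSq (tailH lam u (kStar lam γ N)) vstar

/-- `(σ² + 2 a sigmaBias2) / (1 - γ a tr H) · varFactor`, where `a` is the (possibly amplified)
fourth-moment constant and `σ²` the effective noise level. -/
def varBound {M : ℕ} (H : Matrix (Fin M) (Fin M) ℝ) (lam : Fin M → ℝ) (u : Fin M → Fin M → ℝ)
    (γ : ℝ) (N : ℕ) (vstar : Fin M → ℝ) (a σ2 : ℝ) : ℝ :=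
  (σ2 + 2 * a * sigmaBias2 lam u γ N vstar) / (1 - γ * a * H.trace) * varFactor lam γ N

/-- `ε̃ = 4 ε_o + 2 (2 ε_o + 1) [2 (1 + ε_p) ε_a + 2 ε_p]`. -/
def epsTilde (εp εa εo : ℝ) : ℝ :=
  4 * εo + 2 * (2 * εo + 1) * (2 * (1 + εp) * εa + 2 * εp)

/-- `σ_M² = (2 ε_o + 1) σhi² + (2 ε_o + 1) [2 ε_p + 2 (1 + ε_p) ε_a] α tr(H v* v*ᵀ)`. -/
def sigmaM2 {M : ℕ} (H : Matrix (Fin M) (Fin M) ℝ) (vstar : Fin M → ℝ) (α σhi εp εa εo : ℝ) : ℝ :=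
  (2 * εo + 1) * σhi ^ 2 +
    (2 * εo + 1) * (2 * εp + 2 * (1 + εp) * εa) * α * (H * outer vstar).trace

end QSGD

end

open QSGD

/-! Write x for the feature, ξ for the residual at v* and H for `covHf`. With η_t = v_t - v*, one
step reads η_{t+1} = η_t - γ⟨x, η_t⟩x + γ(ξ + ζ)x, where ζ is the total quantization error of the
output gradient; unbiasedness centres ζ given the past, the feature and the label. Split η_t = B_t +
W_t: B (`biasIterate`) starts at -v* and receives no noise, W (`noiseIterate`) starts at 0 and
receives all of it. Optimality of v* gives E[ξx] = 0, so E W_t = 0.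

Work in the eigenbasis of H. Given the past, the mean of each coordinate ⟨u_i, B_t⟩ and ⟨u_i, W_t⟩
contracts by 1 - γλ_i. For d_i(t) = E⟨u_i, B_t⟩² + E⟨u_i, W_t⟩², the fourth-moment condition with
rank-one A yields (`secondMoment_rec`) d_i(t+1) ≤ (1 - γλ_i) d_i(t) + γ²λ_i (σ² + a Σ_j λ_j d_j(t)).
Although ξ may depend on x, its cross term with the state is linear in the state: it is absent for B
and has mean zero for W.

`average_sq_le` converts contraction of the conditional means into γλ_i E(Σ_t f_t)² ≤ 2 r_i Σ_t E
f_t², with r_i = 1 - (1 - γλ_i)^N, for f_t a coordinate of B_t or of W_t. `spectral_bound` then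
solves the coupled recursion: summing over i bounds Σ_t Σ_j λ_j d_j(t) in terms of itself, which
closes because γ a tr H < 1, and r_i ≤ min(1, Nγλ_i) produces the head and the tail of Bias and Var.

Both regimes are instances of `excessRisk_le` and differ only in (a, σ²): general quantization adds
its noise to σ² and keeps a = α, while multiplicative noise grows with the state, so that part of it
enlarges a to (1 + ε̃)α. Finiteness of moments is not known beforehand, so the quantization noise is
handled by integrals in [0, ∞] until a bound is available. -/

namespace QSGD

/-! ### Measurability of the quantizers and of the maps making up one step -/

namespace Quantizer

theorem measurable_scalar (Q : Quantizer Unit) : Measurable fun w : ℝ × Q.Seed => Q.scalar w.1 w.2 := by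
  have h : Measurable fun w : ℝ × Q.Seed => ((fun _ : Unit => w.1), w.2) :=
    (measurable_pi_lambda _ fun _ => measurable_fst).prodMk measurable_snd
  exact (measurable_pi_apply ()).comp (Q.measurable_map.comp h)

theorem measurable_scalarErr (Q : Quantizer Unit) : Measurable Q.scalarErr :=
  Measurable.lintegral_prod_right' (f := fun w : ℝ × Q.Seed =>
    ENNReal.ofReal ((Q.scalar w.1 w.2 - w.1) ^ 2))
    (((Q.measurable_scalar.sub measurable_fst).pow_const 2).ennreal_ofReal)

end Quantizer

namespace Model

variable {p : ℕ∞} {M : ℕ} (m : Model p M)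

instance : IsProbabilityMeasure m.law := by unfold law; infer_instance

/-- The part of the randomness of one step that determines the feature and the label. -/
abbrev DataSeed : Type := ((Coord p → ℝ) × ℝ) × (m.Qd.Seed × m.Qs.Seed × m.Qf.Seed × m.Ql.Seed)

theorem measurable_quantS : Measurable m.quantS := by
  refine measurable_pi_lambda _ fun i => measurable_pi_lambda _ fun j => ?_
  have h : Measurable fun z : m.Sample => ((fun k : Fin M × Coord p => m.S k.1 k.2), z.2.1.2.1) := by
    fun_prop
  exact (measurable_pi_apply (i, j)).comp (m.Qs.measurable_map.comp h)

theorem measurable_quantX : Measurable m.quantX := by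
  have h : Measurable fun z : m.Sample => (z.1.1, z.2.1.1) := by fun_prop
  exact m.Qd.measurable_map.comp h

theorem measurable_partialSketch (i : Fin M) (n : ℕ) :
    Measurable fun z => partialSketch (m.quantS z) (m.quantX z) i n := by
  unfold partialSketch
  refine Finset.measurable_sum _ fun j _ => ?_
  split_ifs with h
  · exact ((measurable_pi_apply _).comp ((measurable_pi_apply i).comp m.measurable_quantS)).mul
      ((measurable_pi_apply _).comp m.measurable_quantX)
  · exact measurable_const

theorem measurable_sketch : Measurable fun z => sketch (m.quantS z) (m.quantX z) := by
  refine measurable_pi_lambda _ fun i => ?_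
  -- Convergence is not needed: where the partial sums diverge, `limUnder` is a fixed default value.
  exact (StronglyMeasurable.limUnder (l := atTop)
    fun n => (m.measurable_partialSketch i n).stronglyMeasurable).measurable

@[fun_prop]
theorem measurable_feature : Measurable m.feature := by
  have h : Measurable fun z : m.Sample => (sketch (m.quantS z) (m.quantX z), z.2.1.2.2.1) :=
    m.measurable_sketch.prodMk (by fun_prop)
  exact m.Qf.measurable_map.comp h

@[fun_prop]
theorem measurable_label : Measurable m.label := by
  have h : Measurable fun z : m.Sample => (z.1.2, z.2.1.2.2.2) := by fun_prop
  exact m.Ql.measurable_scalar.comp h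

theorem measurable_dot {𝒳 : Type*} [MeasurableSpace 𝒳] {f g : 𝒳 → Fin M → ℝ} (hf : Measurable f)
    (hg : Measurable g) : Measurable fun s => f s ⬝ᵥ g s := by
  unfold dotProduct
  exact Finset.measurable_sum _ fun i _ =>
    ((measurable_pi_apply i).comp hf).mul ((measurable_pi_apply i).comp hg)

section

variable {𝒳 : Type*} [MeasurableSpace 𝒳] {f : 𝒳 → m.Sample} {v : 𝒳 → Fin M → ℝ}

theorem measurable_quantV (hf : Measurable f) (hv : Measurable v) :
    Measurable fun s => m.quantV (f s) (v s) := by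
  have h : Measurable fun s => (v s, (f s).2.2.1) := hv.prodMk (by fun_prop)
  exact m.Qp.measurable_map.comp h

theorem measurable_act (hf : Measurable f) (hv : Measurable v) :
    Measurable fun s => m.act (f s) (v s) :=
  measurable_dot (m.measurable_feature.comp hf) (m.measurable_quantV hf hv)

theorem measurable_outGrad (hf : Measurable f) (hv : Measurable v) :
    Measurable fun s => m.outGrad (f s) (v s) := by
  have h : Measurable fun s => (m.act (f s) (v s), (f s).2.2.2.1) :=
    (m.measurable_act hf hv).prodMk (by fun_prop)
  exact (m.measurable_label.comp hf).sub (m.Qa.measurable_scalar.comp h)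

theorem measurable_quantOutGrad (hf : Measurable f) (hv : Measurable v) :
    Measurable fun s => m.quantOutGrad (f s) (v s) := by
  have h : Measurable fun s => (m.outGrad (f s) (v s), (f s).2.2.2.2) :=
    (m.measurable_outGrad hf hv).prodMk (by fun_prop)
  exact m.Qo.measurable_scalar.comp h

end

end Model

/-! ### Quadratic forms, rank-one matrices and entrywise expectations -/

section Matrices

variable {M : ℕ}

theorem LoewnerLE.normSq_le {A B : Matrix (Fin M) (Fin M) ℝ} (h : LoewnerLE A B) (u : Fin M → ℝ) :
    normSq A u ≤ normSq B u := by
  have := h.dotProduct_mulVec_nonneg u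
  simp only [star_trivial, Matrix.sub_mulVec, dotProduct_sub] at this
  simpa [normSq] using this

theorem dot_outer_mulVec (x a c : Fin M → ℝ) : a ⬝ᵥ (outer x *ᵥ c) = (x ⬝ᵥ a) * (x ⬝ᵥ c) := by
  rw [outer, Matrix.vecMulVec_mulVec, dotProduct_comm a]
  simp [dotProduct_comm, mul_comm]

theorem normSq_outer (x a : Fin M → ℝ) : normSq (outer x) a = (x ⬝ᵥ a) ^ 2 := by
  rw [normSq, dot_outer_mulVec, sq]

theorem normSq_smul (r : ℝ) (A : Matrix (Fin M) (Fin M) ℝ) (a : Fin M → ℝ) :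
    normSq (r • A) a = r * normSq A a := by
  simp [normSq, Matrix.smul_mulVec, dotProduct_smul]

theorem normSq_add_mat (A B : Matrix (Fin M) (Fin M) ℝ) (a : Fin M → ℝ) :
    normSq (A + B) a = normSq A a + normSq B a := by
  simp [normSq, Matrix.add_mulVec, dotProduct_add]

theorem normSq_sum {ι : Type*} (s : Finset ι) (A : ι → Matrix (Fin M) (Fin M) ℝ) (a : Fin M → ℝ) :
    normSq (∑ i ∈ s, A i) a = ∑ i ∈ s, normSq (A i) a := by
  simp [normSq, Matrix.sum_mulVec, dotProduct_sum]

theorem trace_mul_outer (A : Matrix (Fin M) (Fin M) ℝ) (a : Fin M → ℝ) :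
    (A * outer a).trace = normSq A a := by
  rw [outer, Matrix.mul_vecMulVec, Matrix.trace_vecMulVec, normSq, dotProduct_comm]

theorem outer_mul_outer_mul_outer (x a : Fin M → ℝ) :
    outer x * outer a * outer x = ((x ⬝ᵥ a) ^ 2) • outer x := by
  simp only [outer, Matrix.vecMulVec_mul_vecMulVec, Matrix.vecMulVec_smul, Matrix.smul_mul,
    smul_smul, dotProduct_comm a x, sq]

theorem posSemidef_outer (a : Fin M → ℝ) : (outer a).PosSemidef := by
  simpa [outer] using Matrix.posSemidef_vecMulVec_self_star a

theorem integral_dot_mulVec {Ω : Type*} [MeasurableSpace Ω] {μ : Measure Ω}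
    {F : Ω → Matrix (Fin M) (Fin M) ℝ} (hF : ∀ i j, Integrable (fun ω => F ω i j) μ)
    (a c : Fin M → ℝ) :
    ∫ ω, a ⬝ᵥ (F ω *ᵥ c) ∂μ = a ⬝ᵥ (matE μ F *ᵥ c) := by
  simp only [dotProduct, Matrix.mulVec, matE, Matrix.of_apply, Finset.mul_sum]
  rw [integral_finsetSum _ fun i _ => integrable_finsetSum _ fun j _ =>
    ((hF i j).mul_const _).const_mul _]
  refine Finset.sum_congr rfl fun i _ => ?_
  rw [integral_finsetSum _ fun j _ => ((hF i j).mul_const _).const_mul _]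
  refine Finset.sum_congr rfl fun j _ => ?_
  rw [integral_const_mul, integral_mul_const]

theorem normSq_matE {Ω : Type*} [MeasurableSpace Ω] {μ : Measure Ω}
    {F : Ω → Matrix (Fin M) (Fin M) ℝ} (hF : ∀ i j, Integrable (fun ω => F ω i j) μ)
    (a : Fin M → ℝ) : normSq (matE μ F) a = ∫ ω, normSq (F ω) a ∂μ :=
  (integral_dot_mulVec hF a a).symm

theorem memLp_dot {Ω : Type*} [MeasurableSpace Ω] {μ : Measure Ω} {q : ℝ≥0∞}
    {f : Ω → Fin M → ℝ} (hf : ∀ i, MemLp (fun ω => f ω i) q μ) (a : Fin M → ℝ) :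
    MemLp (fun ω => f ω ⬝ᵥ a) q μ := by
  simp only [dotProduct, mul_comm _ (a _)]
  exact memLp_finsetSum _ fun i _ => (hf i).const_mul (a i)

theorem memLp_mul_of_four {Ω : Type*} [MeasurableSpace Ω] {μ : Measure Ω} {f g : Ω → ℝ}
    (hf : MemLp f 4 μ) (hg : MemLp g 4 μ) : MemLp (fun ω => f ω * g ω) 2 μ := by
  have : ENNReal.HolderTriple 4 4 2 := ⟨by
    rw [← two_mul]
    rw [show (4 : ℝ≥0∞) = 2 * 2 by norm_num, ENNReal.mul_inv (by simp) (by simp), ← mul_assoc,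
      ENNReal.mul_inv_cancel (by simp) (by simp), one_mul]⟩
  exact hg.mul' hf

theorem integral_add_mul_sq {Ω : Type*} [MeasurableSpace Ω] {μ : Measure Ω} {f g : Ω → ℝ}
    (hf : MemLp f 2 μ) (hg : MemLp g 2 μ) (s : ℝ) :
    ∫ ω, (f ω + s * g ω) ^ 2 ∂μ =
      ∫ ω, f ω ^ 2 ∂μ + 2 * s * ∫ ω, f ω * g ω ∂μ + s ^ 2 * ∫ ω, g ω ^ 2 ∂μ := by
  have h1 : ∀ ω, (f ω + s * g ω) ^ 2 = f ω ^ 2 + (2 * s) * (f ω * g ω) + s ^ 2 * g ω ^ 2 :=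
    fun ω => by ring
  have hfg : Integrable (fun ω => (2 * s) * (f ω * g ω)) μ := (hf.integrable_mul hg).const_mul _
  have hff : Integrable (fun ω => f ω ^ 2 + (2 * s) * (f ω * g ω)) μ := hf.integrable_sq.add hfg
  simp only [h1]
  rw [integral_add hff (hg.integrable_sq.const_mul _), integral_add hf.integrable_sq hfg,
    integral_const_mul, integral_const_mul]

end Matrices

/-! ### Computations in the eigenbasis -/

section Spectral

variable {M : ℕ} {H : Matrix (Fin M) (Fin M) ℝ} {lam : Fin M → ℝ} {u : Fin M → Fin M → ℝ}

namespace IsEigendecomposition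

variable (h : IsEigendecomposition H lam u)
include h

theorem mulVec_eq (c : Fin M → ℝ) : H *ᵥ c = ∑ j, (lam j * (u j ⬝ᵥ c)) • u j := by
  conv_lhs => rw [h.decomp]
  rw [Matrix.sum_mulVec]
  refine Finset.sum_congr rfl fun j _ => ?_
  rw [Matrix.smul_mulVec, outer, Matrix.vecMulVec_mulVec]
  ext k; simp; ring

theorem dot_mulVec (i : Fin M) (c : Fin M → ℝ) : u i ⬝ᵥ (H *ᵥ c) = lam i * (u i ⬝ᵥ c) := by
  simp [h.mulVec_eq, dotProduct_sum, dotProduct_smul, h.orthonormal]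

theorem normSq_eq (c : Fin M → ℝ) : normSq H c = ∑ j, lam j * (u j ⬝ᵥ c) ^ 2 := by
  conv_lhs => rw [h.decomp]
  simp [normSq_sum, normSq_smul, normSq_outer]

theorem normSq_vec (i : Fin M) : normSq H (u i) = lam i := by
  rw [normSq, h.dot_mulVec, h.orthonormal]; simp

theorem trace_eq : H.trace = ∑ i, lam i := by
  conv_lhs => rw [h.decomp]
  simp [Matrix.trace_sum, Matrix.trace_smul, outer, Matrix.trace_vecMulVec, h.orthonormal]

/-- Parseval: every vector expands in the eigenbasis. -/
theorem sum_dot_smul (c : Fin M → ℝ) : ∑ j, (u j ⬝ᵥ c) • u j = c := by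
  have h1 : (Matrix.of u) * (Matrix.of u)ᵀ = 1 := by
    ext i j
    rw [Matrix.mul_apply, Matrix.one_apply]
    exact h.orthonormal i j
  have h2 : (Matrix.of u)ᵀ * (Matrix.of u) = 1 := mul_eq_one_comm.mp h1
  have h3 : (Matrix.of u)ᵀ *ᵥ ((Matrix.of u) *ᵥ c) = c := by
    rw [Matrix.mulVec_mulVec, h2, Matrix.one_mulVec]
  conv_rhs => rw [← h3]
  ext k
  simp [Matrix.mulVec, dotProduct, Finset.sum_apply, mul_comm]

end IsEigendecomposition

end Spectral

/-! ### Moments of the feature, the optimality condition and the label noise -/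

namespace Model

variable {p : ℕ∞} {M : ℕ} {m : Model p M}

section

variable (hcov : m.DataCovariance)
include hcov

theorem DataCovariance.memLp_dot (a : Fin M → ℝ) : MemLp (fun z => m.feature z ⬝ᵥ a) 2 m.law :=
  QSGD.memLp_dot hcov.sq_feature a

theorem DataCovariance.integral_dot_mul_dot (a c : Fin M → ℝ) :
    ∫ z, (m.feature z ⬝ᵥ a) * (m.feature z ⬝ᵥ c) ∂m.law = a ⬝ᵥ (m.covHf *ᵥ c) := by
  rw [covHf, ← integral_dot_mulVec]
  · simp [dot_outer_mulVec]
  · intro i j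
    exact (hcov.sq_feature i).integrable_mul (hcov.sq_feature j)

theorem DataCovariance.integral_dot_sq (a : Fin M → ℝ) :
    ∫ z, (m.feature z ⬝ᵥ a) ^ 2 ∂m.law = normSq m.covHf a := by
  simpa [sq, normSq] using hcov.integral_dot_mul_dot a a

theorem DataCovariance.normSq_covHf_nonneg (a : Fin M → ℝ) : 0 ≤ normSq m.covHf a := by
  rw [← hcov.integral_dot_sq]; exact integral_nonneg fun z => sq_nonneg _

end

section

variable {α β : ℝ} (h4 : m.FourthMomentCondition α β)
include h4

theorem FourthMomentCondition.memLp_dot (a : Fin M → ℝ) :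
    MemLp (fun z => m.feature z ⬝ᵥ a) 4 m.law := QSGD.memLp_dot h4.finite a

theorem FourthMomentCondition.memLp_dot_mul_dot (a c : Fin M → ℝ) :
    MemLp (fun z => (m.feature z ⬝ᵥ a) * (m.feature z ⬝ᵥ c)) 2 m.law :=
  memLp_mul_of_four (h4.memLp_dot a) (h4.memLp_dot c)

theorem FourthMomentCondition.normSq_fourthMoment (a c : Fin M → ℝ) :
    normSq (m.fourthMoment (outer a)) c =
      ∫ z, ((m.feature z ⬝ᵥ a) * (m.feature z ⬝ᵥ c)) ^ 2 ∂m.law := by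
  rw [fourthMoment, normSq_matE]
  · simp [outer_mul_outer_mul_outer, normSq_smul, normSq_outer, mul_pow]
  · intro i j
    simp only [outer_mul_outer_mul_outer]
    have hi := memLp_mul_of_four (h4.memLp_dot a) (h4.finite i)
    have hj := memLp_mul_of_four (h4.memLp_dot a) (h4.finite j)
    refine (hi.integrable_mul hj).congr (ae_of_all _ fun z => ?_)
    simp [outer, Matrix.vecMulVec_apply]; ring

/-- The choice A = a aᵀ makes both sides scalar: the trace becomes `normSq m.covHf a`. This is the
form in which the fourth-moment bound enters the recursions. -/
theorem FourthMomentCondition.integral_le (a c : Fin M → ℝ) :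
    ∫ z, ((m.feature z ⬝ᵥ a) * (m.feature z ⬝ᵥ c)) ^ 2 ∂m.law ≤
      α * normSq m.covHf a * normSq m.covHf c := by
  rw [← h4.normSq_fourthMoment]
  have := (h4.upper _ (posSemidef_outer a)).normSq_le c
  rwa [normSq_smul, trace_mul_outer] at this

/-- At A = u_i u_iᵀ, tested against u_i, the two fourth-moment bounds give (1 + β)λ_i² ≤ αλ_i². It
serves to turn the trace condition on the step size into γλ_i ≤ 1. -/
theorem FourthMomentCondition.one_le {lam : Fin M → ℝ} {u : Fin M → Fin M → ℝ}
    (he : IsEigendecomposition m.covHf lam u) {i : Fin M} (hi : 0 < lam i) : 1 ≤ α := by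
  have h1 := (h4.upper _ (posSemidef_outer (u i))).normSq_le (u i)
  have h2 := (h4.lower _ (posSemidef_outer (u i))).normSq_le (u i)
  rw [normSq_smul, trace_mul_outer, he.normSq_vec] at h1
  rw [normSq_add_mat, normSq_smul, trace_mul_outer, he.normSq_vec] at h2
  have h3 : normSq (m.covHf * outer (u i) * m.covHf) (u i) = lam i * lam i := by
    rw [normSq, ← Matrix.mulVec_mulVec, ← Matrix.mulVec_mulVec, he.dot_mulVec, dot_outer_mulVec,
      he.dot_mulVec, he.orthonormal]
    simp
  rw [h3] at h2
  have h5 : lam i * lam i ≤ α * (lam i * lam i) := by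
    nlinarith [mul_pos (mul_pos h4.pos_β hi) hi]
  by_contra hlt
  nlinarith [mul_pos hi hi]

end

section

variable {vstar : Fin M → ℝ}

theorem memLp_residual (hwell : m.WellPosed) (hcov : m.DataCovariance) :
    MemLp (m.residual vstar) 2 m.law := by
  have := hwell.label_sq.sub (hcov.memLp_dot vstar)
  simpa [residual, dotProduct_comm, funext_iff] using! this

/-- The first-order optimality condition `E[ξ x̃] = 0`. -/
theorem integral_residual_mul_dot (hwell : m.WellPosed) (hcov : m.DataCovariance)
    (hopt : ∀ v, m.riskq vstar ≤ m.riskq v) (a : Fin M → ℝ) :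
    ∫ z, m.residual vstar z * (m.feature z ⬝ᵥ a) ∂m.law = 0 := by
  have hr := memLp_residual (vstar := vstar) hwell hcov
  have ha := hcov.memLp_dot a
  set I := ∫ z, m.residual vstar z * (m.feature z ⬝ᵥ a) ∂m.law with hI
  set J := ∫ z, (m.feature z ⬝ᵥ a) ^ 2 ∂m.law
  set K := ∫ z, (m.residual vstar z) ^ 2 ∂m.law
  have hexp : ∀ s : ℝ, m.riskq (vstar + s • a) = 1 / 2 * (K - 2 * s * I + s ^ 2 * J) := by
    intro s
    rw [riskq]
    have h1 : ∀ z, (m.feature z ⬝ᵥ (vstar + s • a) - m.label z) ^ 2 =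
        (m.residual vstar z + (-s) * (m.feature z ⬝ᵥ a)) ^ 2 := by
      intro z
      simp only [residual, dotProduct_add, dotProduct_smul, smul_eq_mul, dotProduct_comm vstar]
      ring
    simp only [h1]
    rw [integral_add_mul_sq hr ha]
    ring
  have hJ : 0 ≤ J := integral_nonneg fun z => sq_nonneg _
  have hmin : ∀ s : ℝ, 0 ≤ s ^ 2 * J - 2 * s * I := by
    intro s
    have h0 := hexp 0
    have h1 := hexp s
    have h2 := hopt (vstar + s • a)
    simp only [zero_smul, add_zero] at h0
    rw [h0, h1] at h2
    linarith
  -- The quadratic s ↦ s²J - 2sI is negative at this s unless I = 0; using J + 1 instead of J covers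
  -- J = 0.
  have h1 := hmin (I / (J + 1))
  have h2 : (I / (J + 1)) ^ 2 * J - 2 * (I / (J + 1)) * I =
      - (I ^ 2 * (J + 2) / (J + 1) ^ 2) := by
    field_simp; ring
  rw [h2] at h1
  have h3 : I ^ 2 * (J + 2) / (J + 1) ^ 2 ≤ 0 := by linarith
  have h4 : I ^ 2 * (J + 2) ≤ 0 := by
    by_contra hc
    exact absurd h3 (not_le.mpr (div_pos (not_le.mp hc) (by positivity)))
  have h5 : I ^ 2 ≤ 0 := by nlinarith [sq_nonneg I]
  exact pow_eq_zero_iff (two_ne_zero) |>.mp (le_antisymm h5 (sq_nonneg I))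

variable {σlo σhi : ℝ} (hn : m.NoiseCondition vstar σlo σhi)
include hn

/-- This rests on the finiteness clause of the noise condition: ξ is only known to be square
integrable, so moments of ξ and x taken separately do not suffice. -/
theorem NoiseCondition.integrable (hwell : m.WellPosed) (hcov : m.DataCovariance) (a : Fin M → ℝ) :
    MemLp (fun z => m.residual vstar z * (m.feature z ⬝ᵥ a)) 2 m.law := by
  have hms : Measurable fun z => m.feature z ⬝ᵥ a := 
    measurable_dot m.measurable_feature measurable_const
  have hmeas : AEStronglyMeasurable (fun z => m.residual vstar z * (m.feature z ⬝ᵥ a)) m.law :=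
    (memLp_residual hwell hcov).aestronglyMeasurable.mul hms.aestronglyMeasurable
  rw [memLp_two_iff_integrable_sq hmeas]
  have : ∀ z, (m.residual vstar z * (m.feature z ⬝ᵥ a)) ^ 2 =
      ∑ i, ∑ j, (m.residual vstar z ^ 2 * (m.feature z i * m.feature z j)) * (a i * a j) := by
    intro z
    rw [mul_pow, sq (m.feature z ⬝ᵥ a), dotProduct, Finset.sum_mul_sum, Finset.mul_sum]
    refine Finset.sum_congr rfl fun i _ => ?_
    rw [Finset.mul_sum]
    exact Finset.sum_congr rfl fun j _ => by ring
  simp only [this]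
  exact integrable_finsetSum _ fun i _ => integrable_finsetSum _ fun j _ =>
    (hn.finite i j).mul_const _

theorem NoiseCondition.integral_le (a : Fin M → ℝ) :
    ∫ z, (m.residual vstar z * (m.feature z ⬝ᵥ a)) ^ 2 ∂m.law ≤ σhi ^ 2 * normSq m.covHf a := by
  have h := hn.upper.normSq_le a
  rw [normSq_smul, normSq_matE] at h
  · simpa [normSq_smul, normSq_outer, mul_pow] using h
  · intro i j
    simpa [outer, Matrix.vecMulVec_apply] using hn.finite i j

end

end Model

/-! ### Bias-variance identities for unbiased quantizers, in [0, ∞] -/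

section SecondMoments

variable {Ω : Type*} [MeasurableSpace Ω] {μ : Measure Ω} {f : Ω → ℝ}

theorem memLp_two_of_lintegral_lt_top (hf : AEStronglyMeasurable f μ)
    (h : ∫⁻ ω, ENNReal.ofReal (f ω ^ 2) ∂μ < ∞) : MemLp f 2 μ := by
  rw [memLp_two_iff_integrable_sq hf]
  refine ⟨hf.pow 2, ?_⟩
  rw [hasFiniteIntegral_iff_ofReal (ae_of_all _ fun _ => sq_nonneg _)]
  exact h

theorem lintegral_ofReal_sq (hf : MemLp f 2 μ) :
    ∫⁻ ω, ENNReal.ofReal (f ω ^ 2) ∂μ = ENNReal.ofReal (∫ ω, f ω ^ 2 ∂μ) :=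
  (ofReal_integral_eq_lintegral_ofReal hf.integrable_sq (ae_of_all _ fun _ => sq_nonneg _)).symm

/-- The bias-variance decomposition of `E (A + B Y)²`, with both sides possibly infinite. -/
theorem lintegral_add_mul_sq [IsProbabilityMeasure μ] {r : ℝ} (hf : Integrable f μ)
    (hr : ∫ ω, f ω ∂μ = r) (A B : ℝ) :
    ∫⁻ ω, ENNReal.ofReal ((A + B * f ω) ^ 2) ∂μ = ENNReal.ofReal ((A + B * r) ^ 2) +
      ENNReal.ofReal (B ^ 2) * ∫⁻ ω, ENNReal.ofReal ((f ω - r) ^ 2) ∂μ := by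
  have hm : AEStronglyMeasurable (fun ω => f ω - r) μ :=
    hf.aestronglyMeasurable.sub aestronglyMeasurable_const
  rcases eq_or_ne B 0 with rfl | hB
  · simp
  by_cases h : ∫⁻ ω, ENNReal.ofReal ((f ω - r) ^ 2) ∂μ < ∞
  · have h2 := memLp_two_of_lintegral_lt_top hm h
    have hc : MemLp (fun _ : Ω => A + B * r) 2 μ := memLp_const _
    have h3 : ∀ ω, (A + B * f ω) ^ 2 = ((A + B * r) + B * (f ω - r)) ^ 2 := fun ω => by ring
    simp only [h3]
    have hs : MemLp (fun ω => (A + B * r) + B * (f ω - r)) 2 μ := hc.add (h2.const_mul B)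
    rw [lintegral_ofReal_sq hs, lintegral_ofReal_sq h2,
      ← ENNReal.ofReal_mul (sq_nonneg _), ← ENNReal.ofReal_add (sq_nonneg _)
      (mul_nonneg (sq_nonneg _) (integral_nonneg fun _ => sq_nonneg _))]
    have h4 : ∫ ω, (f ω - r) ∂μ = 0 := by
      rw [integral_sub hf (integrable_const r), hr]; simp
    have := integral_add_mul_sq hc h2 B
    simp only [integral_const_mul, h4] at this
    congr 1
    simpa using this
  -- Infinite variance: since B ≠ 0, finiteness of the left side would put f - r in L² as well.
  · rw [not_lt_top_iff.mp h, ENNReal.mul_top (by simpa using hB), add_top]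
    by_contra hne
    apply h
    have h5 : MemLp (fun ω => A + B * f ω) 2 μ := memLp_two_of_lintegral_lt_top
      (aestronglyMeasurable_const.add (hf.aestronglyMeasurable.const_mul B)) (lt_top_iff_ne_top.mpr hne)
    have h6 : MemLp (fun ω => f ω - r) 2 μ := by
      have := (h5.sub (memLp_const (A + B * r))).const_mul B⁻¹
      convert this using 2 with ω
      simp only [Pi.sub_apply]
      field_simp
      ring
    rw [lintegral_ofReal_sq h6]
    exact ENNReal.ofReal_lt_top

end SecondMoments

namespace Quantizer

theorem Unbiased.lintegral_scalar {Q : Quantizer Unit} (hQ : Q.Unbiased) (A B r : ℝ) :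
    ∫⁻ s, ENNReal.ofReal ((A + B * Q.scalar r s) ^ 2) ∂Q.law =
      ENNReal.ofReal ((A + B * r) ^ 2) + ENNReal.ofReal (B ^ 2) * Q.scalarErr r :=
  lintegral_add_mul_sq (hQ (fun _ => r) ()).1 (hQ (fun _ => r) ()).2 A B

/-- `E[⟨x, Q(v) - v⟩²]`, in `[0, ∞]`. -/
noncomputable def vecErr {M : ℕ} (Q : Quantizer (Fin M)) (x v : Fin M → ℝ) : ℝ≥0∞ :=
  ∫⁻ s, ENNReal.ofReal ((x ⬝ᵥ (Q.map v s - v)) ^ 2) ∂Q.law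

theorem Unbiased.lintegral_dot {M : ℕ} {Q : Quantizer (Fin M)} (hQ : Q.Unbiased) (A B : ℝ)
    (x v : Fin M → ℝ) :
    ∫⁻ s, ENNReal.ofReal ((A + B * (x ⬝ᵥ Q.map v s)) ^ 2) ∂Q.law =
      ENNReal.ofReal ((A + B * (x ⬝ᵥ v)) ^ 2) + ENNReal.ofReal (B ^ 2) * Q.vecErr x v := by
  have hi : Integrable (fun s => x ⬝ᵥ Q.map v s) Q.law :=
    integrable_finsetSum _ fun i _ => ((hQ v i).1).const_mul _
  have hr : ∫ s, x ⬝ᵥ Q.map v s ∂Q.law = x ⬝ᵥ v := by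
    simp only [dotProduct]
    rw [integral_finsetSum _ fun i _ => ((hQ v i).1).const_mul _]
    exact Finset.sum_congr rfl fun i _ => by rw [integral_const_mul, (hQ v i).2]
  simpa only [vecErr, dotProduct_sub] using lintegral_add_mul_sq hi hr A B

theorem Multiplicative.vecErr_le {M : ℕ} {Q : Quantizer (Fin M)} {ε : ℝ} (hQ : Q.Multiplicative ε)
    (x v : Fin M → ℝ) : Q.vecErr x v ≤ ENNReal.ofReal (ε * (x ⬝ᵥ v) ^ 2) := by
  have hd : ∀ k, MemLp (fun s => (Q.map v s - v) k) 2 Q.law := fun k =>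
    ((hQ v).1 k).sub (memLp_const (v k))
  have h2 : MemLp (fun s => x ⬝ᵥ (Q.map v s - v)) 2 Q.law := by
    simpa only [dotProduct_comm x] using memLp_dot hd x
  rw [vecErr, lintegral_ofReal_sq h2]
  apply ENNReal.ofReal_le_ofReal
  have h := LoewnerLE.normSq_le (A := Q.errCov v) (B := ε • outer v) (hQ v).2 x
  rw [normSq_smul, normSq_outer, errCov, normSq_matE] at h
  · simpa [normSq_outer, dotProduct_comm _ x] using h
  · intro i j
    exact (hd i).integrable_mul (hd j)

theorem Multiplicative.scalarErr_le {Q : Quantizer Unit} {ε : ℝ} (hQ : Q.Multiplicative ε)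
    (r : ℝ) : Q.scalarErr r ≤ ENNReal.ofReal (ε * r ^ 2) := by
  have hd : MemLp (fun s => Q.scalar r s - r) 2 Q.law :=
    ((hQ fun _ => r).1 ()).sub (memLp_const r)
  rw [scalarErr, lintegral_ofReal_sq hd]
  apply ENNReal.ofReal_le_ofReal
  have h := (hQ fun _ => r).2.dotProduct_mulVec_nonneg (fun _ => 1)
  simp only [dotProduct, Matrix.mulVec, outer, errCov, matE, Matrix.vecMulVec_apply] at h
  simp [Matrix.vecMulVec_apply, ← sq] at h
  exact h

end Quantizer

/-! ### The noise injected by the quantizers of parameters, activations and output gradients -/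

namespace Model

variable {p : ℕ∞} {M : ℕ} (m : Model p M)

/-- The conditional second moment, given everything drawn before them, of the errors that the
quantizers of parameters, activations and output gradients inject into the output gradient. -/
noncomputable def quantNoise (z : m.Sample) (v : Fin M → ℝ) : ℝ≥0∞ :=
  ENNReal.ofReal ((m.feature z ⬝ᵥ (m.quantV z v - v)) ^ 2) + m.Qa.scalarErr (m.act z v) +
    m.Qo.scalarErr (m.outGrad z v)

theorem measurable_quantNoise {𝒳 : Type*} [MeasurableSpace 𝒳] {f : 𝒳 → m.Sample}
    {v : 𝒳 → Fin M → ℝ} (hf : Measurable f) (hv : Measurable v) :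
    Measurable fun s => m.quantNoise (f s) (v s) :=
  ((((measurable_dot (m.measurable_feature.comp hf) ((m.measurable_quantV hf hv).sub hv)).pow_const
    2).ennreal_ofReal).add (m.Qa.measurable_scalarErr.comp (m.measurable_act hf hv))).add
    (m.Qo.measurable_scalarErr.comp (m.measurable_outGrad hf hv))

/-- Integration over one step, the seeds of the quantizers `Q_p, Q_a, Q_o` being integrated
first. -/
theorem lintegral_law {f : m.Sample → ℝ≥0∞} (hf : Measurable f) :
    ∫⁻ z, f z ∂m.law = ∫⁻ w : m.DataSeed, ∫⁻ sp, ∫⁻ sa, ∫⁻ so, f (w.1, w.2, sp, sa, so) ∂m.Qo.law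
      ∂m.Qa.law ∂m.Qp.law ∂(m.data.prod (m.Qd.law.prod (m.Qs.law.prod (m.Qf.law.prod m.Ql.law)))) := by
  have h1 : Measurable fun w : m.DataSeed × (m.Qp.Seed × m.Qa.Seed × m.Qo.Seed) =>
      f (w.1.1, w.1.2, w.2) := hf.comp (by fun_prop)
  have h2 : ∀ w : m.DataSeed, Measurable fun q : m.Qp.Seed × m.Qa.Seed × m.Qo.Seed =>
      f (w.1, w.2, q) := fun w => h1.comp (measurable_const.prodMk measurable_id)
  have h3 : ∀ w : m.DataSeed, ∫⁻ q, f (w.1, w.2, q) ∂(m.Qp.law.prod (m.Qa.law.prod m.Qo.law)) =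
      ∫⁻ sp, ∫⁻ sa, ∫⁻ so, f (w.1, w.2, sp, sa, so) ∂m.Qo.law ∂m.Qa.law ∂m.Qp.law := by
    intro w
    rw [lintegral_prod _ (h2 w).aemeasurable]
    refine lintegral_congr fun sp => ?_
    exact lintegral_prod (fun q : m.Qa.Seed × m.Qo.Seed => f (w.1, w.2, sp, q))
      ((h2 w).comp (measurable_const.prodMk measurable_id)).aemeasurable
  simp only [← h3]
  rw [law, lintegral_prod _ hf.aemeasurable, lintegral_prod _ h1.lintegral_prod_right'.aemeasurable]
  refine lintegral_congr fun d => ?_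
  exact lintegral_prod (fun y => f (d, y))
    (hf.comp (measurable_const.prodMk measurable_id)).aemeasurable

/-- An opaque constant for the feature brings the iterated seed integrals to the shape of
`lintegral_seeds`. -/
theorem exists_feature_eq (w : m.DataSeed) : ∃ x, ∀ q, m.feature (w.1, w.2, q) = x :=
  ⟨m.Qf.map (sketch (fun i j => m.Qs.map (fun k => m.S k.1 k.2) w.2.2.1 (i, j))
    (m.Qd.map w.1.1 w.2.1)) w.2.2.2.1, fun _ => rfl⟩

theorem exists_label_eq (w : m.DataSeed) : ∃ l, ∀ q, m.label (w.1, w.2, q) = l :=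
  ⟨m.Ql.scalar w.1.2 w.2.2.2.2, fun _ => rfl⟩

variable {m}

/-- The integrand is affine in the output of Q_o; averaging over its seed leaves the square of an
affine function of the output of Q_a plus a variance, and likewise for Q_a and then Q_p. Three
bias-variance identities, innermost seed first, make the errors add without cross terms. -/
theorem lintegral_seeds (hunb : m.UnbiasedQuantization) (x v : Fin M → ℝ) (l A B : ℝ) :
    ∫⁻ sp, ∫⁻ sa, ∫⁻ so, ENNReal.ofReal
      ((A + B * m.Qo.scalar (l - m.Qa.scalar (x ⬝ᵥ m.Qp.map v sp) sa) so) ^ 2)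
        ∂m.Qo.law ∂m.Qa.law ∂m.Qp.law =
    ENNReal.ofReal ((A + B * (l - x ⬝ᵥ v)) ^ 2) + ENNReal.ofReal (B ^ 2) *
      ∫⁻ sp, ∫⁻ sa, (ENNReal.ofReal ((x ⬝ᵥ (m.Qp.map v sp - v)) ^ 2) +
        m.Qa.scalarErr (x ⬝ᵥ m.Qp.map v sp) +
        m.Qo.scalarErr (l - m.Qa.scalar (x ⬝ᵥ m.Qp.map v sp) sa)) ∂m.Qa.law ∂m.Qp.law := by
  have hp : Measurable fun sp => m.Qp.map v sp :=
    m.Qp.measurable_map.comp (measurable_const.prodMk measurable_id)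
  have hxp : Measurable fun sp => x ⬝ᵥ m.Qp.map v sp := measurable_dot measurable_const hp
  have hxd : Measurable fun sp => ENNReal.ofReal ((x ⬝ᵥ (m.Qp.map v sp - v)) ^ 2) :=
    ((measurable_dot measurable_const (hp.sub measurable_const)).pow_const 2).ennreal_ofReal
  have hea : Measurable fun sp => m.Qa.scalarErr (x ⬝ᵥ m.Qp.map v sp) :=
    m.Qa.measurable_scalarErr.comp hxp
  have hqa : Measurable fun w : m.Qp.Seed × m.Qa.Seed => m.Qa.scalar (x ⬝ᵥ m.Qp.map v w.1) w.2 :=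
    m.Qa.measurable_scalar.comp ((hxp.comp measurable_fst).prodMk measurable_snd)
  have heo : Measurable fun w : m.Qp.Seed × m.Qa.Seed =>
      m.Qo.scalarErr (l - m.Qa.scalar (x ⬝ᵥ m.Qp.map v w.1) w.2) :=
    m.Qo.measurable_scalarErr.comp (measurable_const.sub hqa)
  have hsa : ∀ sp, Measurable fun sa => m.Qa.scalar (x ⬝ᵥ m.Qp.map v sp) sa := fun sp =>
    hqa.comp (measurable_const.prodMk measurable_id)
  have heosa : ∀ sp, Measurable fun sa =>
      m.Qo.scalarErr (l - m.Qa.scalar (x ⬝ᵥ m.Qp.map v sp) sa) := fun sp =>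
    m.Qo.measurable_scalarErr.comp (measurable_const.sub (hsa sp))
  have h1 : ∀ sp, ∫⁻ sa, ∫⁻ so, ENNReal.ofReal
      ((A + B * m.Qo.scalar (l - m.Qa.scalar (x ⬝ᵥ m.Qp.map v sp) sa) so) ^ 2)
        ∂m.Qo.law ∂m.Qa.law =
      ENNReal.ofReal ((A + B * l + (-B) * (x ⬝ᵥ m.Qp.map v sp)) ^ 2) + ENNReal.ofReal (B ^ 2) *
        (m.Qa.scalarErr (x ⬝ᵥ m.Qp.map v sp) + 
          ∫⁻ sa, m.Qo.scalarErr (l - m.Qa.scalar (x ⬝ᵥ m.Qp.map v sp) sa) ∂m.Qa.law) := by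
    intro sp
    simp only [hunb.o.lintegral_scalar]
    rw [lintegral_add_right _ ((heosa sp).const_mul _), lintegral_const_mul _ (heosa sp)]
    have h2 : ∀ sa, A + B * (l - m.Qa.scalar (x ⬝ᵥ m.Qp.map v sp) sa) =
      A + B * l + (-B) * m.Qa.scalar (x ⬝ᵥ m.Qp.map v sp) sa := fun sa => by ring
    simp only [h2, hunb.a.lintegral_scalar, neg_sq]
    rw [mul_add, add_assoc]
  have h3 : ∀ sp, ∫⁻ sa, (ENNReal.ofReal ((x ⬝ᵥ (m.Qp.map v sp - v)) ^ 2) +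
        m.Qa.scalarErr (x ⬝ᵥ m.Qp.map v sp) +
        m.Qo.scalarErr (l - m.Qa.scalar (x ⬝ᵥ m.Qp.map v sp) sa)) ∂m.Qa.law =
      ENNReal.ofReal ((x ⬝ᵥ (m.Qp.map v sp - v)) ^ 2) + (m.Qa.scalarErr (x ⬝ᵥ m.Qp.map v sp) + 
          ∫⁻ sa, m.Qo.scalarErr (l - m.Qa.scalar (x ⬝ᵥ m.Qp.map v sp) sa) ∂m.Qa.law) := by
    intro sp
    rw [lintegral_add_right _ (heosa sp), lintegral_const, measure_univ, mul_one, add_assoc]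
  simp only [h1, h3]
  have h4 : Measurable fun sp => m.Qa.scalarErr (x ⬝ᵥ m.Qp.map v sp) + 
      ∫⁻ sa, m.Qo.scalarErr (l - m.Qa.scalar (x ⬝ᵥ m.Qp.map v sp) sa) ∂m.Qa.law :=
    hea.add heo.lintegral_prod_right'
  rw [lintegral_add_right _ (h4.const_mul _), lintegral_const_mul _ h4, lintegral_add_left hxd,
    hunb.p.lintegral_dot, neg_sq, Quantizer.vecErr, mul_add, add_assoc,
    show A + B * l + -B * (x ⬝ᵥ v) = A + B * (l - x ⬝ᵥ v) by ring]

/-- Multiplicative quantizers inject a noise that is controlled by the output gradient and the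
activation in exact arithmetic. -/
theorem lintegral_seeds_le (hunb : m.UnbiasedQuantization) {εp εa εo : ℝ} (hp0 : 0 ≤ εp)
    (ha0 : 0 ≤ εa) (ho0 : 0 ≤ εo) (hQp : m.Qp.Multiplicative εp) (hQa : m.Qa.Multiplicative εa)
    (hQo : m.Qo.Multiplicative εo) (x v : Fin M → ℝ) (l : ℝ) :
    ∫⁻ sp, ∫⁻ sa, (ENNReal.ofReal ((x ⬝ᵥ (m.Qp.map v sp - v)) ^ 2) +
        m.Qa.scalarErr (x ⬝ᵥ m.Qp.map v sp) +
        m.Qo.scalarErr (l - m.Qa.scalar (x ⬝ᵥ m.Qp.map v sp) sa)) ∂m.Qa.law ∂m.Qp.law ≤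
      ENNReal.ofReal (εo * (l - x ⬝ᵥ v) ^ 2 +
        (1 + εo) * (εp + (1 + εp) * εa) * (x ⬝ᵥ v) ^ 2) := by
  have hp : Measurable fun sp => m.Qp.map v sp :=
    m.Qp.measurable_map.comp (measurable_const.prodMk measurable_id)
  have hxp : Measurable fun sp => x ⬝ᵥ m.Qp.map v sp := measurable_dot measurable_const hp
  have hea : Measurable fun sp => m.Qa.scalarErr (x ⬝ᵥ m.Qp.map v sp) :=
    m.Qa.measurable_scalarErr.comp hxp
  set P := m.Qp.vecErr x v with hP
  have hPle : P ≤ ENNReal.ofReal εp * ENNReal.ofReal ((x ⬝ᵥ v) ^ 2) := by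
    rw [← ENNReal.ofReal_mul hp0]; exact hQp.vecErr_le x v
  set E := ∫⁻ sp, m.Qa.scalarErr (x ⬝ᵥ m.Qp.map v sp) ∂m.Qp.law with hE
  have hEle : E ≤ ENNReal.ofReal εa * (ENNReal.ofReal ((x ⬝ᵥ v) ^ 2) + P) := by
    calc E ≤ ∫⁻ sp, ENNReal.ofReal εa * ENNReal.ofReal ((0 + 1 * (x ⬝ᵥ m.Qp.map v sp)) ^ 2)
          ∂m.Qp.law := lintegral_mono fun sp => by
            rw [← ENNReal.ofReal_mul ha0, zero_add, one_mul]; exact hQa.scalarErr_le _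
      _ = _ := by
        rw [lintegral_const_mul' _ _ ENNReal.ofReal_ne_top, hunb.p.lintegral_dot]; simp [hP]
  have hxd : Measurable fun sp => ENNReal.ofReal ((x ⬝ᵥ (m.Qp.map v sp - v)) ^ 2) :=
    ((measurable_dot measurable_const (hp.sub measurable_const)).pow_const 2).ennreal_ofReal
  have h1 : ∀ sp, ∫⁻ sa, (ENNReal.ofReal ((x ⬝ᵥ (m.Qp.map v sp - v)) ^ 2) +
        m.Qa.scalarErr (x ⬝ᵥ m.Qp.map v sp) +
        m.Qo.scalarErr (l - m.Qa.scalar (x ⬝ᵥ m.Qp.map v sp) sa)) ∂m.Qa.law ≤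
      (ENNReal.ofReal ((x ⬝ᵥ (m.Qp.map v sp - v)) ^ 2) + m.Qa.scalarErr (x ⬝ᵥ m.Qp.map v sp)) +
      ENNReal.ofReal εo * (ENNReal.ofReal ((l + (-1) * (x ⬝ᵥ m.Qp.map v sp)) ^ 2) +
        m.Qa.scalarErr (x ⬝ᵥ m.Qp.map v sp)) := by
    intro sp
    rw [lintegral_add_left measurable_const, lintegral_const, measure_univ, mul_one]
    refine add_le_add le_rfl ?_
    calc _ ≤ ∫⁻ sa, ENNReal.ofReal εo * ENNReal.ofReal
            ((l + (-1) * m.Qa.scalar (x ⬝ᵥ m.Qp.map v sp) sa) ^ 2) ∂m.Qa.law :=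
          lintegral_mono fun sa => by
            rw [← ENNReal.ofReal_mul ho0, neg_one_mul, ← sub_eq_add_neg]; exact hQo.scalarErr_le _
      _ = _ := by
        rw [lintegral_const_mul' _ _ ENNReal.ofReal_ne_top, hunb.a.lintegral_scalar]; simp
  have h2 : ∫⁻ sp, ENNReal.ofReal ((l + (-1) * (x ⬝ᵥ m.Qp.map v sp)) ^ 2) ∂m.Qp.law =
      ENNReal.ofReal ((l - x ⬝ᵥ v) ^ 2) + P := by
    rw [hunb.p.lintegral_dot]; simp [hP, sub_eq_add_neg]
  calc _ ≤ _ := lintegral_mono h1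
    -- P and E are the mean squared errors of Q_p and Q_a. The unquantized gradient has been
    -- perturbed by both before Q_o sees it, hence the second P + E under the factor ε_o.
    _ = P + E + ENNReal.ofReal εo * (ENNReal.ofReal ((l - x ⬝ᵥ v) ^ 2) + P + E) := by
      have hs : Measurable fun sp => ENNReal.ofReal ((x ⬝ᵥ (m.Qp.map v sp - v)) ^ 2) +
        m.Qa.scalarErr (x ⬝ᵥ m.Qp.map v sp) := hxd.add hea
      rw [lintegral_add_left hs, lintegral_add_left hxd,
        lintegral_const_mul' _ _ ENNReal.ofReal_ne_top, lintegral_add_right _ hea, h2]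
      rfl
    _ ≤ _ := by
      have hv := sq_nonneg (x ⬝ᵥ v)
      have hl := sq_nonneg (l - x ⬝ᵥ v)
      generalize (x ⬝ᵥ v) ^ 2 = V at *
      generalize (l - x ⬝ᵥ v) ^ 2 = L at *
      have hE' : E ≤ ENNReal.ofReal (εa * (V + εp * V)) := by
        rw [ENNReal.ofReal_mul ha0, ENNReal.ofReal_add hv (by positivity), ENNReal.ofReal_mul hp0]
        exact hEle.trans (by gcongr)
      rw [← ENNReal.ofReal_mul hp0] at hPle
      calc _ ≤ ENNReal.ofReal (εp * V) + ENNReal.ofReal (εa * (V + εp * V)) + ENNReal.ofReal εo *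
            (ENNReal.ofReal L + ENNReal.ofReal (εp * V) + ENNReal.ofReal (εa * (V + εp * V))) := by
            gcongr
        _ = _ := by
          rw [← ENNReal.ofReal_add (by positivity) (by positivity),
            ← ENNReal.ofReal_add (by positivity) (by positivity),
            ← ENNReal.ofReal_add (by positivity) (by positivity), ← ENNReal.ofReal_mul ho0,
            ← ENNReal.ofReal_add (by positivity) (by positivity)]
          congr 1; ring

section

variable {A B : (Fin M → ℝ) → ℝ} (hB : Measurable B) (v : Fin M → ℝ)
include hB

/-- A and B may depend on the feature, since it is fixed before the seeds of Q_p, Q_a, Q_o are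
drawn. With B = γ⟨x, a⟩ this covers one coordinate of the SGD update. -/
theorem lintegral_quantOutGrad (hunb : m.UnbiasedQuantization) (hA : Measurable A) :
    ∫⁻ z, ENNReal.ofReal ((A (m.feature z) + B (m.feature z) * m.quantOutGrad z v) ^ 2) ∂m.law =
    ∫⁻ z, ENNReal.ofReal
      ((A (m.feature z) + B (m.feature z) * (m.label z - m.feature z ⬝ᵥ v)) ^ 2) ∂m.law +
    ∫⁻ z, ENNReal.ofReal (B (m.feature z) ^ 2) * m.quantNoise z v ∂m.law := by
  have hAf := hA.comp m.measurable_feature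
  have hBf := hB.comp m.measurable_feature
  have hv : Measurable fun _ : m.Sample => v := measurable_const
  have hN : Measurable fun z => ENNReal.ofReal (B (m.feature z) ^ 2) * m.quantNoise z v :=
    (hBf.pow_const 2).ennreal_ofReal.mul (m.measurable_quantNoise measurable_id hv)
  have hF : Measurable fun z => ENNReal.ofReal
      ((A (m.feature z) + B (m.feature z) * (m.label z - m.feature z ⬝ᵥ v)) ^ 2) :=
    ((hAf.add (hBf.mul (m.measurable_label.sub
      (measurable_dot m.measurable_feature hv)))).pow_const 2).ennreal_ofReal
  have hL : Measurable fun z => ENNReal.ofReal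
      ((A (m.feature z) + B (m.feature z) * m.quantOutGrad z v) ^ 2) :=
    ((hAf.add (hBf.mul (m.measurable_quantOutGrad measurable_id hv))).pow_const 2).ennreal_ofReal
  have hS : Measurable fun z => ENNReal.ofReal
      ((A (m.feature z) + B (m.feature z) * (m.label z - m.feature z ⬝ᵥ v)) ^ 2) +
      ENNReal.ofReal (B (m.feature z) ^ 2) * m.quantNoise z v := hF.add hN
  rw [← lintegral_add_left hF, m.lintegral_law hL, m.lintegral_law hS]
  refine lintegral_congr fun w => ?_
  obtain ⟨x, hx⟩ := m.exists_feature_eq w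
  obtain ⟨l, hl⟩ := m.exists_label_eq w
  simp only [quantNoise, quantOutGrad, outGrad, act, quantV, hx, hl]
  rw [lintegral_seeds hunb]
  simp only [lintegral_const, measure_univ, mul_one]
  simp only [lintegral_add_left measurable_const, lintegral_const, measure_univ, mul_one,
    lintegral_const_mul' _ _ (ENNReal.ofReal_ne_top (r := B x ^ 2))]

theorem lintegral_quantNoise_le (hunb : m.UnbiasedQuantization) {εp εa εo : ℝ} (hp0 : 0 ≤ εp)
    (ha0 : 0 ≤ εa) (ho0 : 0 ≤ εo) (hQp : m.Qp.Multiplicative εp) (hQa : m.Qa.Multiplicative εa)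
    (hQo : m.Qo.Multiplicative εo) :
    ∫⁻ z, ENNReal.ofReal (B (m.feature z) ^ 2) * m.quantNoise z v ∂m.law ≤
    ∫⁻ z, ENNReal.ofReal (B (m.feature z) ^ 2 * (εo * (m.label z - m.feature z ⬝ᵥ v) ^ 2 +
        (1 + εo) * (εp + (1 + εp) * εa) * (m.feature z ⬝ᵥ v) ^ 2)) ∂m.law := by
  have hBf := hB.comp m.measurable_feature
  have hv : Measurable fun _ : m.Sample => v := measurable_const
  have hN : Measurable fun z => ENNReal.ofReal (B (m.feature z) ^ 2) * m.quantNoise z v :=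
    (hBf.pow_const 2).ennreal_ofReal.mul (m.measurable_quantNoise measurable_id hv)
  have hxv : Measurable fun z => m.feature z ⬝ᵥ v := measurable_dot m.measurable_feature hv
  have hR : Measurable fun z => ENNReal.ofReal (B (m.feature z) ^ 2 *
      (εo * (m.label z - m.feature z ⬝ᵥ v) ^ 2 +
        (1 + εo) * (εp + (1 + εp) * εa) * (m.feature z ⬝ᵥ v) ^ 2)) :=
    ((hBf.pow_const 2).mul ((((m.measurable_label.sub hxv).pow_const 2).const_mul _).add
      ((hxv.pow_const 2).const_mul _))).ennreal_ofReal
  rw [m.lintegral_law hN, m.lintegral_law hR]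
  refine lintegral_mono fun w => ?_
  obtain ⟨x, hx⟩ := m.exists_feature_eq w
  obtain ⟨l, hl⟩ := m.exists_label_eq w
  simp only [quantNoise, outGrad, act, quantV, hx, hl]
  simp only [lintegral_const, measure_univ, mul_one,
    lintegral_const_mul' _ _ (ENNReal.ofReal_ne_top (r := B x ^ 2))]
  rw [ENNReal.ofReal_mul (sq_nonneg _)]
  gcongr
  exact lintegral_seeds_le hunb hp0 ha0 ho0 hQp hQa hQo x v l

end

end Model

/-! ### One step without quantization noise, from a fixed state -/

namespace Model

variable {p : ℕ∞} {M : ℕ} {m : Model p M}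

/-- The `a`-component of the update `X ↦ X - γ ⟨x, X⟩ x + κ ξ x`. -/
noncomputable def linStep (m : Model p M) (vstar : Fin M → ℝ) (γ κ : ℝ) (a X : Fin M → ℝ)
    (z : m.Sample) : ℝ :=
  a ⬝ᵥ X + (κ * (m.residual vstar z * (m.feature z ⬝ᵥ a)) +
    -γ * ((m.feature z ⬝ᵥ X) * (m.feature z ⬝ᵥ a)))

theorem measurable_residual (vstar : Fin M → ℝ) : Measurable (m.residual vstar) :=
  m.measurable_label.sub (measurable_dot measurable_const m.measurable_feature)

theorem measurable_linStep {𝒳 : Type*} [MeasurableSpace 𝒳] {X : 𝒳 → Fin M → ℝ} (hX : Measurable X)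
    (vstar a : Fin M → ℝ) (γ κ : ℝ) :
    Measurable fun s : 𝒳 × m.Sample => linStep m vstar γ κ a (X s.1) s.2 := by
  have hx : Measurable fun s : 𝒳 × m.Sample => m.feature s.2 := by fun_prop
  have hX' : Measurable fun s : 𝒳 × m.Sample => X s.1 := by fun_prop
  have hr : Measurable fun s : 𝒳 × m.Sample => m.residual vstar s.2 :=
    (measurable_residual vstar).comp measurable_snd
  have hxa := measurable_dot hx (measurable_const (a := a))
  exact (measurable_dot measurable_const hX').add (((hr.mul hxa).const_mul κ).add
    (((measurable_dot hx hX').mul hxa).const_mul (-γ)))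

section

variable (hwell : m.WellPosed) (hcov : m.DataCovariance) {α β : ℝ}
  (h4 : m.FourthMomentCondition α β) {vstar : Fin M → ℝ}
  {σlo σhi : ℝ} (hn : m.NoiseCondition vstar σlo σhi) (γ κ : ℝ) (a : Fin M → ℝ)
include hwell hcov h4 hn

theorem memLp_linStep_tail (X : Fin M → ℝ) :
    MemLp (fun z => κ * (m.residual vstar z * (m.feature z ⬝ᵥ a)) +
      -γ * ((m.feature z ⬝ᵥ X) * (m.feature z ⬝ᵥ a))) 2 m.law :=
  ((hn.integrable hwell hcov a).const_mul κ).add ((h4.memLp_dot_mul_dot X a).const_mul (-γ))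

theorem memLp_linStep (X : Fin M → ℝ) : MemLp (linStep m vstar γ κ a X) 2 m.law := by
  have h := (memLp_const (a ⬝ᵥ X)).add (memLp_linStep_tail hwell hcov h4 hn γ κ a X)
  exact h

variable (hopt : ∀ v, m.riskq vstar ≤ m.riskq v) {lama : ℝ}
  (ha : ∀ c, a ⬝ᵥ (m.covHf *ᵥ c) = lama * (a ⬝ᵥ c))
include hopt ha

theorem integral_linStep_tail (X : Fin M → ℝ) :
    ∫ z, (κ * (m.residual vstar z * (m.feature z ⬝ᵥ a)) +
      -γ * ((m.feature z ⬝ᵥ X) * (m.feature z ⬝ᵥ a))) ∂m.law = -γ * (lama * (a ⬝ᵥ X)) := by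
  have h1 := ((hn.integrable hwell hcov a).const_mul κ).integrable one_le_two
  have h2 := ((h4.memLp_dot_mul_dot X a).const_mul (-γ)).integrable one_le_two
  rw [integral_add h1 h2, integral_const_mul, integral_const_mul,
    integral_residual_mul_dot hwell hcov hopt, ← ha]
  simp only [mul_comm (m.feature _ ⬝ᵥ X)]
  rw [hcov.integral_dot_mul_dot]
  ring

theorem integral_linStep (X : Fin M → ℝ) :
    ∫ z, linStep m vstar γ κ a X z ∂m.law = (1 - γ * lama) * (a ⬝ᵥ X) := by
  simp only [linStep]
  rw [integral_add (integrable_const _)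
    ((memLp_linStep_tail hwell hcov h4 hn γ κ a X).integrable one_le_two),
    integral_linStep_tail hwell hcov h4 hn γ κ a hopt ha]
  simp
  ring

/-- Expanding the square, the mean drift gives -2γλ, the fourth moment bounds the quadratic term in
X and the noise condition bounds the pure noise. The remaining term is the correlation of ξ⟨x, a⟩
with ⟨x, X⟩⟨x, a⟩. It has no sign, but it is linear in X; Ψ is its coefficient vector and does not
depend on X. -/
theorem integral_linStep_sq_le (hnorm : normSq m.covHf a = lama) :
    ∃ Ψ : Fin M → ℝ, ∀ X : Fin M → ℝ, ∫ z, linStep m vstar γ κ a X z ^ 2 ∂m.law ≤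
      (1 - 2 * γ * lama) * (a ⬝ᵥ X) ^ 2 + γ ^ 2 * (α * lama * normSq m.covHf X) +
        κ ^ 2 * (σhi ^ 2 * lama) + κ * (Ψ ⬝ᵥ X) := by
  have hr := hn.integrable hwell hcov a
  refine ⟨fun k => -2 * γ * ∫ z, (m.residual vstar z * (m.feature z ⬝ᵥ a)) *
    (m.feature z k * (m.feature z ⬝ᵥ a)) ∂m.law, fun X => ?_⟩
  have ht := memLp_linStep_tail hwell hcov h4 hn γ κ a X
  have hg := h4.memLp_dot_mul_dot X a
  have e1 := integral_add_mul_sq (memLp_const (a ⬝ᵥ X)) ht 1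
  have e2 := integral_add_mul_sq (hr.const_mul κ) hg (-γ)
  simp only [one_mul, integral_const_mul, mul_assoc κ,
    integral_linStep_tail hwell hcov h4 hn γ κ a hopt ha X, mul_pow κ] at e1 e2
  have e3 : ∫ z, (m.residual vstar z * (m.feature z ⬝ᵥ a)) *
      ((m.feature z ⬝ᵥ X) * (m.feature z ⬝ᵥ a)) ∂m.law =
      (fun k => ∫ z, (m.residual vstar z * (m.feature z ⬝ᵥ a)) *
        (m.feature z k * (m.feature z ⬝ᵥ a)) ∂m.law) ⬝ᵥ X := by
    have e4 : ∀ z, (m.residual vstar z * (m.feature z ⬝ᵥ a)) *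
        ((m.feature z ⬝ᵥ X) * (m.feature z ⬝ᵥ a)) = ∑ k, (m.residual vstar z *
          (m.feature z ⬝ᵥ a)) * (m.feature z k * (m.feature z ⬝ᵥ a)) * X k := by
      intro z
      have hd : m.feature z ⬝ᵥ X = ∑ k, m.feature z k * X k := rfl
      rw [hd, Finset.sum_mul, Finset.mul_sum]
      exact Finset.sum_congr rfl fun k _ => by ring
    simp only [e4]
    have hk : ∀ k, Integrable (fun z => (m.residual vstar z * (m.feature z ⬝ᵥ a)) *
        (m.feature z k * (m.feature z ⬝ᵥ a)) * X k) m.law := fun k =>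
      (hr.integrable_mul (memLp_mul_of_four (h4.finite k) (h4.memLp_dot a))).mul_const _
    rw [integral_finsetSum _ fun k _ => hk k]
    exact Finset.sum_congr rfl fun k _ => integral_mul_const _ _
  have b1 := hn.integral_le a
  have b2 := h4.integral_le X a
  rw [hnorm] at b1 b2
  rw [e3] at e2
  simp only [linStep]
  rw [e1, e2]
  have e5 : ∀ g : Fin M → ℝ, (fun k => -2 * γ * g k) ⬝ᵥ X = -2 * γ * (g ⬝ᵥ X) := fun g => by
    simp only [dotProduct, Finset.mul_sum, mul_assoc]
  rw [e5]
  simp only [integral_const, probReal_univ, smul_eq_mul, one_mul, one_pow]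
  nlinarith [mul_le_mul_of_nonneg_left b1 (sq_nonneg κ), mul_le_mul_of_nonneg_left b2 (sq_nonneg γ)]

end

end Model

theorem integrable_normSq {M : ℕ} {𝒳 : Type*} [MeasurableSpace 𝒳] {ρ : Measure 𝒳}
    {X : 𝒳 → Fin M → ℝ} (hX2 : ∀ i, MemLp (fun s => X s i) 2 ρ) (H : Matrix (Fin M) (Fin M) ℝ) :
    Integrable (fun s => normSq H (X s)) ρ := by
  unfold normSq
  refine integrable_finsetSum _ fun i _ => ?_
  have h : MemLp (fun s => (H *ᵥ X s) i) 2 ρ := by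
    simpa only [Matrix.mulVec, dotProduct_comm (fun j => H i j)] using memLp_dot hX2 (H i)
  exact (hX2 i).integrable_mul h

/-! ### One step from a random state, without and with quantization noise -/

namespace Model

variable {p : ℕ∞} {M : ℕ} {m : Model p M}

section

variable (hwell : m.WellPosed) (hcov : m.DataCovariance) {α β : ℝ}
  (h4 : m.FourthMomentCondition α β) {vstar : Fin M → ℝ}
  {σlo σhi : ℝ} (hn : m.NoiseCondition vstar σlo σhi) (γ κ : ℝ) {a : Fin M → ℝ}
  (hopt : ∀ v, m.riskq vstar ≤ m.riskq v) {lama : ℝ}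
  (ha : ∀ c, a ⬝ᵥ (m.covHf *ᵥ c) = lama * (a ⬝ᵥ c))
  {𝒳 : Type*} [MeasurableSpace 𝒳] {ρ : Measure 𝒳} [IsProbabilityMeasure ρ]
  {X : 𝒳 → Fin M → ℝ} (hX : Measurable X) (hX2 : ∀ i, MemLp (fun s => X s i) 2 ρ)
include hwell hcov h4 hn hopt ha hX hX2

/-- The assumption `hzero` removes the linear remainder Ψ for two reasons at once: κ = 0 for the
bias part, a centred state for the noise part. -/
theorem linStep_prod (hnorm : normSq m.covHf a = lama)
    (hzero : ∀ c : Fin M → ℝ, κ * ∫ s, c ⬝ᵥ X s ∂ρ = 0) :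
    MemLp (fun s : 𝒳 × m.Sample => linStep m vstar γ κ a (X s.1) s.2) 2 (ρ.prod m.law) ∧
    ∫ s, linStep m vstar γ κ a (X s.1) s.2 ^ 2 ∂(ρ.prod m.law) ≤
      (1 - 2 * γ * lama) * ∫ s, (a ⬝ᵥ X s) ^ 2 ∂ρ +
        γ ^ 2 * (α * lama * ∫ s, normSq m.covHf (X s) ∂ρ) + κ ^ 2 * (σhi ^ 2 * lama) := by
  obtain ⟨Ψ, hΨ⟩ := integral_linStep_sq_le hwell hcov h4 hn γ κ a hopt ha hnorm
  have hm := measurable_linStep (m := m) hX vstar a γ κ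
  have hdot : ∀ c : Fin M → ℝ, MemLp (fun s => c ⬝ᵥ X s) 2 ρ := fun c => by
    simpa only [dotProduct_comm c] using memLp_dot hX2 c
  set R : 𝒳 → ℝ := fun s => (1 - 2 * γ * lama) * (a ⬝ᵥ X s) ^ 2 +
    γ ^ 2 * (α * lama * normSq m.covHf (X s)) + κ ^ 2 * (σhi ^ 2 * lama) + κ * (Ψ ⬝ᵥ X s) with hR
  have i1 : Integrable (fun s => (1 - 2 * γ * lama) * (a ⬝ᵥ X s) ^ 2) ρ :=
    (hdot a).integrable_sq.const_mul _
  have i2 : Integrable (fun s => γ ^ 2 * (α * lama * normSq m.covHf (X s))) ρ :=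
    ((integrable_normSq hX2 _).const_mul _).const_mul _
  have i3 : Integrable (fun s => κ * (Ψ ⬝ᵥ X s)) ρ :=
    ((hdot Ψ).integrable one_le_two).const_mul _
  have i12 : Integrable (fun s => (1 - 2 * γ * lama) * (a ⬝ᵥ X s) ^ 2 +
    γ ^ 2 * (α * lama * normSq m.covHf (X s))) ρ := i1.add i2
  have i123 : Integrable (fun s => (1 - 2 * γ * lama) * (a ⬝ᵥ X s) ^ 2 +
    γ ^ 2 * (α * lama * normSq m.covHf (X s)) + κ ^ 2 * (σhi ^ 2 * lama)) ρ :=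
    i12.add (integrable_const _)
  have iR : Integrable R ρ := i123.add i3
  -- R dominates an integral of a square, so it is nonnegative although its linear term may have
  -- either sign. This lets the bound be integrated in [0, ∞] and read back in ℝ.
  have hRnn : ∀ s, 0 ≤ R s := fun s =>
    le_trans (integral_nonneg fun _ => sq_nonneg _) (hΨ (X s))
  have hRint : ∫ s, R s ∂ρ = (1 - 2 * γ * lama) * ∫ s, (a ⬝ᵥ X s) ^ 2 ∂ρ +
        γ ^ 2 * (α * lama * ∫ s, normSq m.covHf (X s) ∂ρ) + κ ^ 2 * (σhi ^ 2 * lama) := by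
    simp only [hR]
    rw [integral_add i123 i3, integral_add i12 (integrable_const _), integral_add i1 i2]
    simp only [integral_const_mul, integral_const, probReal_univ, smul_eq_mul, one_mul, hzero,
      add_zero]
  have hle : ∫⁻ s, ENNReal.ofReal (linStep m vstar γ κ a (X s.1) s.2 ^ 2) ∂(ρ.prod m.law) ≤
      ENNReal.ofReal (∫ s, R s ∂ρ) := by
    rw [lintegral_prod _ (hm.pow_const 2).ennreal_ofReal.aemeasurable,
      ofReal_integral_eq_lintegral_ofReal iR (ae_of_all _ hRnn)]
    refine lintegral_mono fun s => ?_
    simp only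
    rw [lintegral_ofReal_sq (memLp_linStep hwell hcov h4 hn γ κ a (X s))]
    exact ENNReal.ofReal_le_ofReal (hΨ (X s))
  have hmem := memLp_two_of_lintegral_lt_top hm.aestronglyMeasurable
    (hle.trans_lt ENNReal.ofReal_lt_top)
  refine ⟨hmem, ?_⟩
  rw [lintegral_ofReal_sq hmem, ENNReal.ofReal_le_ofReal_iff (integral_nonneg hRnn)] at hle
  exact hle.trans hRint.le

omit hX hX2 in
theorem integral_mul_linStep {Y : 𝒳 → ℝ} (hY : MemLp Y 2 ρ)
    (hmem : MemLp (fun s : 𝒳 × m.Sample => linStep m vstar γ κ a (X s.1) s.2) 2 (ρ.prod m.law)) :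
    ∫ s, Y s.1 * linStep m vstar γ κ a (X s.1) s.2 ∂(ρ.prod m.law) =
      (1 - γ * lama) * ∫ s, Y s * (a ⬝ᵥ X s) ∂ρ := by
  have hi : Integrable (fun s : 𝒳 × m.Sample => Y s.1 * linStep m vstar γ κ a (X s.1) s.2)
    (ρ.prod m.law) := (hY.comp_fst m.law).integrable_mul hmem
  rw [integral_prod _ hi, ← integral_const_mul]
  refine integral_congr_ae (ae_of_all _ fun s => ?_)
  simp only
  rw [integral_const_mul, integral_linStep hwell hcov h4 hn γ κ a hopt ha]
  ring

end

/-- The `a`-component of the quantized update of the deviation from `v*`, of which `X` is one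
part, `v` being the current iterate. -/
noncomputable def quantStep (m : Model p M) (vstar : Fin M → ℝ) (γ : ℝ) (a v X : Fin M → ℝ)
    (z : m.Sample) : ℝ :=
  a ⬝ᵥ X + (γ * ((m.quantOutGrad z v + m.feature z ⬝ᵥ (v - vstar)) * (m.feature z ⬝ᵥ a)) +
    -γ * ((m.feature z ⬝ᵥ X) * (m.feature z ⬝ᵥ a)))

section

variable (hunb : m.UnbiasedQuantization) (vstar : Fin M → ℝ) (γ : ℝ) (a : Fin M → ℝ)
  {𝒳 : Type*} [MeasurableSpace 𝒳] {v X : 𝒳 → Fin M → ℝ} (hv : Measurable v) (hX : Measurable X)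

include hv hX in
theorem measurable_quantStep :
    Measurable fun s : 𝒳 × m.Sample => quantStep m vstar γ a (v s.1) (X s.1) s.2 := by
  have hx : Measurable fun s : 𝒳 × m.Sample => m.feature s.2 := by fun_prop
  have hX' : Measurable fun s : 𝒳 × m.Sample => X s.1 := by fun_prop
  have hv' : Measurable fun s : 𝒳 × m.Sample => v s.1 := by fun_prop
  have hq := m.measurable_quantOutGrad (f := fun s : 𝒳 × m.Sample => s.2) measurable_snd hv'
  have hxa := measurable_dot hx (measurable_const (a := a))
  exact (measurable_dot measurable_const hX').add ((((hq.add (measurable_dot hx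
    (hv'.sub measurable_const))).mul hxa).const_mul γ).add
    (((measurable_dot hx hX').mul hxa).const_mul (-γ)))

include hunb hv hX in
-- The excess on the right does not involve Y. Comparing Y = 0 with a general Y therefore determines
-- the cross term between Y and the step.
theorem lintegral_quantStep {Y : 𝒳 → ℝ} (hY : Measurable Y) (ρ : Measure 𝒳) [SFinite ρ] :
    ∫⁻ s, ENNReal.ofReal ((Y s.1 + quantStep m vstar γ a (v s.1) (X s.1) s.2) ^ 2)
      ∂(ρ.prod m.law) =
    ∫⁻ s, ENNReal.ofReal ((Y s.1 + linStep m vstar γ γ a (X s.1) s.2) ^ 2) ∂(ρ.prod m.law) +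
    ∫⁻ s, ENNReal.ofReal ((γ * (m.feature s.2 ⬝ᵥ a)) ^ 2) * m.quantNoise s.2 (v s.1)
      ∂(ρ.prod m.law) := by
  have hx : Measurable fun s : 𝒳 × m.Sample => m.feature s.2 := by fun_prop
  have hv' : Measurable fun s : 𝒳 × m.Sample => v s.1 := by fun_prop
  have hY' : Measurable fun s : 𝒳 × m.Sample => Y s.1 := by fun_prop
  have hxa := measurable_dot hx (measurable_const (a := a))
  have h1 : Measurable fun s : 𝒳 × m.Sample =>
      ENNReal.ofReal ((Y s.1 + quantStep m vstar γ a (v s.1) (X s.1) s.2) ^ 2) :=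
    ((hY'.add (measurable_quantStep vstar γ a hv hX)).pow_const 2).ennreal_ofReal
  have h2 : Measurable fun s : 𝒳 × m.Sample =>
      ENNReal.ofReal ((Y s.1 + linStep m vstar γ γ a (X s.1) s.2) ^ 2) :=
    ((hY'.add (measurable_linStep hX vstar a γ γ)).pow_const 2).ennreal_ofReal
  have h3 : Measurable fun s : 𝒳 × m.Sample =>
      ENNReal.ofReal ((γ * (m.feature s.2 ⬝ᵥ a)) ^ 2) * m.quantNoise s.2 (v s.1) :=
    (((hxa.const_mul γ).pow_const 2).ennreal_ofReal).mul
      (m.measurable_quantNoise (f := fun s : 𝒳 × m.Sample => s.2) measurable_snd hv')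
  rw [lintegral_prod _ h1.aemeasurable, lintegral_prod _ h2.aemeasurable,
    lintegral_prod _ h3.aemeasurable, ← lintegral_add_left h2.lintegral_prod_right']
  refine lintegral_congr fun s => ?_
  have hd : ∀ c : Fin M → ℝ, Measurable fun x : Fin M → ℝ => x ⬝ᵥ c := fun c =>
    measurable_dot measurable_id measurable_const
  have key := lintegral_quantOutGrad (m := m) (B := fun x => γ * (x ⬝ᵥ a))
    (A := fun x => Y s + (a ⬝ᵥ X s + (γ * ((x ⬝ᵥ (v s - vstar)) * (x ⬝ᵥ a)) +
      -γ * ((x ⬝ᵥ X s) * (x ⬝ᵥ a))))) ((hd a).const_mul γ) (v s) hunb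
    (measurable_const.add (measurable_const.add ((((hd _).mul (hd a)).const_mul γ).add
      (((hd _).mul (hd a)).const_mul (-γ)))))
  convert key using 3 with z z
  · rw [quantStep]; congr 2; ring
  · funext z
    rw [linStep, residual, dotProduct_sub, dotProduct_comm vstar]; congr 2; ring

end

section

variable (hunb : m.UnbiasedQuantization) {vstar : Fin M → ℝ} {γ : ℝ} {a : Fin M → ℝ}
  {𝒳 : Type*} [MeasurableSpace 𝒳] {v X : 𝒳 → Fin M → ℝ} (hv : Measurable v) (hX : Measurable X)
  {ρ : Measure 𝒳} [IsProbabilityMeasure ρ]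
  (hmem : MemLp (fun s : 𝒳 × m.Sample => linStep m vstar γ γ a (X s.1) s.2) 2 (ρ.prod m.law))
  {n : ℝ} (hn0 : 0 ≤ n)
  (hnoise : ∫⁻ s, ENNReal.ofReal ((m.feature s.2 ⬝ᵥ a) ^ 2) * m.quantNoise s.2 (v s.1)
    ∂(ρ.prod m.law) ≤ ENNReal.ofReal n)

omit [IsProbabilityMeasure ρ] in
include hnoise in
theorem lintegral_noise_le :
    ∫⁻ s, ENNReal.ofReal ((γ * (m.feature s.2 ⬝ᵥ a)) ^ 2) * m.quantNoise s.2 (v s.1)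
      ∂(ρ.prod m.law) ≤ ENNReal.ofReal (γ ^ 2 * n) := by
  simp only [mul_pow, ENNReal.ofReal_mul (sq_nonneg γ), mul_assoc]
  rw [lintegral_const_mul' _ _ ENNReal.ofReal_ne_top]
  gcongr

include hunb hv hX hmem hnoise

theorem memLp_quantStep :
    MemLp (fun s : 𝒳 × m.Sample => quantStep m vstar γ a (v s.1) (X s.1) s.2) 2 (ρ.prod m.law) := by
  refine memLp_two_of_lintegral_lt_top (measurable_quantStep vstar γ a hv hX).aestronglyMeasurable ?_
  have h := lintegral_quantStep hunb vstar γ a hv hX (Y := 0) measurable_const ρ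
  simp only [Pi.zero_apply, zero_add] at h
  rw [h, lintegral_ofReal_sq hmem]
  exact ENNReal.add_lt_top.mpr ⟨ENNReal.ofReal_lt_top,
    (lintegral_noise_le (γ := γ) hnoise).trans_lt ENNReal.ofReal_lt_top⟩

include hn0 in
theorem integral_quantStep_sq_le :
    ∫ s, quantStep m vstar γ a (v s.1) (X s.1) s.2 ^ 2 ∂(ρ.prod m.law) ≤
      ∫ s, linStep m vstar γ γ a (X s.1) s.2 ^ 2 ∂(ρ.prod m.law) + γ ^ 2 * n := by
  have h := lintegral_quantStep hunb vstar γ a hv hX (Y := 0) measurable_const ρ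
  simp only [Pi.zero_apply, zero_add] at h
  rw [lintegral_ofReal_sq hmem, lintegral_ofReal_sq (memLp_quantStep hunb hv hX hmem hnoise)] at h
  have h0 : 0 ≤ ∫ s, linStep m vstar γ γ a (X s.1) s.2 ^ 2 ∂(ρ.prod m.law) :=
    integral_nonneg fun _ => sq_nonneg _
  rw [← ENNReal.ofReal_le_ofReal_iff (by positivity), h, ENNReal.ofReal_add h0 (by positivity)]
  gcongr
  exact lintegral_noise_le hnoise

/-- The quantization noise is orthogonal to every square integrable function of the past. -/
theorem integral_mul_quantStep {Y : 𝒳 → ℝ} (hYm : Measurable Y) (hY : MemLp Y 2 ρ) :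
    ∫ s, Y s.1 * quantStep m vstar γ a (v s.1) (X s.1) s.2 ∂(ρ.prod m.law) =
      ∫ s, Y s.1 * linStep m vstar γ γ a (X s.1) s.2 ∂(ρ.prod m.law) := by
  have hq := memLp_quantStep hunb hv hX hmem hnoise
  have hY' : MemLp (fun s : 𝒳 × m.Sample => Y s.1) 2 (ρ.prod m.law) := hY.comp_fst m.law
  have hYq : MemLp (fun s : 𝒳 × m.Sample => Y s.1 + quantStep m vstar γ a (v s.1) (X s.1) s.2) 2
    (ρ.prod m.law) := hY'.add hq
  have hYl : MemLp (fun s : 𝒳 × m.Sample => Y s.1 + linStep m vstar γ γ a (X s.1) s.2) 2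
    (ρ.prod m.law) := hY'.add hmem
  -- Polarization: the same finite noise term C separates the quantized and the exact step in
  -- E(step²) and in E((Y + step)²). Subtraction cancels C and leaves equal cross terms.
  have h0 := lintegral_quantStep hunb vstar γ a hv hX (Y := 0) measurable_const ρ
  have h1 := lintegral_quantStep hunb vstar γ a hv hX hYm ρ
  simp only [Pi.zero_apply, zero_add] at h0
  have hC := ((lintegral_noise_le (γ := γ) hnoise).trans_lt ENNReal.ofReal_lt_top).ne
  generalize ∫⁻ s, ENNReal.ofReal ((γ * (m.feature s.2 ⬝ᵥ a)) ^ 2) * m.quantNoise s.2 (v s.1)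
    ∂(ρ.prod m.law) = C at h0 h1 hC
  rw [lintegral_ofReal_sq hmem, lintegral_ofReal_sq hq] at h0
  rw [lintegral_ofReal_sq hYl, lintegral_ofReal_sq hYq] at h1
  have nn : ∀ f : 𝒳 × m.Sample → ℝ, 0 ≤ ∫ s, f s ^ 2 ∂(ρ.prod m.law) := fun f =>
    integral_nonneg fun _ => sq_nonneg _
  have t0 := congrArg ENNReal.toReal h0
  have t1 := congrArg ENNReal.toReal h1
  rw [ENNReal.toReal_add ENNReal.ofReal_ne_top hC, ENNReal.toReal_ofReal (nn _),
    ENNReal.toReal_ofReal (nn _)] at t0 t1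
  have e1 := integral_add_mul_sq hY' hq 1
  have e2 := integral_add_mul_sq hY' hmem 1
  simp only [one_mul, one_pow] at e1 e2
  linarith

end

end Model

/-! ### Bounds on the injected noise -/

namespace Model

variable {p : ℕ∞} {M : ℕ} {m : Model p M}

/-- The feature is independent of the seed of the quantizer of the parameters. -/
theorem lintegral_feature_seed {g : (Fin M → ℝ) × m.Qp.Seed → ℝ≥0∞} (hg : Measurable g) :
    ∫⁻ z, g (m.feature z, z.2.2.1) ∂m.law =
      ∫⁻ sp, ∫⁻ z, g (m.feature z, sp) ∂m.law ∂m.Qp.law := by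
  have h1 : Measurable fun w : m.Sample × m.Qp.Seed => g (m.feature w.1, w.2) :=
    hg.comp (by fun_prop)
  have h2 : Measurable fun z => g (m.feature z, z.2.2.1) := hg.comp (by fun_prop)
  rw [← lintegral_lintegral_swap h1.aemeasurable, m.lintegral_law h2,
    m.lintegral_law h1.lintegral_prod_right']
  refine lintegral_congr fun w => ?_
  obtain ⟨x, hx⟩ := m.exists_feature_eq w
  simp only [hx, lintegral_const, measure_univ, mul_one]

section

variable (hcov : m.DataCovariance) {α β : ℝ} (h4 : m.FourthMomentCondition α β)
include h4

theorem FourthMomentCondition.lintegral_le (a c : Fin M → ℝ) :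
    ∫⁻ z, ENNReal.ofReal ((m.feature z ⬝ᵥ a) ^ 2) * ENNReal.ofReal ((m.feature z ⬝ᵥ c) ^ 2)
      ∂m.law ≤ ENNReal.ofReal (α * normSq m.covHf a * normSq m.covHf c) := by
  simp only [← ENNReal.ofReal_mul (sq_nonneg _), ← mul_pow]
  rw [lintegral_ofReal_sq (h4.memLp_dot_mul_dot a c)]
  exact ENNReal.ofReal_le_ofReal (h4.integral_le a c)

include hcov in
-- Independence of the feature and the seed of Q_p allows the error vector Q_p(v) - v to be frozen;
-- the fourth-moment bound then applies with that vector as c.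
theorem lintegral_paramErr_le (a v : Fin M → ℝ) :
    ∫⁻ z, ENNReal.ofReal ((m.feature z ⬝ᵥ a) ^ 2) *
      ENNReal.ofReal ((m.feature z ⬝ᵥ (m.quantV z v - v)) ^ 2) ∂m.law ≤
    ENNReal.ofReal (α * normSq m.covHf a) *
      ∫⁻ z, ENNReal.ofReal (normSq m.covHf (m.quantV z v - v)) ∂m.law := by
  have hp : Measurable fun sp => m.Qp.map v sp - v :=
    (m.Qp.measurable_map.comp (measurable_const.prodMk measurable_id)).sub measurable_const
  have hp' : Measurable fun w : (Fin M → ℝ) × m.Qp.Seed => m.Qp.map v w.2 - v :=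
    hp.comp measurable_snd
  have h1 := lintegral_feature_seed (m := m) (g := fun w => ENNReal.ofReal ((w.1 ⬝ᵥ a) ^ 2) *
    ENNReal.ofReal ((w.1 ⬝ᵥ (m.Qp.map v w.2 - v)) ^ 2))
    (((measurable_dot measurable_fst measurable_const).pow_const 2).ennreal_ofReal.mul
      ((measurable_dot measurable_fst hp').pow_const 2).ennreal_ofReal)
  have hcont : Measurable fun e : Fin M → ℝ => normSq m.covHf e := by
    unfold normSq
    exact Continuous.measurable (by fun_prop)
  have h2 := lintegral_feature_seed (m := m) (g := fun w => 
    ENNReal.ofReal (normSq m.covHf (m.Qp.map v w.2 - v))) (hcont.comp hp').ennreal_ofReal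
  simp only [lintegral_const, measure_univ, mul_one] at h2
  simp only [quantV]
  rw [h1, h2, ← lintegral_const_mul' _ _ ENNReal.ofReal_ne_top]
  refine lintegral_mono fun sp => ?_
  simp only
  rw [← ENNReal.ofReal_mul (mul_nonneg h4.pos_α.le (hcov.normSq_covHf_nonneg a))]
  exact h4.lintegral_le _ _

end

section

variable (hcov : m.DataCovariance) {α β : ℝ} (h4 : m.FourthMomentCondition α β)
  {𝒳 : Type*} [MeasurableSpace 𝒳] {ρ : Measure 𝒳} [IsProbabilityMeasure ρ]
  {v b w : 𝒳 → Fin M → ℝ} (hv : Measurable v) {a : Fin M → ℝ}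

omit [IsProbabilityMeasure ρ] in
include hcov h4 hv in
theorem lintegral_prod_paramErr_le :
    ∫⁻ s, ENNReal.ofReal ((m.feature s.2 ⬝ᵥ a) ^ 2) *
      ENNReal.ofReal ((m.feature s.2 ⬝ᵥ (m.quantV s.2 (v s.1) - v s.1)) ^ 2) ∂(ρ.prod m.law) ≤
    ENNReal.ofReal (α * normSq m.covHf a) * ∫⁻ s, ENNReal.ofReal
      ((m.covHf * outer (m.quantV s.2 (v s.1) - v s.1)).trace) ∂(ρ.prod m.law) := by
  simp only [trace_mul_outer]
  have hv' : Measurable fun s : 𝒳 × m.Sample => v s.1 := by fun_prop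
  have hq := (m.measurable_quantV (f := fun s : 𝒳 × m.Sample => s.2) measurable_snd hv').sub hv'
  have hcont : Measurable fun e : Fin M → ℝ => normSq m.covHf e := by
    unfold normSq
    exact Continuous.measurable (by fun_prop)
  have hE : Measurable fun s : 𝒳 × m.Sample =>
      ENNReal.ofReal (normSq m.covHf (m.quantV s.2 (v s.1) - v s.1)) :=
    (hcont.comp hq).ennreal_ofReal
  refine (lintegral_prod_le _).trans ?_
  rw [lintegral_prod _ hE.aemeasurable, ← lintegral_const_mul' _ _ ENNReal.ofReal_ne_top]
  exact lintegral_mono fun s => lintegral_paramErr_le hcov h4 a (v s)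

variable (hwell : m.WellPosed) {vstar : Fin M → ℝ} {σlo σhi : ℝ}
  (hn : m.NoiseCondition vstar σlo σhi)
  (hunb : m.UnbiasedQuantization) {εp εa εo : ℝ} (hp0 : 0 ≤ εp)
    (ha0 : 0 ≤ εa) (ho0 : 0 ≤ εo) (hQp : m.Qp.Multiplicative εp) (hQa : m.Qa.Multiplicative εa)
    (hQo : m.Qo.Multiplicative εo)
include hcov h4 hwell hn hunb hp0 ha0 ho0 hQp hQa hQo

/-- With v = v* + η the exact output gradient is ξ - ⟨x, η⟩ and the exact activation is ⟨x, v*⟩ +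
⟨x, η⟩. Separating each square by (p + q)² ≤ 2p² + 2q² is the source of the factors 2; the three
resulting moments are covered by the noise and fourth-moment conditions. -/
theorem lintegral_quantNoise_le_normSq (v η : Fin M → ℝ) (hη : v = vstar + η) :
    ∫⁻ z, ENNReal.ofReal ((m.feature z ⬝ᵥ a) ^ 2) * m.quantNoise z v ∂m.law ≤
      ENNReal.ofReal (normSq m.covHf a * (2 * εo * σhi ^ 2 + 
        2 * (1 + εo) * (εp + (1 + εp) * εa) * α * normSq m.covHf vstar +
        (2 * εo + 2 * (1 + εo) * (εp + (1 + εp) * εa)) * α * normSq m.covHf η)) := by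
  have h := lintegral_quantNoise_le (m := m) (B := fun x => x ⬝ᵥ a)
    (measurable_dot measurable_id measurable_const) v hunb hp0 ha0 ho0 hQp hQa hQo
  set K := (εp + (1 + εp) * εa) with hK
  have hK0 : 0 ≤ K := by positivity
  have hr := hn.integrable hwell hcov a
  have hs := h4.memLp_dot_mul_dot vstar a
  have he := h4.memLp_dot_mul_dot η a
  refine h.trans ?_
  have hle : ∀ z, (m.feature z ⬝ᵥ a) ^ 2 * (εo * (m.label z - m.feature z ⬝ᵥ v) ^ 2 +
      (1 + εo) * K * (m.feature z ⬝ᵥ v) ^ 2) ≤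
      2 * εo * (m.residual vstar z * (m.feature z ⬝ᵥ a)) ^ 2 +
      2 * (1 + εo) * K * ((m.feature z ⬝ᵥ vstar) * (m.feature z ⬝ᵥ a)) ^ 2 +
      (2 * εo + 2 * (1 + εo) * K) * ((m.feature z ⬝ᵥ η) * (m.feature z ⬝ᵥ a)) ^ 2 := by
    intro z
    have e1 : m.feature z ⬝ᵥ v = m.feature z ⬝ᵥ vstar + m.feature z ⬝ᵥ η := by
      rw [hη, dotProduct_add]
    rw [residual, dotProduct_comm vstar, e1]
    generalize m.feature z ⬝ᵥ vstar = s
    generalize m.feature z ⬝ᵥ η = e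
    generalize m.feature z ⬝ᵥ a = x
    generalize m.label z = l
    -- `c1` and `c2` are the exact slack of the two inequalities (p + q)² ≤ 2p² + 2q².
    have c1 : 0 ≤ εo * x ^ 2 * (l - s + e) ^ 2 := by positivity
    have c2 : 0 ≤ (1 + εo) * K * x ^ 2 * (s - e) ^ 2 := by positivity
    linarith
  have i1 : Integrable (fun z => 2 * εo * (m.residual vstar z * (m.feature z ⬝ᵥ a)) ^ 2) m.law :=
    hr.integrable_sq.const_mul _
  have i2 : Integrable (fun z => 2 * (1 + εo) * K * 
    ((m.feature z ⬝ᵥ vstar) * (m.feature z ⬝ᵥ a)) ^ 2) m.law := hs.integrable_sq.const_mul _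
  have i3 : Integrable (fun z => (2 * εo + 2 * (1 + εo) * K) *
    ((m.feature z ⬝ᵥ η) * (m.feature z ⬝ᵥ a)) ^ 2) m.law := he.integrable_sq.const_mul _
  have i12 : Integrable (fun z => 2 * εo * (m.residual vstar z * (m.feature z ⬝ᵥ a)) ^ 2 +
    2 * (1 + εo) * K * ((m.feature z ⬝ᵥ vstar) * (m.feature z ⬝ᵥ a)) ^ 2) m.law := i1.add i2
  have i123 : Integrable (fun z => 2 * εo * (m.residual vstar z * (m.feature z ⬝ᵥ a)) ^ 2 +
    2 * (1 + εo) * K * ((m.feature z ⬝ᵥ vstar) * (m.feature z ⬝ᵥ a)) ^ 2 + 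
    (2 * εo + 2 * (1 + εo) * K) * ((m.feature z ⬝ᵥ η) * (m.feature z ⬝ᵥ a)) ^ 2) m.law :=
    i12.add i3
  refine (lintegral_mono fun z => ENNReal.ofReal_le_ofReal (hle z)).trans ?_
  rw [← ofReal_integral_eq_lintegral_ofReal i123 (ae_of_all _ fun z => by positivity)]
  apply ENNReal.ofReal_le_ofReal
  rw [integral_add i12 i3, integral_add i1 i2, integral_const_mul, integral_const_mul,
    integral_const_mul]
  have b1 := mul_le_mul_of_nonneg_left (hn.integral_le a) (show 0 ≤ 2 * εo by positivity)
  have b2 := mul_le_mul_of_nonneg_left (h4.integral_le vstar a)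
    (show 0 ≤ 2 * (1 + εo) * K by positivity)
  have b3 := mul_le_mul_of_nonneg_left (h4.integral_le η a)
    (show 0 ≤ 2 * εo + 2 * (1 + εo) * K by positivity)
  linarith

/-- Splitting η = b + w costs one more factor 2, which accounts for the 4 in front of ε_o in ε̃. The
part that does not grow with the state goes to the noise level, the rest to the fourth-moment
constant. -/
theorem lintegral_prod_quantNoise_le (hb2 : ∀ i, MemLp (fun s => b s i) 2 ρ)
    (hw2 : ∀ i, MemLp (fun s => w s i) 2 ρ) (hvbw : ∀ s, v s = vstar + (b s + w s)) :
    ∫⁻ s, ENNReal.ofReal ((m.feature s.2 ⬝ᵥ a) ^ 2) * m.quantNoise s.2 (v s.1) ∂(ρ.prod m.law) ≤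
      ENNReal.ofReal (normSq m.covHf a * (sigmaM2 m.covHf vstar α σhi εp εa εo - σhi ^ 2 +
        epsTilde εp εa εo * α * (∫ s, normSq m.covHf (b s) ∂ρ + ∫ s, normSq m.covHf (w s) ∂ρ))) := by
  refine (lintegral_prod_le _).trans ?_
  have hb := integrable_normSq hb2 m.covHf
  have hw := integrable_normSq hw2 m.covHf
  have hbw : Integrable (fun s => normSq m.covHf (b s) + normSq m.covHf (w s)) ρ := hb.add hw
  have hα := h4.pos_α
  set σ' := sigmaM2 m.covHf vstar α σhi εp εa εo - σhi ^ 2 with hσ'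
  have hσeq : σ' = 2 * εo * σhi ^ 2 +
      (2 * εo + 1) * (2 * εp + 2 * (1 + εp) * εa) * α * normSq m.covHf vstar := by
    rw [hσ', sigmaM2, trace_mul_outer]; ring
  have hσ0 : 0 ≤ σ' := by
    have := hcov.normSq_covHf_nonneg vstar
    rw [hσeq]; positivity
  have hε : 0 ≤ epsTilde εp εa εo := by unfold epsTilde; positivity
  have iR : Integrable (fun s => normSq m.covHf a * (σ' + epsTilde εp εa εo * α *
      (normSq m.covHf (b s) + normSq m.covHf (w s)))) ρ :=
    ((integrable_const σ').add (hbw.const_mul _)).const_mul _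
  have hA := hcov.normSq_covHf_nonneg a
  have e1 : normSq m.covHf a * (σ' + epsTilde εp εa εo * α *
      (∫ s, normSq m.covHf (b s) ∂ρ + ∫ s, normSq m.covHf (w s) ∂ρ)) =
      ∫ s, normSq m.covHf a * (σ' + epsTilde εp εa εo * α *
      (normSq m.covHf (b s) + normSq m.covHf (w s))) ∂ρ := by
    rw [integral_const_mul, integral_add (integrable_const _) (hbw.const_mul _),
      integral_const_mul, integral_add hb hw]
    simp
  rw [e1, ofReal_integral_eq_lintegral_ofReal iR (ae_of_all _ fun s => by
    have h1 := hcov.normSq_covHf_nonneg (b s)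
    have h2 := hcov.normSq_covHf_nonneg (w s)
    positivity)]
  refine lintegral_mono fun s => (lintegral_quantNoise_le_normSq hcov h4 hwell hn hunb hp0 ha0 ho0
    hQp hQa hQo (v s) (b s + w s) (hvbw s)).trans (ENNReal.ofReal_le_ofReal ?_)
  refine mul_le_mul_of_nonneg_left ?_ hA
  have h1 := hcov.normSq_covHf_nonneg (b s)
  have h2 := hcov.normSq_covHf_nonneg (w s)
  have h3 := hcov.normSq_covHf_nonneg vstar
  have h5 : normSq m.covHf (b s + w s) ≤ 2 * (normSq m.covHf (b s) + normSq m.covHf (w s)) := by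
    have h6 := hcov.normSq_covHf_nonneg (b s - w s)
    have h7 : normSq m.covHf (b s + w s) + normSq m.covHf (b s - w s) =
        2 * (normSq m.covHf (b s) + normSq m.covHf (w s)) := by
      simp only [normSq, Matrix.mulVec_add, Matrix.mulVec_sub, dotProduct_add, add_dotProduct,
        dotProduct_sub, sub_dotProduct]
      ring
    linarith
  set K := (εp + (1 + εp) * εa) with hK
  have hK0 : 0 ≤ K := by positivity
  have h8 := mul_le_mul_of_nonneg_left h5
    (show 0 ≤ (2 * εo + 2 * (1 + εo) * K) * α by positivity)
  -- `h9` and `h10` pay for replacing 1 + ε_o by the larger 2ε_o + 1 that appears in σ_M² and ε̃.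
  have h9 : 0 ≤ εo * K * α * normSq m.covHf vstar := by positivity
  have h10 : 0 ≤ εo * K * α * (normSq m.covHf (b s) + normSq m.covHf (w s)) := by positivity
  have h11 : epsTilde εp εa εo = 4 * εo + 4 * (2 * εo + 1) * K := by rw [epsTilde, hK]; ring
  have h12 : (2 * εo + 1) * (2 * εp + 2 * (1 + εp) * εa) = 2 * (2 * εo + 1) * K := by rw [hK]; ring
  rw [hσeq, h11, h12]
  linarith

end

end Model

/-! ### Deterministic recursions and the spectral bound -/

/-- A geometrically damped recursion: every input is summed with total weight at most
`(1 - q ^ n) / (1 - q)`. -/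
theorem sum_le_of_damped_recursion {q : ℝ} (hq0 : 0 ≤ q) (hq1 : q ≤ 1) (n : ℕ) (c : ℝ)
    (d f : ℕ → ℝ) (hf : ∀ t, 0 ≤ f t) (h0 : 0 < n → d 0 ≤ c + f 0)
    (hrec : ∀ t, t + 1 < n → d (t + 1) ≤ q * d t + f (t + 1)) :
    (1 - q) * ∑ t ∈ Finset.range n, d t ≤ (1 - q ^ n) * (c + ∑ t ∈ Finset.range n, f t) := by
  induction n generalizing c d f with
  | zero => simp
  | succ n ih =>
    have h0' := h0 n.succ_pos
    -- After removing d 0, the shifted sequence starts from q(c + f 0). In total c + f 0 gets weight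
    -- (1 - q) + q(1 - q^n) = 1 - q^(n+1).
    have h1 := ih (q * (c + f 0)) (fun t => d (t + 1)) (fun t => f (t + 1)) (fun t => hf _)
      (fun hn => (hrec 0 (by omega)).trans (by
        simpa using mul_le_mul_of_nonneg_left h0' hq0))
      (fun t ht => hrec (t + 1) (by omega))
    rw [Finset.sum_range_succ', Finset.sum_range_succ']
    have hs : 0 ≤ ∑ t ∈ Finset.range n, f (t + 1) := Finset.sum_nonneg fun t _ => hf _
    have h2 : q ^ (n + 1) ≤ q ^ n := pow_le_pow_of_le_one hq0 hq1 n.le_succ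
    have h3 := mul_le_mul_of_nonneg_right (sub_le_sub_left h2 1) hs
    have h4 := mul_le_mul_of_nonneg_left h0' (sub_nonneg.mpr hq1)
    rw [pow_succ] at h3 ⊢
    linarith

/-- Let S_n be the sum of the first n terms and d n = E[S_{n+1} f_n]. Expanding the square gives E
S_N² ≤ 2 Σ d n, and `hrec` says d (n+1) = q d n + E f_{n+1}², a damped recursion driven by the
second moments. Keeping 1 - q^N instead of 1 is what later makes the contribution of small
eigenvalues small. -/
theorem average_sq_le {Ω : Type*} [MeasurableSpace Ω] {μ : Measure Ω} {q : ℝ} (hq0 : 0 ≤ q)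
    (hq1 : q ≤ 1) (N : ℕ) {f : ℕ → Ω → ℝ} (hf : ∀ t, t < N → MemLp (f t) 2 μ)
    (hrec : ∀ n, n + 1 < N → ∫ ω, (∑ s ∈ Finset.range (n + 1), f s ω) * f (n + 1) ω ∂μ =
      q * ∫ ω, (∑ s ∈ Finset.range (n + 1), f s ω) * f n ω ∂μ) :
    (1 - q) * ∫ ω, (∑ t ∈ Finset.range N, f t ω) ^ 2 ∂μ ≤
      2 * ((1 - q ^ N) * ∑ t ∈ Finset.range N, ∫ ω, f t ω ^ 2 ∂μ) := by
  have hS : ∀ n, n ≤ N → MemLp (fun ω => ∑ s ∈ Finset.range n, f s ω) 2 μ := fun n hn =>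
    memLp_finsetSum _ fun s hs => hf s ((Finset.mem_range.mp hs).trans_le hn)
  set d : ℕ → ℝ := fun n => ∫ ω, (∑ s ∈ Finset.range (n + 1), f s ω) * f n ω ∂μ with hd
  have hnn : ∀ t, 0 ≤ ∫ ω, f t ω ^ 2 ∂μ := fun t => integral_nonneg fun _ => sq_nonneg _
  have hsplit : ∀ n, n < N → d n = ∫ ω, (∑ s ∈ Finset.range n, f s ω) * f n ω ∂μ +
      ∫ ω, f n ω ^ 2 ∂μ := by
    intro n hn
    have i1 : Integrable (fun ω => (∑ s ∈ Finset.range n, f s ω) * f n ω) μ :=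
      (hS n hn.le).integrable_mul (hf n hn)
    rw [hd, ← integral_add i1 (hf n hn).integrable_sq]
    refine integral_congr_ae (ae_of_all _ fun ω => ?_)
    simp only [Finset.sum_range_succ]; ring
  have hd0 : d 0 = ∫ ω, f 0 ω ^ 2 ∂μ := by simp [hd, sq]
  have key := sum_le_of_damped_recursion hq0 hq1 N 0 d
    (fun t => ∫ ω, f t ω ^ 2 ∂μ) hnn (fun _ => (hd0.trans (zero_add _).symm).le)
    (fun t ht => by rw [hsplit (t + 1) ht, hrec t ht])
  rw [zero_add] at key
  have hsq : ∀ n, n ≤ N → ∫ ω, (∑ t ∈ Finset.range n, f t ω) ^ 2 ∂μ ≤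
      2 * ∑ t ∈ Finset.range n, d t := by
    intro n
    induction n with
    | zero => intro _; simp
    | succ n ih =>
      intro hn
      have e := integral_add_mul_sq (hS n (Nat.le_of_succ_le hn)) (hf n hn) 1
      simp only [one_mul] at e
      rw [Finset.sum_range_succ d, hsplit n hn]
      simp only [Finset.sum_range_succ]
      rw [e]
      linarith [ih (Nat.le_of_succ_le hn), hnn n]
  calc _ ≤ (1 - q) * (2 * ∑ t ∈ Finset.range N, d t) :=
        mul_le_mul_of_nonneg_left (hsq N le_rfl) (by linarith)
    _ ≤ _ := by linarith

theorem one_sub_pow_le {q : ℝ} (hq0 : 0 ≤ q) (N : ℕ) : 1 - q ^ N ≤ N * (1 - q) := by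
  have := one_add_mul_le_pow (show (-2 : ℝ) ≤ q - 1 by linarith) N
  rw [add_sub_cancel] at this
  linarith

/-- The spectral bound on the averaged second moments of the coordinates of the iterates. -/
theorem spectral_bound {M : ℕ} {lam c : Fin M → ℝ} {γ a σ2 : ℝ} {N : ℕ} (hN : 0 < N) (hγ : 0 < γ)
    (ha : 0 ≤ a) (hσ : 0 ≤ σ2) (hlam : ∀ i, 0 ≤ lam i) (hγlam : ∀ i, γ * lam i ≤ 1)
    (htr : γ * (a * ∑ i, lam i) < 1) {d : Fin M → ℕ → ℝ} (hd : ∀ i t, 0 ≤ d i t)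
    (hd0 : ∀ i, d i 0 = c i ^ 2)
    (hrec : ∀ i t, t + 1 < N → d i (t + 1) ≤ (1 - γ * lam i) * d i t +
      γ ^ 2 * lam i * (σ2 + a * ∑ j, lam j * d j t))
    {k : ℕ} (hkM : k ≤ M) (hk : ∀ i : Fin M, (i : ℕ) < k → 0 < lam i) :
    ∑ i, (1 - (1 - γ * lam i) ^ N) * (∑ t ∈ Finset.range N, d i t) / (γ * N ^ 2) ≤
      (1 / (γ ^ 2 * (N : ℝ) ^ 2) * ∑ i : Fin M, (if (i : ℕ) < k then (lam i)⁻¹ * c i ^ 2 else 0) +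
        ∑ i : Fin M, (if (i : ℕ) < k then 0 else lam i * c i ^ 2)) +
      (σ2 + 2 * a * ((∑ i : Fin M, if (i : ℕ) < k then c i ^ 2 else 0) / (N * γ) +
        ∑ i : Fin M, (if (i : ℕ) < k then 0 else lam i * c i ^ 2))) / (1 - γ * (a * ∑ i, lam i)) *
      ((k : ℝ) / N + N * γ ^ 2 * ∑ i : Fin M, if (i : ℕ) < k then 0 else lam i ^ 2) := by
  have hN' : (0 : ℝ) < N := Nat.cast_pos.mpr hN
  set T : ℕ → ℝ := fun t => ∑ j, lam j * d j t with hT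
  have hT0 : ∀ t, 0 ≤ T t := fun t => Finset.sum_nonneg fun j _ => mul_nonneg (hlam j) (hd j t)
  set D : Fin M → ℝ := fun i => ∑ t ∈ Finset.range N, d i t with hD
  set K : ℝ := N * σ2 + a * ∑ t ∈ Finset.range N, T t with hK
  have hST : 0 ≤ ∑ t ∈ Finset.range N, T t := Finset.sum_nonneg fun t _ => hT0 t
  have hK0 : 0 ≤ K := by positivity
  set r : Fin M → ℝ := fun i => 1 - (1 - γ * lam i) ^ N with hr
  have hr0 : ∀ i, 0 ≤ r i := fun i => by
    have := pow_le_one₀ (n := N) (show 0 ≤ 1 - γ * lam i by linarith [hγlam i])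
      (by linarith [mul_nonneg hγ.le (hlam i)])
    simp only [hr]; linarith
  have hr1 : ∀ i, r i ≤ 1 := fun i => by
    have := pow_nonneg (show 0 ≤ 1 - γ * lam i by linarith [hγlam i]) N
    simp only [hr]; linarith
  have hrN : ∀ i, r i ≤ N * (γ * lam i) := fun i => by
    have := one_sub_pow_le (show 0 ≤ 1 - γ * lam i by linarith [hγlam i]) N
    simp only [hr]; linarith
  have hDi : ∀ i, γ * lam i * D i ≤ r i * (c i ^ 2 + γ ^ 2 * lam i * K) := by
    intro i
    have h1 := sum_le_of_damped_recursion (q := 1 - γ * lam i) (by linarith [hγlam i])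
      (by linarith [mul_nonneg hγ.le (hlam i)]) N (c i ^ 2) (d i)
      -- The initial value c_i² is carried by the constant, so the input at time 0 is zero; the
      -- input at time t comes from the state at t - 1.
      (fun t => if t = 0 then 0 else γ ^ 2 * lam i * (σ2 + a * T (t - 1)))
      (fun t => by
        split_ifs
        · exact le_rfl
        · have := hT0 (t - 1); have := hlam i; positivity)
      (fun _ => by simp [hd0])
      (fun t ht => by simpa using hrec i t ht)
    -- Only N - 1 inputs occur; K includes the missing nonnegative one as well.
    have h2 : ∑ t ∈ Finset.range N, (if t = 0 then 0 else γ ^ 2 * lam i * (σ2 + a * T (t - 1))) ≤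
        γ ^ 2 * lam i * K := by
      obtain ⟨n, rfl⟩ : ∃ n, N = n + 1 := ⟨N - 1, by omega⟩
      rw [Finset.sum_range_succ', hK, Finset.sum_range_succ]
      simp only [Nat.add_eq_zero_iff, one_ne_zero, and_false, if_false, Nat.add_sub_cancel, if_true,
        add_zero, ← Finset.mul_sum, Finset.sum_add_distrib, Finset.sum_const, Finset.card_range,
        nsmul_eq_mul]
      have := hT0 n; have := hlam i
      gcongr
      · linarith
      · linarith
    calc γ * lam i * D i = (1 - (1 - γ * lam i)) * ∑ t ∈ Finset.range N, d i t := by rw [hD]; ring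
      _ ≤ _ := h1
      _ ≤ _ := mul_le_mul_of_nonneg_left (by linarith) (hr0 i)
  set B1 := ∑ i : Fin M, (if (i : ℕ) < k then c i ^ 2 else 0) with hB1
  set B2 := ∑ i : Fin M, (if (i : ℕ) < k then 0 else lam i * c i ^ 2) with hB2
  set Λ := ∑ i, lam i with hΛ
  have hTD : ∑ t ∈ Finset.range N, T t = ∑ i, lam i * D i := by
    simp only [hT, hD, Finset.mul_sum]
    exact Finset.sum_comm
  -- Sum `hDi` over i, with r_i ≤ 1 on the head and on the K term, and r_i ≤ Nγλ_i on the tail of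
  -- the initial condition.
  have hTle : γ * ∑ t ∈ Finset.range N, T t ≤ B1 + N * γ * B2 + γ ^ 2 * Λ * K := by
    rw [hTD, Finset.mul_sum, hB1, hB2, hΛ, Finset.mul_sum, Finset.mul_sum, Finset.sum_mul,
      ← Finset.sum_add_distrib, ← Finset.sum_add_distrib]
    refine Finset.sum_le_sum fun i _ => ?_
    have h1 := hDi i
    have h2 : r i * (γ ^ 2 * lam i * K) ≤ γ ^ 2 * lam i * K :=
      mul_le_of_le_one_left (by have := hlam i; positivity) (hr1 i)
    split_ifs with hik
    · have h3 : r i * c i ^ 2 ≤ c i ^ 2 := mul_le_of_le_one_left (sq_nonneg _) (hr1 i)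
      linarith
    · have h3 : r i * c i ^ 2 ≤ N * (γ * lam i) * c i ^ 2 :=
        mul_le_mul_of_nonneg_right (hrN i) (sq_nonneg _)
      linarith
  have hden : 0 < 1 - γ * (a * Λ) := by linarith
  set S := B1 / (N * γ) + B2 with hS
  have hB1n : 0 ≤ B1 := Finset.sum_nonneg fun i _ => by split_ifs <;> positivity
  have hB2n : 0 ≤ B2 := Finset.sum_nonneg fun i _ => by
    have := hlam i
    split_ifs <;> positivity
  have hS0 : 0 ≤ S := by positivity
  have hSe : B1 + N * γ * B2 = N * γ * S := by rw [hS]; field_simp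
  set κ := (σ2 + 2 * a * S) / (1 - γ * (a * Λ)) with hκ
  -- K reappears in its own bound with coefficient γaΛ < 1 and can be solved for. This needs only aS
  -- where κ has 2aS.
  have hKle : K ≤ N * κ := by
    have h1 : K * (1 - γ * (a * Λ)) ≤ N * (σ2 + 2 * a * S) := by
      rw [hSe] at hTle
      have h2 : ∑ t ∈ Finset.range N, T t ≤ N * S + γ * Λ * K := by
        refine le_of_mul_le_mul_left ?_ hγ
        linarith
      have h3 := mul_le_mul_of_nonneg_left h2 ha
      have h4 : 0 ≤ N * (a * S) := by positivity
      have h5 : K = N * σ2 + a * ∑ t ∈ Finset.range N, T t := rfl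
      linarith
    rw [hκ, mul_div_assoc', le_div_iff₀ hden]
    exact h1
  have hcard : (k : ℝ) = ∑ i : Fin M, (if (i : ℕ) < k then (1 : ℝ) else 0) := by
    rw [Finset.sum_boole]
    norm_cast
    have : Finset.univ.filter (fun i : Fin M => (i : ℕ) < k) =
        (Finset.univ : Finset (Fin k)).map (Fin.castLEEmb hkM) := by
      ext i
      simp only [Finset.mem_filter, Finset.mem_univ, true_and, Finset.mem_map]
      constructor
      · intro h; exact ⟨⟨i, h⟩, rfl⟩
      · rintro ⟨j, rfl⟩; exact j.2
    rw [this]; simp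
  rw [hcard, Finset.sum_div, Finset.mul_sum, mul_add, Finset.mul_sum, Finset.mul_sum,
    Finset.mul_sum, ← Finset.sum_add_distrib, ← Finset.sum_add_distrib,
    ← Finset.sum_add_distrib]
  refine Finset.sum_le_sum fun i _ => ?_
  rw [div_le_iff₀ (by positivity)]
  change r i * D i ≤ _
  have hli := hlam i
  split_ifs with hik
  -- Head: r_i enters twice, once as the weight and once through `hDi`; both are bounded by 1.
  · have hpos := hk i hik
    have h1 := hDi i
    have h2 : r i * (r i * (c i ^ 2 + γ ^ 2 * lam i * K)) ≤ c i ^ 2 + γ ^ 2 * lam i * (N * κ) := by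
      have h3 : 0 ≤ c i ^ 2 + γ ^ 2 * lam i * K := by positivity
      calc _ ≤ r i * (c i ^ 2 + γ ^ 2 * lam i * K) := mul_le_of_le_one_left
            (mul_nonneg (hr0 i) h3) (hr1 i)
        _ ≤ c i ^ 2 + γ ^ 2 * lam i * K := mul_le_of_le_one_left h3 (hr1 i)
        _ ≤ _ := by gcongr
    have h4 := (mul_le_mul_of_nonneg_left h1 (hr0 i)).trans h2
    refine le_of_mul_le_mul_left ?_ (mul_pos hγ hpos)
    calc γ * lam i * (r i * D i) = r i * (γ * lam i * D i) := by ring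
      _ ≤ _ := h4
      _ = _ := by field_simp; ring
  -- Tail: both occurrences of r_i are bounded by Nγλ_i. For λ_i = 0 division is impossible, but the
  -- weight r_i vanishes.
  · rcases hli.eq_or_lt with h0 | hpos
    · have : r i = 0 := by simp [hr, ← h0]
      rw [this, ← h0]; simp
    have h1 := hDi i
    have h3 : 0 ≤ c i ^ 2 + γ ^ 2 * lam i * K := by positivity
    have h2 : r i * (r i * (c i ^ 2 + γ ^ 2 * lam i * K)) ≤ 
        (N * (γ * lam i)) ^ 2 * (c i ^ 2 + γ ^ 2 * lam i * (N * κ)) := by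
      rw [← mul_assoc, ← sq]
      gcongr
      · exact hr0 i
      · exact hrN i
    have h4 := (mul_le_mul_of_nonneg_left h1 (hr0 i)).trans h2
    refine le_of_mul_le_mul_left ?_ (mul_pos hγ hpos)
    calc γ * lam i * (r i * D i) = r i * (γ * lam i * D i) := by ring
      _ ≤ _ := h4
      _ = _ := by field_simp; ring

/-! ### Transfer to the sample space and independence of the past -/

section Transfer

variable {Ω 𝒴 : Type*} [MeasurableSpace Ω] [MeasurableSpace 𝒴] {μ : Measure Ω} {ν : Measure 𝒴}
  {g : Ω → 𝒴}

theorem integral_comp_of_measurePreserving (hg : MeasurePreserving g μ ν) {f : 𝒴 → ℝ}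
    (hf : Measurable f) : ∫ ω, f (g ω) ∂μ = ∫ y, f y ∂ν := by
  rw [← hg.map_eq, integral_map hg.aemeasurable hf.aestronglyMeasurable]

theorem memLp_comp_of_measurePreserving (hg : MeasurePreserving g μ ν) {f : 𝒴 → ℝ}
    (hf : Measurable f) : MemLp (fun ω => f (g ω)) 2 μ ↔ MemLp f 2 ν := by
  rw [← hg.map_eq, memLp_map_measure_iff hf.aestronglyMeasurable hg.aemeasurable]
  rfl

end Transfer

namespace Model

variable {p : ℕ∞} {M : ℕ} {m : Model p M}

theorem measurable_normSq (H : Matrix (Fin M) (Fin M) ℝ) : Measurable (normSq H) := by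
  unfold normSq
  exact Continuous.measurable (by fun_prop)

section

variable (hwell : m.WellPosed) (hcov : m.DataCovariance) {α β : ℝ}
  (h4 : m.FourthMomentCondition α β) {vstar : Fin M → ℝ}
  {σlo σhi : ℝ} (hn : m.NoiseCondition vstar σlo σhi) (γ κ : ℝ) {a : Fin M → ℝ}
  (hopt : ∀ v, m.riskq vstar ≤ m.riskq v) {lama : ℝ}
  (ha : ∀ c, a ⬝ᵥ (m.covHf *ᵥ c) = lama * (a ⬝ᵥ c)) (hnorm : normSq m.covHf a = lama)
  {Ω 𝒳 : Type*} [MeasurableSpace Ω] [MeasurableSpace 𝒳] {μ : Measure Ω} {ρ : Measure 𝒳}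
  [IsProbabilityMeasure ρ] {S : Ω → 𝒳} {ζ : Ω → m.Sample} (hS : MeasurePreserving S μ ρ)
  (hSζ : MeasurePreserving (fun ω => (S ω, ζ ω)) μ (ρ.prod m.law))
  {v X : 𝒳 → Fin M → ℝ} (hX : Measurable X) (hX2 : ∀ i, MemLp (fun ω => X (S ω) i) 2 μ)
include hwell hcov h4 hn hopt ha hnorm hS hSζ hX hX2

/-- Conditioning on the past is expressed by a product law: S records the past, ζ is the fresh
sample, and the one-step estimates on `ρ.prod m.law` are pulled back along (S, ζ). -/
theorem linStep_random (hzero : ∀ c : Fin M → ℝ, κ * ∫ ω, c ⬝ᵥ X (S ω) ∂μ = 0) :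
    MemLp (fun ω => linStep m vstar γ κ a (X (S ω)) (ζ ω)) 2 μ ∧
    ∫ ω, linStep m vstar γ κ a (X (S ω)) (ζ ω) ^ 2 ∂μ ≤
      (1 - 2 * γ * lama) * ∫ ω, (a ⬝ᵥ X (S ω)) ^ 2 ∂μ +
        γ ^ 2 * (α * lama * ∫ ω, normSq m.covHf (X (S ω)) ∂μ) + κ ^ 2 * (σhi ^ 2 * lama) ∧
    ∀ Y : 𝒳 → ℝ, Measurable Y → MemLp (fun ω => Y (S ω)) 2 μ →
      ∫ ω, Y (S ω) * linStep m vstar γ κ a (X (S ω)) (ζ ω) ∂μ =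
        (1 - γ * lama) * ∫ ω, Y (S ω) * (a ⬝ᵥ X (S ω)) ∂μ := by
  have hXi : ∀ i, Measurable fun s => X s i := fun i => (measurable_pi_apply i).comp hX
  have hX2' : ∀ i, MemLp (fun s => X s i) 2 ρ := fun i =>
    (memLp_comp_of_measurePreserving hS (hXi i)).mp (hX2 i)
  have hdot : ∀ c : Fin M → ℝ, Measurable fun s => c ⬝ᵥ X s := fun c =>
    measurable_dot measurable_const hX
  have hm := measurable_linStep (m := m) hX vstar a γ κ
  have e2 := integral_comp_of_measurePreserving hS ((hdot a).pow_const 2)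
  have e3 := integral_comp_of_measurePreserving hS ((measurable_normSq m.covHf).comp hX)
  have e4 := integral_comp_of_measurePreserving hSζ (hm.pow_const 2)
  simp only [Function.comp_apply] at e2 e3 e4
  obtain ⟨h1, h2⟩ := linStep_prod hwell hcov h4 hn γ κ hopt ha hX hX2' hnorm (fun c => by
    rw [← integral_comp_of_measurePreserving hS (hdot c)]; exact hzero c)
  refine ⟨(memLp_comp_of_measurePreserving hSζ hm).mpr h1, ?_, fun Y hY hY2 => ?_⟩
  · rw [e2, e3, e4]; exact h2
  · have e5 := integral_comp_of_measurePreserving hS (hY.mul (hdot a))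
    have e6 := integral_comp_of_measurePreserving hSζ ((hY.comp measurable_fst).mul hm)
    simp only [Function.comp_apply, Pi.mul_apply] at e5 e6
    rw [e5, e6]
    exact integral_mul_linStep hwell hcov h4 hn γ κ hopt ha
      ((memLp_comp_of_measurePreserving hS hY).mp hY2) h1

theorem quantStep_random (hunb : m.UnbiasedQuantization) (hv : Measurable v)
    (hzero : ∀ c : Fin M → ℝ, ∫ ω, c ⬝ᵥ X (S ω) ∂μ = 0) {n : ℝ} (hn0 : 0 ≤ n)
    (hnoise : ∫⁻ ω, ENNReal.ofReal ((m.feature (ζ ω) ⬝ᵥ a) ^ 2) * m.quantNoise (ζ ω) (v (S ω)) ∂μ ≤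
      ENNReal.ofReal n) :
    MemLp (fun ω => quantStep m vstar γ a (v (S ω)) (X (S ω)) (ζ ω)) 2 μ ∧
    ∫ ω, quantStep m vstar γ a (v (S ω)) (X (S ω)) (ζ ω) ^ 2 ∂μ ≤
      (1 - 2 * γ * lama) * ∫ ω, (a ⬝ᵥ X (S ω)) ^ 2 ∂μ +
        γ ^ 2 * (α * lama * ∫ ω, normSq m.covHf (X (S ω)) ∂μ) + γ ^ 2 * (σhi ^ 2 * lama) +
        γ ^ 2 * n ∧
    ∀ Y : 𝒳 → ℝ, Measurable Y → MemLp (fun ω => Y (S ω)) 2 μ →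
      ∫ ω, Y (S ω) * quantStep m vstar γ a (v (S ω)) (X (S ω)) (ζ ω) ∂μ =
        (1 - γ * lama) * ∫ ω, Y (S ω) * (a ⬝ᵥ X (S ω)) ∂μ := by
  obtain ⟨h1, h2, h3⟩ := linStep_random hwell hcov h4 hn γ γ hopt ha hnorm hS hSζ hX hX2
    (fun c => by rw [hzero, mul_zero])
  have hx : Measurable fun s : 𝒳 × m.Sample => m.feature s.2 := by fun_prop
  have hv' : Measurable fun s : 𝒳 × m.Sample => v s.1 := by fun_prop
  have hml := measurable_linStep (m := m) hX vstar a γ γ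
  have hmq := measurable_quantStep (m := m) vstar γ a hv hX
  have h1' := (memLp_comp_of_measurePreserving hSζ hml).mp h1
  have hmn : Measurable fun s : 𝒳 × m.Sample =>
      ENNReal.ofReal ((m.feature s.2 ⬝ᵥ a) ^ 2) * m.quantNoise s.2 (v s.1) :=
    ((measurable_dot hx measurable_const).pow_const 2).ennreal_ofReal.mul
      (m.measurable_quantNoise (f := fun s : 𝒳 × m.Sample => s.2) measurable_snd hv')
  have hnoise' := (hSζ.lintegral_comp hmn).symm.trans_le hnoise
  have eq := integral_comp_of_measurePreserving hSζ (hmq.pow_const 2)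
  have el := integral_comp_of_measurePreserving hSζ (hml.pow_const 2)
  simp only at eq el
  refine ⟨(memLp_comp_of_measurePreserving hSζ hmq).mpr
    (memLp_quantStep hunb hv hX h1' hnoise'), ?_, fun Y hY hY2 => ?_⟩
  · have := integral_quantStep_sq_le hunb hv hX h1' hn0 hnoise'
    rw [eq]
    rw [← el] at this
    linarith
  · rw [← h3 Y hY hY2]
    have e5 := integral_comp_of_measurePreserving hSζ ((hY.comp measurable_fst).mul hmq)
    have e6 := integral_comp_of_measurePreserving hSζ ((hY.comp measurable_fst).mul hml)
    simp only [Function.comp_apply, Pi.mul_apply] at e5 e6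
    rw [e5, e6]
    exact integral_mul_quantStep hunb hv hX h1' hnoise' hY
      ((memLp_comp_of_measurePreserving hS hY).mp hY2)

end

/-- The noiseless part of the deviation of the iterates from `v*`. -/
noncomputable def biasIterate (m : Model p M) (γ : ℝ) (vstar : Fin M → ℝ) (Z : ℕ → m.Sample) :
    ℕ → Fin M → ℝ
  | 0 => -vstar
  | t + 1 => biasIterate m γ vstar Z t +
      (-γ * (m.feature (Z t) ⬝ᵥ biasIterate m γ vstar Z t)) • m.feature (Z t)

/-- The part of the deviation of the iterates from `v*` that is caused by the label noise and the
quantization noise. -/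
noncomputable def noiseIterate (m : Model p M) (γ : ℝ) (vstar : Fin M → ℝ) (Z : ℕ → m.Sample)
    (t : ℕ) : Fin M → ℝ :=
  m.iterate γ Z t - vstar - biasIterate m γ vstar Z t

theorem dot_biasIterate_succ (γ : ℝ) (vstar a : Fin M → ℝ) (Z : ℕ → m.Sample) (t : ℕ) :
    a ⬝ᵥ biasIterate m γ vstar Z (t + 1) =
      linStep m vstar γ 0 a (biasIterate m γ vstar Z t) (Z t) := by
  simp only [biasIterate, linStep, dotProduct_add, dotProduct_smul, smul_eq_mul,
    dotProduct_comm a (m.feature _)]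
  ring

theorem dot_noiseIterate_succ (γ : ℝ) (vstar a : Fin M → ℝ) (Z : ℕ → m.Sample) (t : ℕ) :
    a ⬝ᵥ noiseIterate m γ vstar Z (t + 1) =
      quantStep m vstar γ a (m.iterate γ Z t) (noiseIterate m γ vstar Z t) (Z t) := by
  simp only [noiseIterate, iterate, biasIterate, quantStep, dotProduct_add, dotProduct_sub,
    dotProduct_smul, smul_eq_mul, dotProduct_comm a (m.feature _)]
  ring

theorem noiseIterate_zero (γ : ℝ) (vstar : Fin M → ℝ) (Z : ℕ → m.Sample) :
    noiseIterate m γ vstar Z 0 = 0 := by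
  simp [noiseIterate, iterate, biasIterate]

section

variable {𝒳 : Type*} [MeasurableSpace 𝒳] {Z : ℕ → 𝒳 → m.Sample} {t : ℕ}
  (hZ : ∀ s < t, Measurable (Z s)) (γ : ℝ) (vstar : Fin M → ℝ)
include hZ

/-- Only the samples before t are required to be measurable, so the lemma also applies with the
σ-algebra `past Z t` on Ω. -/
theorem measurable_iterate : Measurable fun ω => m.iterate γ (fun s => Z s ω) t := by
  induction t with
  | zero => exact measurable_const
  | succ t ih =>
    have h1 := ih fun s hs => hZ s (hs.trans t.lt_succ_self)
    have h2 := hZ t t.lt_succ_self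
    exact h1.add (((m.measurable_quantOutGrad h2 h1).const_mul γ).smul
      (m.measurable_feature.comp h2))

theorem measurable_biasIterate :
    Measurable fun ω => biasIterate m γ vstar (fun s => Z s ω) t := by
  induction t with
  | zero => exact measurable_const
  | succ t ih =>
    have h1 := ih fun s hs => hZ s (hs.trans t.lt_succ_self)
    have h2 := m.measurable_feature.comp (hZ t t.lt_succ_self)
    exact h1.add (((measurable_dot h2 h1).const_mul (-γ)).smul h2)

theorem measurable_noiseIterate :
    Measurable fun ω => noiseIterate m γ vstar (fun s => Z s ω) t :=
  ((measurable_iterate hZ γ).sub measurable_const).sub (measurable_biasIterate hZ γ vstar)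

end

/-- The `σ`-algebra generated by the samples before time `t`. -/
@[reducible]
def past {Ω : Type*} (Z : ℕ → Ω → m.Sample) (t : ℕ) : MeasurableSpace Ω :=
  ⨆ i ∈ Set.Iio t, MeasurableSpace.comap (Z i) inferInstance

theorem measurable_past {Ω : Type*} (Z : ℕ → Ω → m.Sample) {s t : ℕ} (h : s < t) :
    Measurable[past Z t] (Z s) := by
  rw [measurable_iff_comap_le]
  exact le_iSup₂_of_le s (Set.mem_Iio.mpr h) le_rfl

section

variable {Ω : Type*} [MeasurableSpace Ω] {μ : Measure Ω} [IsProbabilityMeasure μ]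
  {Z : ℕ → Ω → m.Sample} (hZ : m.IsSampling μ Z)
include hZ

omit [IsProbabilityMeasure μ] in
theorem past_le (t : ℕ) : past Z t ≤ ‹MeasurableSpace Ω› :=
  iSup₂_le fun i _ => measurable_iff_comap_le.mp (hZ.measurable i)

/-- The current sample is independent of the σ-algebra of the earlier ones, so any past-measurable
state and `Z t` have a product joint law. -/
theorem measurePreserving_state {𝒳 : Type*} [MeasurableSpace 𝒳] {S : Ω → 𝒳} {t : ℕ}
    (hS : Measurable[past Z t] S) :
    MeasurePreserving S μ (μ.map S) ∧
      MeasurePreserving (fun ω => (S ω, Z t ω)) μ ((μ.map S).prod m.law) := by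
  have hSm : Measurable S := hS.mono (past_le hZ t) le_rfl
  refine ⟨⟨hSm, rfl⟩, ⟨hSm.prodMk (hZ.measurable t), ?_⟩⟩
  have hind : Indep (past Z t) (⨆ i ∈ ({t} : Set ℕ), MeasurableSpace.comap (Z i) inferInstance) μ :=
    indep_iSup_of_disjoint (fun i => measurable_iff_comap_le.mp (hZ.measurable i)) hZ.indep
      (by simp)
  have hind' : IndepFun S (Z t) μ := by
    rw [IndepFun_iff_Indep]
    refine indep_of_indep_of_le_left (indep_of_indep_of_le_right hind ?_) ?_
    · simp
    · exact measurable_iff_comap_le.mp hS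
  rw [(indepFun_iff_map_prod_eq_prod_map_map hSm.aemeasurable (hZ.measurable t).aemeasurable).mp
    hind', hZ.law_eq]

end

end Model

theorem IsEigendecomposition.memLp {M : ℕ} {H : Matrix (Fin M) (Fin M) ℝ} {lam : Fin M → ℝ}
    {u : Fin M → Fin M → ℝ} (h : IsEigendecomposition H lam u) {Ω : Type*} [MeasurableSpace Ω]
    {μ : Measure Ω} {X : Ω → Fin M → ℝ} (hX : ∀ i, MemLp (fun ω => u i ⬝ᵥ X ω) 2 μ) (k : Fin M) :
    MemLp (fun ω => X ω k) 2 μ := by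
  have h1 : ∀ ω, X ω k = ∑ j, (u j ⬝ᵥ X ω) * u j k := fun ω => by
    conv_lhs => rw [← h.sum_dot_smul (X ω)]
    simp
  simp only [h1]
  exact memLp_finsetSum _ fun j _ => (hX j).mul_const _

theorem IsEigendecomposition.trace_transpose_mul {M : ℕ} {H : Matrix (Fin M) (Fin M) ℝ}
    {lam : Fin M → ℝ} {u : Fin M → Fin M → ℝ} (h : IsEigendecomposition H lam u)
    (A : Matrix (Fin M) (Fin M) ℝ) : (Hᵀ * A).trace = ∑ i, lam i * normSq A (u i) := by
  conv_lhs => rw [h.decomp]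
  rw [Matrix.transpose_sum, Finset.sum_mul, Matrix.trace_sum]
  refine Finset.sum_congr rfl fun i _ => ?_
  rw [Matrix.transpose_smul, Matrix.smul_mul, Matrix.trace_smul, smul_eq_mul, outer,
    Matrix.transpose_vecMulVec, Matrix.trace_mul_comm, ← outer, trace_mul_outer]

theorem memLp_dot' {M : ℕ} {Ω : Type*} [MeasurableSpace Ω] {μ : Measure Ω} {q : ℝ≥0∞}
    {f : Ω → Fin M → ℝ} (hf : ∀ i, MemLp (fun ω => f ω i) q μ) (a : Fin M → ℝ) :
    MemLp (fun ω => a ⬝ᵥ f ω) q μ := by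
  simpa only [dotProduct_comm a] using memLp_dot hf a

/-! ### Moment recursions along the iterates -/

namespace Model

variable {p : ℕ∞} {M : ℕ} {m : Model p M}

section

variable (hwell : m.WellPosed) (hunb : m.UnbiasedQuantization) (hcov : m.DataCovariance)
  {α β : ℝ} (h4 : m.FourthMomentCondition α β) {vstar : Fin M → ℝ}
  (hopt : ∀ v, m.riskq vstar ≤ m.riskq v) {σlo σhi : ℝ} (hn : m.NoiseCondition vstar σlo σhi)
  {lam : Fin M → ℝ} {u : Fin M → Fin M → ℝ} (he : IsEigendecomposition m.covHf lam u)
  {Ω : Type*} [MeasurableSpace Ω] {μ : Measure Ω} [IsProbabilityMeasure μ]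
  {Z : ℕ → Ω → m.Sample} (hZ : m.IsSampling μ Z) (γ : ℝ)
include hwell hcov h4 hopt hn he hZ

theorem biasIterate_step (t : ℕ)
    (hB : ∀ i, MemLp (fun ω => biasIterate m γ vstar (fun s => Z s ω) t i) 2 μ) (i : Fin M) :
    MemLp (fun ω => u i ⬝ᵥ biasIterate m γ vstar (fun s => Z s ω) (t + 1)) 2 μ ∧
    ∫ ω, (u i ⬝ᵥ biasIterate m γ vstar (fun s => Z s ω) (t + 1)) ^ 2 ∂μ ≤
      (1 - 2 * γ * lam i) * ∫ ω, (u i ⬝ᵥ biasIterate m γ vstar (fun s => Z s ω) t) ^ 2 ∂μ +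
        γ ^ 2 * (α * lam i *
          ∫ ω, normSq m.covHf (biasIterate m γ vstar (fun s => Z s ω) t) ∂μ) ∧
    ∀ Y : Ω → ℝ, Measurable[past Z t] Y → MemLp Y 2 μ →
      ∫ ω, Y ω * (u i ⬝ᵥ biasIterate m γ vstar (fun s => Z s ω) (t + 1)) ∂μ =
        (1 - γ * lam i) * ∫ ω, Y ω * (u i ⬝ᵥ biasIterate m γ vstar (fun s => Z s ω) t) ∂μ := by
  have hb : Measurable[past Z t] fun ω => biasIterate m γ vstar (fun s => Z s ω) t :=
    @measurable_biasIterate p M m Ω (past Z t) Z t (fun s hs => measurable_past Z hs) γ vstar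
  simp only [dot_biasIterate_succ]
  -- The test variable Y is made a coordinate of the state, so that correlations with an arbitrary
  -- past-measurable variable are covered.
  have hS := fun (Y : Ω → ℝ) (hY : Measurable[past Z t] Y) =>
    measurePreserving_state hZ (@Measurable.prodMk _ (past Z t) _ _ _ _ _ _ hb hY)
  have main := fun (Y : Ω → ℝ) (hY : Measurable[past Z t] Y) =>
    haveI := Measure.isProbabilityMeasure_map (μ := μ) (hS Y hY).1.aemeasurable
    linStep_random hwell hcov h4 hn γ 0 hopt (he.dot_mulVec i) (he.normSq_vec i) (hS Y hY).1
      (hS Y hY).2 (X := Prod.fst) measurable_fst hB (fun c => zero_mul _)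
  have h0 := main 0 (@measurable_const _ _ _ (past Z t) _)
  refine ⟨h0.1, ?_, fun Y hY hY2 => (main Y hY).2.2 Prod.snd measurable_snd hY2⟩
  have h2 := h0.2.1
  simpa using h2

include hunb in
theorem noiseIterate_step (t : ℕ)
    (hW : ∀ i, MemLp (fun ω => noiseIterate m γ vstar (fun s => Z s ω) t i) 2 μ)
    (hzero : ∀ c : Fin M → ℝ, ∫ ω, c ⬝ᵥ noiseIterate m γ vstar (fun s => Z s ω) t ∂μ = 0)
    (i : Fin M) {n : ℝ} (hn0 : 0 ≤ n)
    (hnoise : ∫⁻ ω, ENNReal.ofReal ((m.feature (Z t ω) ⬝ᵥ u i) ^ 2) *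
      m.quantNoise (Z t ω) (m.randIterate Z γ t ω) ∂μ ≤ ENNReal.ofReal n) :
    MemLp (fun ω => u i ⬝ᵥ noiseIterate m γ vstar (fun s => Z s ω) (t + 1)) 2 μ ∧
    ∫ ω, (u i ⬝ᵥ noiseIterate m γ vstar (fun s => Z s ω) (t + 1)) ^ 2 ∂μ ≤
      (1 - 2 * γ * lam i) * ∫ ω, (u i ⬝ᵥ noiseIterate m γ vstar (fun s => Z s ω) t) ^ 2 ∂μ +
        γ ^ 2 * (α * lam i *
          ∫ ω, normSq m.covHf (noiseIterate m γ vstar (fun s => Z s ω) t) ∂μ) +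
        γ ^ 2 * (σhi ^ 2 * lam i) + γ ^ 2 * n ∧
    ∀ Y : Ω → ℝ, Measurable[past Z t] Y → MemLp Y 2 μ →
      ∫ ω, Y ω * (u i ⬝ᵥ noiseIterate m γ vstar (fun s => Z s ω) (t + 1)) ∂μ =
        (1 - γ * lam i) * ∫ ω, Y ω * (u i ⬝ᵥ noiseIterate m γ vstar (fun s => Z s ω) t) ∂μ := by
  have hw : Measurable[past Z t] fun ω => noiseIterate m γ vstar (fun s => Z s ω) t :=
    @measurable_noiseIterate p M m Ω (past Z t) Z t (fun s hs => measurable_past Z hs) γ vstar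
  have hv : Measurable[past Z t] fun ω => m.randIterate Z γ t ω :=
    @measurable_iterate p M m Ω (past Z t) Z t (fun s hs => measurable_past Z hs) γ
  simp only [dot_noiseIterate_succ]
  have hS := fun (Y : Ω → ℝ) (hY : Measurable[past Z t] Y) =>
    measurePreserving_state hZ (@Measurable.prodMk _ (past Z t) _ _ _ _ _ _ hv
      (@Measurable.prodMk _ (past Z t) _ _ _ _ _ _ hw hY))
  have main := fun (Y : Ω → ℝ) (hY : Measurable[past Z t] Y) =>
    haveI := Measure.isProbabilityMeasure_map (μ := μ) (hS Y hY).1.aemeasurable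
    quantStep_random hwell hcov h4 hn γ hopt (he.dot_mulVec i) (he.normSq_vec i) (hS Y hY).1
      (hS Y hY).2 (X := fun s => s.2.1) (v := fun s => s.1) (measurable_fst.comp measurable_snd)
      hW hunb measurable_fst hzero hn0 hnoise
  have h0 := main 0 (@measurable_const _ _ _ (past Z t) _)
  exact ⟨h0.1, h0.2.1, fun Y hY hY2 => (main Y hY).2.2 (fun s => s.2.2)
    (measurable_snd.comp measurable_snd) hY2⟩

variable {N : ℕ} {a σ2 : ℝ} (hασ : α ≤ a) (hσ : σhi ^ 2 ≤ σ2)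
  (hnoise : ∀ t, t + 1 < N →
    (∀ i, MemLp (fun ω => biasIterate m γ vstar (fun s => Z s ω) t i) 2 μ) →
    (∀ i, MemLp (fun ω => noiseIterate m γ vstar (fun s => Z s ω) t i) 2 μ) → ∀ i,
    ∫⁻ ω, ENNReal.ofReal ((m.feature (Z t ω) ⬝ᵥ u i) ^ 2) *
      m.quantNoise (Z t ω) (m.randIterate Z γ t ω) ∂μ ≤
    ENNReal.ofReal (lam i * (σ2 - σhi ^ 2 + (a - α) *
      (∫ ω, normSq m.covHf (biasIterate m γ vstar (fun s => Z s ω) t) ∂μ +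
        ∫ ω, normSq m.covHf (noiseIterate m γ vstar (fun s => Z s ω) t) ∂μ))))
include hασ hσ

omit hwell h4 hopt hn hZ [IsProbabilityMeasure μ] in
theorem noiseLevel_nonneg (t : ℕ) (i : Fin M) : 0 ≤ lam i * (σ2 - σhi ^ 2 + (a - α) *
      (∫ ω, normSq m.covHf (biasIterate m γ vstar (fun s => Z s ω) t) ∂μ +
        ∫ ω, normSq m.covHf (noiseIterate m γ vstar (fun s => Z s ω) t) ∂μ)) := by
  refine mul_nonneg (he.normSq_vec i ▸ hcov.normSq_covHf_nonneg _) (add_nonneg (sub_nonneg.mpr hσ)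
    (mul_nonneg (sub_nonneg.mpr hασ) (add_nonneg ?_ ?_))) <;>
  exact integral_nonneg fun ω => hcov.normSq_covHf_nonneg _

include hunb hnoise

/-- Square integrability and centring must be propagated together: centring of W_t removes the
linear cross term, and L² at time t makes the noise bound `hnoise` available for the next step. Time
N is excluded because the average stops at v_{N-1}. -/
theorem iterates_memLp (t : ℕ) (ht : t < N) :
    (∀ i, MemLp (fun ω => biasIterate m γ vstar (fun s => Z s ω) t i) 2 μ) ∧
    (∀ i, MemLp (fun ω => noiseIterate m γ vstar (fun s => Z s ω) t i) 2 μ) ∧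
    ∀ c : Fin M → ℝ, ∫ ω, c ⬝ᵥ noiseIterate m γ vstar (fun s => Z s ω) t ∂μ = 0 := by
  induction t with
  | zero =>
    refine ⟨fun i => memLp_const _, fun i => ?_, fun c => ?_⟩
    · simp only [noiseIterate_zero]; exact memLp_const _
    · simp [noiseIterate_zero]
  | succ t ih =>
    obtain ⟨hB, hW, h0⟩ := ih (Nat.lt_of_succ_lt ht)
    have h1 := biasIterate_step hwell hcov h4 hopt hn he hZ γ t hB
    have h2 := fun i => noiseIterate_step hwell hunb hcov h4 hopt hn he hZ γ t hW h0 i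
      (noiseLevel_nonneg hcov he γ hασ hσ t i) (hnoise t ht hB hW i)
    have hW' := he.memLp fun i => (h2 i).1
    refine ⟨he.memLp fun i => (h1 i).1, hW', fun c => ?_⟩
    have h3 : ∀ i, ∫ ω, u i ⬝ᵥ noiseIterate m γ vstar (fun s => Z s ω) (t + 1) ∂μ = 0 := by
      intro i
      have := (h2 i).2.2 (fun _ => 1) (@measurable_const _ _ _ (past Z t) _) (memLp_const 1)
      simpa only [one_mul, h0, mul_zero] using this
    have h4 : ∀ ω, c ⬝ᵥ noiseIterate m γ vstar (fun s => Z s ω) (t + 1) =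
        ∑ j, (u j ⬝ᵥ noiseIterate m γ vstar (fun s => Z s ω) (t + 1)) * (c ⬝ᵥ u j) := fun ω => by
      conv_lhs => rw [← he.sum_dot_smul (noiseIterate m γ vstar (fun s => Z s ω) (t + 1))]
      simp only [dotProduct_sum, dotProduct_smul, smul_eq_mul]
    simp only [h4]
    rw [integral_finsetSum _ fun j _ => ((h2 j).1.integrable one_le_two).mul_const _]
    simp only [integral_mul_const, h3, zero_mul, Finset.sum_const_zero]

/-- The bias and noise bounds are added, with 1 - 2γλ_i relaxed to 1 - γλ_i. The state-dependent
noise (a - α) joins the α of the fourth-moment bound to give a. -/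
theorem secondMoment_rec (hγ : 0 < γ) (i : Fin M) (t : ℕ) (ht : t + 1 < N) :
    ∫ ω, (u i ⬝ᵥ biasIterate m γ vstar (fun s => Z s ω) (t + 1)) ^ 2 ∂μ +
      ∫ ω, (u i ⬝ᵥ noiseIterate m γ vstar (fun s => Z s ω) (t + 1)) ^ 2 ∂μ ≤
    (1 - γ * lam i) * (∫ ω, (u i ⬝ᵥ biasIterate m γ vstar (fun s => Z s ω) t) ^ 2 ∂μ +
      ∫ ω, (u i ⬝ᵥ noiseIterate m γ vstar (fun s => Z s ω) t) ^ 2 ∂μ) +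
    γ ^ 2 * lam i * (σ2 + a * ∑ j, lam j *
      (∫ ω, (u j ⬝ᵥ biasIterate m γ vstar (fun s => Z s ω) t) ^ 2 ∂μ +
        ∫ ω, (u j ⬝ᵥ noiseIterate m γ vstar (fun s => Z s ω) t) ^ 2 ∂μ)) := by
  obtain ⟨hB, hW, h0⟩ := iterates_memLp hwell hunb hcov h4 hopt hn he hZ γ hασ hσ hnoise t
    (Nat.lt_of_succ_lt ht)
  have h1 := (biasIterate_step hwell hcov h4 hopt hn he hZ γ t hB i).2.1
  have h2 := (noiseIterate_step hwell hunb hcov h4 hopt hn he hZ γ t hW h0 i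
      (noiseLevel_nonneg hcov he γ hασ hσ t i) (hnoise t ht hB hW i)).2.1
  have hT : ∀ X : Ω → Fin M → ℝ, (∀ i, MemLp (fun ω => X ω i) 2 μ) →
      ∫ ω, normSq m.covHf (X ω) ∂μ = ∑ j, lam j * ∫ ω, (u j ⬝ᵥ X ω) ^ 2 ∂μ := by
    intro X hX
    simp only [he.normSq_eq]
    rw [integral_finsetSum _ fun j _ => ((memLp_dot' hX (u j)).integrable_sq).const_mul _]
    simp only [integral_const_mul]
  rw [hT _ hB] at h1 h2
  rw [hT _ hW] at h2
  have hl : 0 ≤ lam i := he.normSq_vec i ▸ hcov.normSq_covHf_nonneg _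
  have n1 : 0 ≤ ∫ ω, (u i ⬝ᵥ biasIterate m γ vstar (fun s => Z s ω) t) ^ 2 ∂μ :=
    integral_nonneg fun _ => sq_nonneg _
  have n2 : 0 ≤ ∫ ω, (u i ⬝ᵥ noiseIterate m γ vstar (fun s => Z s ω) t) ^ 2 ∂μ :=
    integral_nonneg fun _ => sq_nonneg _
  have n3 := mul_nonneg (mul_nonneg hγ.le hl) n1
  have n4 := mul_nonneg (mul_nonneg hγ.le hl) n2
  simp only [mul_add, Finset.sum_add_distrib] at h1 h2 ⊢
  linarith

theorem average_sq_le_biasIterate (hγ : 0 < γ) (i : Fin M) (hγl : γ * lam i ≤ 1) :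
    γ * lam i * ∫ ω, (∑ t ∈ Finset.range N,
      u i ⬝ᵥ biasIterate m γ vstar (fun s => Z s ω) t) ^ 2 ∂μ ≤
    2 * ((1 - (1 - γ * lam i) ^ N) * ∑ t ∈ Finset.range N,
      ∫ ω, (u i ⬝ᵥ biasIterate m γ vstar (fun s => Z s ω) t) ^ 2 ∂μ) := by
  have hinv := iterates_memLp hwell hunb hcov h4 hopt hn he hZ γ hασ hσ hnoise
  have hl : 0 ≤ lam i := he.normSq_vec i ▸ hcov.normSq_covHf_nonneg _
  have h := average_sq_le (μ := μ) (q := 1 - γ * lam i) (by linarith)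
    (by linarith [mul_nonneg hγ.le hl]) N
    (f := fun t ω => u i ⬝ᵥ biasIterate m γ vstar (fun s => Z s ω) t)
    (fun t ht => memLp_dot' (hinv t ht).1 (u i)) (fun n hn' => by
      refine (biasIterate_step hwell hcov h4 hopt hn he hZ γ n
        (hinv n (Nat.lt_of_succ_lt hn')).1 i).2.2 _ ?_ ?_
      · refine @Finset.measurable_sum _ _ _ _ _ _ (past Z n) _ _ fun s hs => ?_
        refine @measurable_dot _ Ω (past Z n) _ _ (@measurable_const _ _ _ (past Z n) _) ?_
        -- The sum up to and including time n is still past-measurable, since the iterate at time n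
        -- uses only samples before n.
        exact @measurable_biasIterate p M m Ω (past Z n) Z s (fun r hr => measurable_past Z
          (hr.trans_le (Nat.lt_succ_iff.mp (Finset.mem_range.mp hs)))) γ vstar
      · exact memLp_finsetSum _ fun s hs => memLp_dot' (hinv s
          ((Finset.mem_range.mp hs).trans_le (Nat.le_of_succ_le hn'))).1 (u i))
  simpa only [sub_sub_cancel] using h

theorem average_sq_le_noiseIterate (hγ : 0 < γ) (i : Fin M) (hγl : γ * lam i ≤ 1) :
    γ * lam i * ∫ ω, (∑ t ∈ Finset.range N,
      u i ⬝ᵥ noiseIterate m γ vstar (fun s => Z s ω) t) ^ 2 ∂μ ≤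
    2 * ((1 - (1 - γ * lam i) ^ N) * ∑ t ∈ Finset.range N,
      ∫ ω, (u i ⬝ᵥ noiseIterate m γ vstar (fun s => Z s ω) t) ^ 2 ∂μ) := by
  have hinv := iterates_memLp hwell hunb hcov h4 hopt hn he hZ γ hασ hσ hnoise
  have hl : 0 ≤ lam i := he.normSq_vec i ▸ hcov.normSq_covHf_nonneg _
  have h := average_sq_le (μ := μ) (q := 1 - γ * lam i) (by linarith)
    (by linarith [mul_nonneg hγ.le hl]) N
    (f := fun t ω => u i ⬝ᵥ noiseIterate m γ vstar (fun s => Z s ω) t)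
    (fun t ht => memLp_dot' (hinv t ht).2.1 (u i)) (fun n hn' => by
      obtain ⟨hB, hW, h0⟩ := hinv n (Nat.lt_of_succ_lt hn')
      refine (noiseIterate_step hwell hunb hcov h4 hopt hn he hZ γ n hW h0 i
        (noiseLevel_nonneg hcov he γ hασ hσ n i) (hnoise n hn' hB hW i)).2.2 _ ?_ ?_
      · refine @Finset.measurable_sum _ _ _ _ _ _ (past Z n) _ _ fun s hs => ?_
        refine @measurable_dot _ Ω (past Z n) _ _ (@measurable_const _ _ _ (past Z n) _) ?_
        exact @measurable_noiseIterate p M m Ω (past Z n) Z s (fun r hr => measurable_past Z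
          (hr.trans_le (Nat.lt_succ_iff.mp (Finset.mem_range.mp hs)))) γ vstar
      · exact memLp_finsetSum _ fun s hs => memLp_dot' (hinv s
          ((Finset.mem_range.mp hs).trans_le (Nat.le_of_succ_le hn'))).2.1 (u i))
  simpa only [sub_sub_cancel] using h

end

end Model

/-! ### The cut-off index and the excess risk bound -/

theorem kStar_le {M : ℕ} (lam : Fin M → ℝ) (γ : ℝ) (N : ℕ) : kStar lam γ N ≤ M :=
  Finset.sup_le fun i _ => i.2

theorem pos_of_lt_kStar {M : ℕ} {lam : Fin M → ℝ} (hlam : Antitone lam) {γ : ℝ} (hγ : 0 < γ)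
    {N : ℕ} (hN : 0 < N) {i : Fin M} (hi : (i : ℕ) < kStar lam γ N) : 0 < lam i := by
  rw [kStar, Finset.lt_sup_iff] at hi
  obtain ⟨j, hj, hij⟩ := hi
  have h1 : 1 / (γ * N) ≤ lam j := (Finset.mem_filter.mp hj).2
  have h2 : lam j ≤ lam i := hlam (Fin.le_def.mpr (Nat.lt_succ_iff.mp hij))
  have h3 : (0 : ℝ) < N := Nat.cast_pos.mpr hN
  have h4 : 0 < 1 / (γ * N) := by positivity
  linarith

theorem normSq_zero_mat {M : ℕ} (a : Fin M → ℝ) :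
    normSq (0 : Matrix (Fin M) (Fin M) ℝ) a = 0 := by
  simp [normSq]

theorem normSq_headProj {M : ℕ} (u : Fin M → Fin M → ℝ) (k : ℕ) (v : Fin M → ℝ) :
    normSq (headProj u k) v = ∑ i : Fin M, if (i : ℕ) < k then (u i ⬝ᵥ v) ^ 2 else 0 := by
  rw [headProj, normSq_sum]
  exact Finset.sum_congr rfl fun i _ => by split_ifs <;> simp [normSq_outer, normSq_zero_mat]

theorem normSq_headInv {M : ℕ} (lam : Fin M → ℝ) (u : Fin M → Fin M → ℝ) (k : ℕ)
    (v : Fin M → ℝ) : normSq (headInv lam u k) v =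
      ∑ i : Fin M, if (i : ℕ) < k then (lam i)⁻¹ * (u i ⬝ᵥ v) ^ 2 else 0 := by
  rw [headInv, normSq_sum]
  exact Finset.sum_congr rfl fun i _ => by
    split_ifs <;> simp [normSq_smul, normSq_outer, normSq_zero_mat]

theorem normSq_tailH {M : ℕ} (lam : Fin M → ℝ) (u : Fin M → Fin M → ℝ) (k : ℕ)
    (v : Fin M → ℝ) : normSq (tailH lam u k) v =
      ∑ i : Fin M, if (i : ℕ) < k then 0 else lam i * (u i ⬝ᵥ v) ^ 2 := by
  rw [tailH, normSq_sum]
  exact Finset.sum_congr rfl fun i _ => by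
    split_ifs <;> simp [normSq_smul, normSq_outer, normSq_zero_mat]

namespace Model

variable {p : ℕ∞} {M : ℕ} {m : Model p M}

theorem dot_deviation {Ω : Type*} (Z : ℕ → Ω → m.Sample) (γ : ℝ) {N : ℕ} (hN : 0 < N)
    (vstar a : Fin M → ℝ) (ω : Ω) :
    a ⬝ᵥ m.deviation Z γ N vstar ω = -(N : ℝ)⁻¹ *
      (∑ t ∈ Finset.range N, a ⬝ᵥ biasIterate m γ vstar (fun s => Z s ω) t +
        ∑ t ∈ Finset.range N, a ⬝ᵥ noiseIterate m γ vstar (fun s => Z s ω) t) := by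
  have hN' : (N : ℝ) ≠ 0 := Nat.cast_ne_zero.mpr hN.ne'
  simp only [deviation, average, noiseIterate, dotProduct_sub, dotProduct_smul, dotProduct_sum,
    Finset.sum_sub_distrib, Finset.sum_const, Finset.card_range, smul_eq_mul, nsmul_eq_mul]
  field_simp
  ring

section

variable (hwell : m.WellPosed) (hunb : m.UnbiasedQuantization) (hcov : m.DataCovariance)
  {α β : ℝ} (h4 : m.FourthMomentCondition α β) {vstar : Fin M → ℝ}
  (hopt : ∀ v, m.riskq vstar ≤ m.riskq v) {σlo σhi : ℝ} (hn : m.NoiseCondition vstar σlo σhi)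
  {lam : Fin M → ℝ} {u : Fin M → Fin M → ℝ} (he : IsEigendecomposition m.covHf lam u)
  {Ω : Type*} [MeasurableSpace Ω] {μ : Measure Ω} [IsProbabilityMeasure μ]
  {Z : ℕ → Ω → m.Sample} (hZ : m.IsSampling μ Z) {γ : ℝ} (hγ : 0 < γ)

include hcov h4 he hγ in
-- A positive eigenvalue forces α ≥ 1, and then λ_i ≤ tr H ≤ a tr H.
theorem stepsize_mul_eigenvalue_le {a : ℝ} (hαa : α ≤ a) (htr : γ * (a * m.covHf.trace) < 1)
    (i : Fin M) : γ * lam i ≤ 1 := by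
  have hl : ∀ j, 0 ≤ lam j := fun j => he.normSq_vec j ▸ hcov.normSq_covHf_nonneg _
  rcases (hl i).eq_or_lt with h | h
  · rw [← h, mul_zero]; exact zero_le_one
  have ha : 1 ≤ a := (h4.one_le he h).trans hαa
  have h1 : lam i ≤ m.covHf.trace := by
    rw [he.trace_eq]; exact Finset.single_le_sum (fun j _ => hl j) (Finset.mem_univ i)
  have h2 : m.covHf.trace ≤ a * m.covHf.trace :=
    le_mul_of_one_le_left (h.le.trans h1) ha
  exact (mul_le_mul_of_nonneg_left (h1.trans h2) hγ.le).trans htr.le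

include hwell hunb hcov h4 hopt hn he hZ hγ

/-- The excess risk bound for an effective noise level `σ2` and an effective fourth-moment
constant `a` that dominate the quantization noise. -/
theorem excessRisk_le {N : ℕ} (hN : 0 < N) {a σ2 : ℝ} (hαa : α ≤ a) (hσ : σhi ^ 2 ≤ σ2)
    (hnoise : ∀ t, t + 1 < N →
      (∀ i, MemLp (fun ω => biasIterate m γ vstar (fun s => Z s ω) t i) 2 μ) →
      (∀ i, MemLp (fun ω => noiseIterate m γ vstar (fun s => Z s ω) t i) 2 μ) → ∀ i,
      ∫⁻ ω, ENNReal.ofReal ((m.feature (Z t ω) ⬝ᵥ u i) ^ 2) *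
        m.quantNoise (Z t ω) (m.randIterate Z γ t ω) ∂μ ≤
      ENNReal.ofReal (lam i * (σ2 - σhi ^ 2 + (a - α) *
        (∫ ω, normSq m.covHf (biasIterate m γ vstar (fun s => Z s ω) t) ∂μ +
          ∫ ω, normSq m.covHf (noiseIterate m γ vstar (fun s => Z s ω) t) ∂μ))))
    (htr : γ * (a * m.covHf.trace) < 1) :
    (∀ i, MemLp (fun ω => m.deviation Z γ N vstar ω i) 2 μ) ∧
      m.excessRisk μ Z γ N vstar ≤
        2 * biasBound lam u γ N vstar + 2 * varBound m.covHf lam u γ N vstar a σ2 := by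
  have hN' : (0 : ℝ) < N := Nat.cast_pos.mpr hN
  have hl : ∀ j, 0 ≤ lam j := fun j => he.normSq_vec j ▸ hcov.normSq_covHf_nonneg _
  have hγl := stepsize_mul_eigenvalue_le hcov h4 he hγ hαa htr
  have hinv := iterates_memLp hwell hunb hcov h4 hopt hn he hZ γ hαa hσ hnoise
  set SB : Fin M → Ω → ℝ := fun i ω =>
    ∑ t ∈ Finset.range N, u i ⬝ᵥ biasIterate m γ vstar (fun s => Z s ω) t with hSB
  set SW : Fin M → Ω → ℝ := fun i ω =>
    ∑ t ∈ Finset.range N, u i ⬝ᵥ noiseIterate m γ vstar (fun s => Z s ω) t with hSW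
  have hSB2 : ∀ i, MemLp (SB i) 2 μ := fun i => memLp_finsetSum _ fun s hs =>
    memLp_dot' (hinv s (Finset.mem_range.mp hs)).1 (u i)
  have hSW2 : ∀ i, MemLp (SW i) 2 μ := fun i => memLp_finsetSum _ fun s hs =>
    memLp_dot' (hinv s (Finset.mem_range.mp hs)).2.1 (u i)
  have hdev : ∀ i ω, u i ⬝ᵥ m.deviation Z γ N vstar ω = -(N : ℝ)⁻¹ * (SB i ω + SW i ω) :=
    fun i ω => dot_deviation Z γ hN vstar (u i) ω
  have hdev2 : ∀ i, MemLp (fun ω => u i ⬝ᵥ m.deviation Z γ N vstar ω) 2 μ := fun i => by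
    simp only [hdev]
    exact ((hSB2 i).add (hSW2 i)).const_mul _
  have hmem := he.memLp hdev2
  refine ⟨hmem, ?_⟩
  have hrisk : m.excessRisk μ Z γ N vstar =
      1 / 2 * ∑ i, lam i * ∫ ω, (u i ⬝ᵥ m.deviation Z γ N vstar ω) ^ 2 ∂μ := by
    rw [excessRisk, he.trace_transpose_mul]
    congr 1
    refine Finset.sum_congr rfl fun i _ => ?_
    rw [normSq_matE]
    · simp only [normSq_outer, dotProduct_comm (u i)]
    · exact fun j k => (hmem j).integrable_mul (hmem k)
  set d : Fin M → ℕ → ℝ := fun i t =>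
    ∫ ω, (u i ⬝ᵥ biasIterate m γ vstar (fun s => Z s ω) t) ^ 2 ∂μ +
      ∫ ω, (u i ⬝ᵥ noiseIterate m γ vstar (fun s => Z s ω) t) ^ 2 ∂μ with hd
  -- The ½ of the risk cancels against (p + q)² ≤ 2p² + 2q² for the bias and noise sums; the
  -- remaining 2 is the one of `average_sq_le`.
  have hterm : ∀ i, 1 / 2 * (lam i * ∫ ω, (u i ⬝ᵥ m.deviation Z γ N vstar ω) ^ 2 ∂μ) ≤
      2 * ((1 - (1 - γ * lam i) ^ N) * (∑ t ∈ Finset.range N, d i t) / (γ * N ^ 2)) := by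
    intro i
    have h1 := average_sq_le_biasIterate hwell hunb hcov h4 hopt hn he hZ γ hαa hσ hnoise hγ i
      (hγl i)
    have h2 := average_sq_le_noiseIterate hwell hunb hcov h4 hopt hn he hZ γ hαa hσ hnoise hγ i
      (hγl i)
    have i1 := (hSB2 i).integrable_sq
    have i2 := (hSW2 i).integrable_sq
    have i12 : Integrable (fun ω => ((N : ℝ)⁻¹) ^ 2 * (2 * (SB i ω ^ 2 + SW i ω ^ 2))) μ :=
      ((i1.add i2).const_mul 2).const_mul _
    have h3 : ∫ ω, (u i ⬝ᵥ m.deviation Z γ N vstar ω) ^ 2 ∂μ ≤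
        ((N : ℝ)⁻¹) ^ 2 * (2 * (∫ ω, SB i ω ^ 2 ∂μ + ∫ ω, SW i ω ^ 2 ∂μ)) := by
      rw [← integral_add i1 i2, ← integral_const_mul, ← integral_const_mul]
      refine integral_mono (hdev2 i).integrable_sq i12 fun ω => ?_
      simp only [hdev]
      rw [mul_pow, neg_sq]
      refine mul_le_mul_of_nonneg_left ?_ (sq_nonneg _)
      linarith [sq_nonneg (SB i ω - SW i ω)]
    have h4 : ∑ t ∈ Finset.range N, d i t =
        ∑ t ∈ Finset.range N, ∫ ω, (u i ⬝ᵥ biasIterate m γ vstar (fun s => Z s ω) t) ^ 2 ∂μ +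
        ∑ t ∈ Finset.range N, ∫ ω, (u i ⬝ᵥ noiseIterate m γ vstar (fun s => Z s ω) t) ^ 2 ∂μ :=
      Finset.sum_add_distrib
    rw [h4, mul_div_assoc', le_div_iff₀ (by positivity)]
    have h5 := mul_le_mul_of_nonneg_left h3 (show 0 ≤ 1 / 2 * lam i * (γ * N ^ 2) by
      have := hl i; positivity)
    have h6 : 1 / 2 * lam i * (γ * N ^ 2) * (((N : ℝ)⁻¹) ^ 2 *
        (2 * (∫ ω, SB i ω ^ 2 ∂μ + ∫ ω, SW i ω ^ 2 ∂μ))) =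
        γ * lam i * ∫ ω, SB i ω ^ 2 ∂μ + γ * lam i * ∫ ω, SW i ω ^ 2 ∂μ := by
      field_simp
    linarith
  have hspec := spectral_bound (c := fun i => u i ⬝ᵥ vstar) hN hγ (h4.pos_α.le.trans hαa)
    ((sq_nonneg σhi).trans hσ) hl hγl (by rwa [← he.trace_eq]) (d := d)
    (fun i t => add_nonneg (integral_nonneg fun _ => sq_nonneg _)
      (integral_nonneg fun _ => sq_nonneg _))
    (fun i => by simp [hd, noiseIterate_zero, biasIterate])
    (fun i t ht => secondMoment_rec hwell hunb hcov h4 hopt hn he hZ γ hαa hσ hnoise hγ i t ht)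
    (kStar_le lam γ N) (fun i hi => pos_of_lt_kStar he.antitone hγ hN hi)
  calc m.excessRisk μ Z γ N vstar
      ≤ ∑ i, 2 * ((1 - (1 - γ * lam i) ^ N) * (∑ t ∈ Finset.range N, d i t) / (γ * N ^ 2)) := by
        rw [hrisk, Finset.mul_sum]
        exact Finset.sum_le_sum fun i _ => hterm i
    _ ≤ _ := by
        rw [← Finset.mul_sum, ← mul_add]
        refine mul_le_mul_of_nonneg_left (hspec.trans_eq ?_) zero_le_two
        rw [biasBound, varBound, sigmaBias2, varFactor, normSq_headProj, normSq_headInv,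
          normSq_tailH, he.trace_eq, mul_assoc γ]

omit hwell hunb hopt hn hγ in
-- The parameter error is independent of the fresh feature, so its expectation suffices, at the
-- price of αλ_i. The activation and gradient errors depend on that feature, so they are taken out
-- by their essential supremum, leaving E⟨x, u_i⟩² = λ_i.
theorem lintegral_quantNoise_le_sup {N t : ℕ} (ht : t < N)
    (i : Fin M) :
    ∫⁻ ω, ENNReal.ofReal ((m.feature (Z t ω) ⬝ᵥ u i) ^ 2) *
        m.quantNoise (Z t ω) (m.randIterate Z γ t ω) ∂μ ≤
      ENNReal.ofReal (lam i) * ((⨆ t : Fin N, ENNReal.ofReal α * m.paramErr μ Z γ t) +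
        ⨆ t : Fin N, essSup (m.actGradErr Z γ t) μ) := by
  have hvp : Measurable[past Z t] fun ω => m.randIterate Z γ t ω :=
    @measurable_iterate p M m Ω (past Z t) Z t (fun s hs => measurable_past Z hs) γ
  have hv : Measurable fun ω => m.randIterate Z γ t ω := hvp.mono (past_le hZ t) le_rfl
  have hx : Measurable fun ω => m.feature (Z t ω) := m.measurable_feature.comp (hZ.measurable t)
  have hxu : Measurable fun ω => ENNReal.ofReal ((m.feature (Z t ω) ⬝ᵥ u i) ^ 2) :=
    ((measurable_dot hx measurable_const).pow_const 2).ennreal_ofReal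
  obtain ⟨h1, h2⟩ := measurePreserving_state hZ hvp
  have : IsProbabilityMeasure (μ.map fun ω => m.randIterate Z γ t ω) :=
    Measure.isProbabilityMeasure_map h1.aemeasurable
  have hq : Measurable fun s : (Fin M → ℝ) × m.Sample => m.quantV s.2 s.1 - s.1 :=
    (m.measurable_quantV (f := fun s : (Fin M → ℝ) × m.Sample => s.2) measurable_snd
      measurable_fst).sub measurable_fst
  have hf : Measurable fun s : (Fin M → ℝ) × m.Sample => m.feature s.2 := by fun_prop
  have m1 : Measurable fun s : (Fin M → ℝ) × m.Sample =>
      ENNReal.ofReal ((m.feature s.2 ⬝ᵥ u i) ^ 2) *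
        ENNReal.ofReal ((m.feature s.2 ⬝ᵥ (m.quantV s.2 s.1 - s.1)) ^ 2) :=
    (((measurable_dot hf measurable_const).pow_const 2).ennreal_ofReal).mul
      ((measurable_dot hf hq).pow_const 2).ennreal_ofReal
  have m2 : Measurable fun s : (Fin M → ℝ) × m.Sample =>
      ENNReal.ofReal ((m.covHf * outer (m.quantV s.2 s.1 - s.1)).trace) := by
    simp only [trace_mul_outer]
    exact ((measurable_normSq _).comp hq).ennreal_ofReal
  have b1 : ∫⁻ ω, ENNReal.ofReal ((m.feature (Z t ω) ⬝ᵥ u i) ^ 2) *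
      ENNReal.ofReal ((m.feature (Z t ω) ⬝ᵥ (m.quantV (Z t ω) (m.randIterate Z γ t ω) -
        m.randIterate Z γ t ω)) ^ 2) ∂μ ≤
      ENNReal.ofReal (lam i) * (ENNReal.ofReal α * m.paramErr μ Z γ t) := by
    have e1 := h2.lintegral_comp m1
    have e2 := h2.lintegral_comp m2
    have e3 := lintegral_prod_paramErr_le hcov h4 (a := u i)
      (ρ := μ.map fun ω => m.randIterate Z γ t ω) measurable_id
    simp only [id] at e3
    rw [← e1, ← e2, he.normSq_vec, mul_comm α,
      ENNReal.ofReal_mul (he.normSq_vec i ▸ hcov.normSq_covHf_nonneg _), mul_assoc] at e3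
    exact e3
  have b2 : ∫⁻ ω, ENNReal.ofReal ((m.feature (Z t ω) ⬝ᵥ u i) ^ 2) * m.actGradErr Z γ t ω ∂μ ≤
      ENNReal.ofReal (lam i) * essSup (m.actGradErr Z γ t) μ := by
    calc _ ≤ ∫⁻ ω, ENNReal.ofReal ((m.feature (Z t ω) ⬝ᵥ u i) ^ 2) *
          essSup (m.actGradErr Z γ t) μ ∂μ := by
          refine lintegral_mono_ae ?_
          filter_upwards [ENNReal.ae_le_essSup (μ := μ) (m.actGradErr Z γ t)] with ω hω
          gcongr
      _ = _ := by
          rw [lintegral_mul_const _ hxu]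
          congr 1
          have hmp : MeasurePreserving (Z t) μ m.law := ⟨hZ.measurable t, hZ.law_eq t⟩
          have mz : Measurable fun z => ENNReal.ofReal ((m.feature z ⬝ᵥ u i) ^ 2) :=
            ((measurable_dot m.measurable_feature measurable_const).pow_const 2).ennreal_ofReal
          rw [← he.normSq_vec i, ← hcov.integral_dot_sq,
            ← lintegral_ofReal_sq (hcov.memLp_dot (u i))]
          exact hmp.lintegral_comp mz
  have hsplit : ∀ ω, ENNReal.ofReal ((m.feature (Z t ω) ⬝ᵥ u i) ^ 2) *
        m.quantNoise (Z t ω) (m.randIterate Z γ t ω) =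
      ENNReal.ofReal ((m.feature (Z t ω) ⬝ᵥ u i) ^ 2) *
        ENNReal.ofReal ((m.feature (Z t ω) ⬝ᵥ (m.quantV (Z t ω) (m.randIterate Z γ t ω) -
          m.randIterate Z γ t ω)) ^ 2) +
      ENNReal.ofReal ((m.feature (Z t ω) ⬝ᵥ u i) ^ 2) * m.actGradErr Z γ t ω := fun ω => by
    rw [quantNoise, actGradErr, add_assoc, mul_add]
  simp only [hsplit]
  have m3 : Measurable fun ω => ENNReal.ofReal ((m.feature (Z t ω) ⬝ᵥ u i) ^ 2) *
      ENNReal.ofReal ((m.feature (Z t ω) ⬝ᵥ (m.quantV (Z t ω) (m.randIterate Z γ t ω) -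
        m.randIterate Z γ t ω)) ^ 2) :=
    hxu.mul ((measurable_dot hx ((m.measurable_quantV (hZ.measurable t) hv).sub hv)).pow_const
      2).ennreal_ofReal
  rw [lintegral_add_left m3, mul_add]
  refine add_le_add (b1.trans ?_) (b2.trans ?_)
  · gcongr
    exact le_iSup (fun t : Fin N => ENNReal.ofReal α * m.paramErr μ Z γ t) ⟨t, ht⟩
  · gcongr
    exact le_iSup (fun t : Fin N => essSup (m.actGradErr Z γ t) μ) ⟨t, ht⟩

end

end Model

end QSGD

/-! ### The two quantization regimes -/

open QSGD
theorem mainTheorem5 {p : ℕ∞} {M : ℕ} (m : Model p M)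
    (hwell : m.WellPosed) (hunb : m.UnbiasedQuantization) (hcov : m.DataCovariance)
    (α β : ℝ) (hfourth : m.FourthMomentCondition α β)
    (vstar : Fin M → ℝ) (hopt : ∀ v, m.riskq vstar ≤ m.riskq v)
    (σlo σhi : ℝ) (hnoise : m.NoiseCondition vstar σlo σhi)
    (lam : Fin M → ℝ) (u : Fin M → Fin M → ℝ) (heig : IsEigendecomposition m.covHf lam u)
    {Ω : Type*} [MeasurableSpace Ω] (μ : Measure Ω) [IsProbabilityMeasure μ]
    (Z : ℕ → Ω → m.Sample) (hZ : m.IsSampling μ Z)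
    (N : ℕ) (hN : 0 < N) (γ : ℝ) (hγ : 0 < γ) :
    (γ * (α * m.covHf.trace) < 1 → m.sigmaG2 μ Z γ N α σhi ≠ ∞ →
      (∀ i, MemLp (fun ω => m.deviation Z γ N vstar ω i) 2 μ) ∧
      m.excessRisk μ Z γ N vstar ≤
        2 * biasBound lam u γ N vstar +
        2 * varBound m.covHf lam u γ N vstar α (m.sigmaG2 μ Z γ N α σhi).toReal) ∧
    (∀ εp εa εo : ℝ, 0 ≤ εp → 0 ≤ εa → 0 ≤ εo →
      m.Qp.Multiplicative εp → m.Qa.Multiplicative εa → m.Qo.Multiplicative εo →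
      γ * ((1 + epsTilde εp εa εo) * α * m.covHf.trace) < 1 →
      (∀ i, MemLp (fun ω => m.deviation Z γ N vstar ω i) 2 μ) ∧
      m.excessRisk μ Z γ N vstar ≤
        2 * biasBound lam u γ N vstar +
        2 * varBound m.covHf lam u γ N vstar ((1 + epsTilde εp εa εo) * α)
          (sigmaM2 m.covHf vstar α σhi εp εa εo)) := by
  have hα := hfourth.pos_α
  have hl : ∀ j, 0 ≤ lam j := fun j => heig.normSq_vec j ▸ hcov.normSq_covHf_nonneg _
  refine ⟨fun htr hfin => ?_, fun εp εa εo hp0 ha0 ho0 hQp hQa hQo htr => ?_⟩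
  · have hsplit : m.sigmaG2 μ Z γ N α σhi = ENNReal.ofReal (σhi ^ 2) +
        ((⨆ t : Fin N, ENNReal.ofReal α * m.paramErr μ Z γ t) +
          ⨆ t : Fin N, essSup (m.actGradErr Z γ t) μ) := add_assoc _ _ _
    rw [hsplit] at hfin ⊢
    have hQ := (ENNReal.add_ne_top.mp hfin).2
    have hbound := fun t (ht : t < N) i =>
      Model.lintegral_quantNoise_le_sup hcov hfourth heig hZ (γ := γ) ht i
    rw [ENNReal.toReal_add ENNReal.ofReal_ne_top hQ, ENNReal.toReal_ofReal (sq_nonneg _)]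
    generalize ((⨆ t : Fin N, ENNReal.ofReal α * m.paramErr μ Z γ t) +
          ⨆ t : Fin N, essSup (m.actGradErr Z γ t) μ) = Q at hQ hbound
    -- Here a = α, so the state-dependent part (a - α) of the allowed noise vanishes and all noise
    -- is charged to σ_G².
    refine Model.excessRisk_le hwell hunb hcov hfourth hopt hnoise heig hZ hγ hN le_rfl
      (le_add_of_nonneg_right ENNReal.toReal_nonneg) (fun t ht _ _ i => ?_) htr
    rw [sub_self, zero_mul, add_zero, add_sub_cancel_left, ENNReal.ofReal_mul (hl i),
      ENNReal.ofReal_toReal hQ]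
    exact hbound t (Nat.lt_of_succ_lt ht) i
  · have hε : 0 ≤ epsTilde εp εa εo := by unfold epsTilde; positivity
    have hσ : σhi ^ 2 ≤ sigmaM2 m.covHf vstar α σhi εp εa εo := by
      have h1 := hcov.normSq_covHf_nonneg vstar
      have h2 : 0 ≤ (2 * εo + 1) * (2 * εp + 2 * (1 + εp) * εa) * α * normSq m.covHf vstar := by
        positivity
      have h3 : 0 ≤ εo * σhi ^ 2 := by positivity
      rw [sigmaM2, trace_mul_outer]
      linarith
    refine Model.excessRisk_le hwell hunb hcov hfourth hopt hnoise heig hZ hγ hN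
      (le_mul_of_one_le_left hα.le (by linarith)) hσ (fun t ht hB hW i => ?_) htr
    -- The pair (v_t, B_t) suffices as state, because W_t = v_t - v* - B_t.
    have hvp : Measurable[Model.past Z t] fun ω => (m.randIterate Z γ t ω,
        Model.biasIterate m γ vstar (fun s => Z s ω) t) :=
      @Measurable.prodMk _ (Model.past Z t) _ _ _ _ _ _
        (@Model.measurable_iterate p M m Ω (Model.past Z t) Z t
          (fun s hs => Model.measurable_past Z hs) γ)
        (@Model.measurable_biasIterate p M m Ω (Model.past Z t) Z t
          (fun s hs => Model.measurable_past Z hs) γ vstar)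
    obtain ⟨h1, h2⟩ := Model.measurePreserving_state hZ hvp
    have := Measure.isProbabilityMeasure_map (μ := μ) h1.aemeasurable
    have mb : Measurable fun s : (Fin M → ℝ) × (Fin M → ℝ) => s.2 := measurable_snd
    have mw : Measurable fun s : (Fin M → ℝ) × (Fin M → ℝ) => s.1 - vstar - s.2 :=
      (measurable_fst.sub measurable_const).sub measurable_snd
    have key := Model.lintegral_prod_quantNoise_le (a := u i) hcov hfourth (v := Prod.fst)
      (b := fun s => s.2) (w := fun s => s.1 - vstar - s.2) hwell hnoise hunb hp0 ha0 ho0 hQp hQa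
      hQo (fun j => (memLp_comp_of_measurePreserving h1 ((measurable_pi_apply j).comp mb)).mp (hB j))
      (fun j => (memLp_comp_of_measurePreserving h1 ((measurable_pi_apply j).comp mw)).mp (hW j))
      (fun s => by abel)
    have mq : Measurable fun s : ((Fin M → ℝ) × (Fin M → ℝ)) × m.Sample =>
        ENNReal.ofReal ((m.feature s.2 ⬝ᵥ u i) ^ 2) * m.quantNoise s.2 s.1.1 :=
      ((Model.measurable_dot (m.measurable_feature.comp measurable_snd)
        measurable_const).pow_const 2).ennreal_ofReal.mul
        (m.measurable_quantNoise (f := fun s : ((Fin M → ℝ) × (Fin M → ℝ)) × m.Sample => s.2)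
          measurable_snd (measurable_fst.comp measurable_fst))
    have e1 := integral_comp_of_measurePreserving h1 ((Model.measurable_normSq m.covHf).comp mb)
    have e2 := integral_comp_of_measurePreserving h1 ((Model.measurable_normSq m.covHf).comp mw)
    simp only [Function.comp_apply] at e1 e2
    rw [← h2.lintegral_comp mq, ← e1, ← e2, heig.normSq_vec] at key
    refine key.trans_eq ?_
    rw [add_mul, one_mul, add_sub_cancel_left]
    rfl
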